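/- Let $(Z,d)$ be a complete separable metric space with its Borel $\sigma$-field, and let $\nu$ be a $\sigma$-finite Radon (i.e. locally finite) measure on $Z$. Let $S$ be one of the following spaces of measures on $Z$, with the $\sigma$-field generated by the maps $\xi\mapsto\xi(A)$, $A\subset Z$ Borel: (i) $S=\mathcal M_{\bar{\mathbb N}}(Z)$, the measures whose restriction to every closed ball is a finite sum of Dirac masses, provided that $\nu$ is finite on every closed ball; (ii) $S$ is the set of the measures such that every point of $Z$ has an open neighbourhood to which the restriction of the measure is a finite sum of Dirac masses; (iii) $S=\mathcal M_b(Z)$, the finite measures on $Z$, provided that $\nu(Z)<\infty$. Then there is exactly one probability measure $\Pi_\nu$ on $S$ which is the law of a Poisson point process with intensity $\nu$, i.e. such that for all pairwise disjoint Borel sets $A_1,\dots,A_l$ with $\nu(A_i)<\infty$ the variables $\eta\mapsto\eta(A_i)$ are, under $\Pi_\nu$, independent and Poisson distributed with means $\nu(A_i)$. For probability measures $\Pi_1,\Pi_2$ on $S$ let $H(\Pi_i|\Pi_\nu)\in[0,\infty]$ be the relative entropy, and for $\alpha:[0,1]\to[0,\infty]$ put $$c_\alpha(\xi,\Pi)=\int\alpha\Big(\int\Big[1-\frac{\chi(\{x\})}{\xi(\{x\})}\Big]_+\Pi(d\chi)\Big)\,\xi(dx),\qquad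 \mathcal T_{c_\alpha}(\Pi_2|\Pi_1)=\inf\int c_\alpha(\xi,p_\xi)\,\Pi_1(d\xi),$$ the infimum being over all couplings $N(d\xi\,d\chi)=p_\xi(d\chi)\,\Pi_1(d\xi)$ of $\Pi_1$ and $\Pi_2$, with $p$ a probability kernel (where $\frac00=0$ and $\frac b0=\infty$ for $b>0$, which is immaterial for sums of Dirac masses). For $t\in(0,1)$ and $u\in[0,1]$ let $$\alpha_t(u)=\frac{t(1-u)\log(1-u)-(1-tu)\log(1-tu)}{t(1-t)},$$ and let $\alpha_0(u)=(1-u)\log(1-u)+u$ and $\alpha_1(u)=-u-\log(1-u)$, with $0\log0=0$ and $\alpha_1(1)=\infty$. Then for every $t\in[0,1]$ and all probability measures $\Pi_1,\Pi_2$ on $S$, $$\mathcal T_{c_{\alpha_t}}(\Pi_2|\Pi_1)\le\frac1t\,H(\Pi_1|\Pi_\nu)+\frac1{1-t}\,H(\Pi_2|\Pi_\nu),$$ with $\frac10=\infty$ and $\infty\cdot0=0$. Moreover the Marton-type inequality $$\mathcal T_{c_\alpha}(\Pi_2|\Pi_1)\le4\,H(\Pi_1|\Pi_\nu)+4\,H(\Pi_2|\Pi_\nu)\quad\text{with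 }\alpha(u)=u^2$$ holds for all probability measures $\Pi_1,\Pi_2$ on $S$. -/

import Mathlib

open MeasureTheory ProbabilityTheory
open scoped ENNReal

noncomputable section

/-! ### Generalized optimal transport and transport-entropy inequalities -/

section Transport

variable {E : Type*} [MeasurableSpace E]

/-- The generalized optimal transport cost `T_c(P₂ | P₁)`: the infimum of `∫ c(x, p_x) P₁(dx)` over all
couplings `N(dx dy) = p_x(dy) P₁(dx)` of `P₁` and `P₂`, where `p` is a disintegration kernel
of `N` along its first marginal `P₁`. -/
def transportCost (c : E → Measure E → ℝ≥0∞) (P₂ P₁ : Measure E) : ℝ≥0∞ :=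
  ⨅ (N : Measure (E × E)) (p : Kernel E E) (_ : IsMarkovKernel p)
    (_ : N.fst = P₁) (_ : N.snd = P₂) (_ : N = P₁ ⊗ₘ p), ∫⁻ x, c x (p x) ∂P₁

/-- `γ` satisfies the transport-entropy inequality for the cost `c` with constants `a₁`, `a₂`:
`T_c(P₂ | P₁) ≤ a₁ H(P₁ | γ) + a₂ H(P₂ | γ)` for all probability measures `P₁`, `P₂`.
Here `∞ * 0 = 0`, and `klDiv P γ` is the relative entropy `∫ log (dP/dγ) dP` of the probability
measure `P` (it is `∞` if `P` is not absolutely continuous with respect to `γ`). -/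
def TransportEntropyInequality (c : E → Measure E → ℝ≥0∞) (a₁ a₂ : ℝ≥0∞)
    (γ : Measure E) : Prop :=
  ∀ P₁ P₂ : Measure E, IsProbabilityMeasure P₁ → IsProbabilityMeasure P₂ →
    transportCost c P₂ P₁ ≤
      a₁ * InformationTheory.klDiv P₁ γ + a₂ * InformationTheory.klDiv P₂ γ

end Transport

/-- Dembo's function `α_t` on `[0, 1]`, for `t ∈ [0, 1]`. The values `t = 0`, `t = 1` are the limits of the
general formula, and `α_1 1 = ∞`. -/
def demboFunction (t u : ℝ) : ℝ≥0∞ :=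
  if t = 0 then ENNReal.ofReal ((1 - u) * Real.log (1 - u) + u)
  else if t = 1 then (if u < 1 then ENNReal.ofReal (-u - Real.log (1 - u)) else ∞)
  else ENNReal.ofReal
    ((t * (1 - u) * Real.log (1 - u) - (1 - t * u) * Real.log (1 - t * u)) / (t * (1 - t)))

/-! ### Configurations

Sets `S` of measures on `Z` carry the `σ`-field generated by the evaluations `ξ ↦ ξ A`, `A` measurable
(Mathlib's `σ`-field on `Measure Z`, restricted to the subtype). -/

section Configurations

variable {Z : Type*} [MeasurableSpace Z]

/-- A finite configuration: a finite sum of Dirac masses. -/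
def IsFiniteConfiguration (ξ : Measure Z) : Prop :=
  ∃ (k : ℕ) (a : Fin k → Z), ξ = ∑ i, Measure.dirac (a i)

variable (Z) in
/-- The space of measures whose restriction to every closed ball is a finite configuration. -/
def configurations [PseudoMetricSpace Z] : Set (Measure Z) :=
  {ξ | ∀ (x : Z) (r : ℝ), IsFiniteConfiguration (ξ.restrict (Metric.closedBall x r))}

variable (Z) in
/-- The space of measures whose restriction to some open neighbourhood of each point is a
finite configuration. -/
def locallyFiniteConfigurations [TopologicalSpace Z] : Set (Measure Z) :=
  {ξ | ∀ x : Z, ∃ U : Set Z, IsOpen U ∧ x ∈ U ∧ IsFiniteConfiguration (ξ.restrict U)}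

variable (Z) in
/-- The space of finite measures. -/
def finiteMeasures : Set (Measure Z) := {ξ | IsFiniteMeasure ξ}

/-- `P`, a measure on the space `S` of measures on `Z`, is the law of a Poisson point process with
intensity measure `ν`: for pairwise disjoint measurable `A₁, …, A_l` of finite `ν`-measure,
the variables `η(A₁), …, η(A_l)` are independent and `η(A_i)` has the Poisson
distribution with mean `ν(A_i)`. -/
def IsPoissonLaw {S : Set (Measure Z)} (ν : Measure Z) (P : Measure S) : Prop :=
  IsProbabilityMeasure P ∧
  ∀ (l : ℕ) (A : Fin l → Set Z), (∀ i, MeasurableSet (A i)) →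
    Pairwise (Function.onFun Disjoint A) → (∀ i, ν (A i) < ∞) →
    iIndepFun (fun i (η : S) => (η : Measure Z) (A i)) P ∧
    ∀ i, P.map (fun η : S => (η : Measure Z) (A i)) =
      (poissonMeasure (ν (A i)).toNNReal).map (fun n : ℕ => (n : ℝ≥0∞))

/-- The cost `c(ξ, P) = ∫ α(∫ [1 - χ({x}) / ξ({x})]₊ P(dχ)) ξ(dx)`. The subtraction of
extended nonnegative numbers is truncated at `0`, hence is the positive part. -/
def martonCost {S : Set (Measure Z)} (α : ℝ → ℝ≥0∞) (ξ : S) (P : Measure S) : ℝ≥0∞ :=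
  ∫⁻ x, α (∫⁻ χ : S, (1 - (χ : Measure Z) {x} / (ξ : Measure Z) {x}) ∂P).toReal ∂(ξ : Measure Z)

end Configurations

end

/-!
The Poisson point process is a superposition of independent cells: if `ν` is a countable sum of measures
`r i • π i` with probability measures `π i`, the cell `i` is a Poisson number with mean `r i` of independent points
with law `π i` (`iIndepFun_superpose`, by characteristic functions, which gives existence of the Poisson law).
Uniqueness holds because the joint law of `η(A₁), …, η(A_l)` is determined by the atoms of the algebra generated by
the `A_i` (`IsPoissonLaw.unique`).

For the transport inequality, let `f₁` and `f₂` be densities with respect to the product law of the cells.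
They are coupled sequentially: given the past, the next coordinate of the pair has the maximal coupling of the two
conditional laws. Under it a coordinate with conditional densities `a` and `b` changes with probability `(1 - b / a)₊`.
Given the whole first sequence, the probability that the coordinate `i` changes is the mean of `(1 - b / a)₊` over the
past of the second sequence only (`exists_sequentialCoupling`), so that Jensen's inequality for the convex function
`α` reduces the cost to the pointwise inequality `a α((1 - b / a)₊) ≤ c₁ φ(a) + c₂ φ(b)` with
`φ(x) = x log x - x + 1` (`CostEntropyBound`). For `α_t` and `c₁ = 1 / t`, `c₂ = 1 / (1 - t)` the difference of the two
sides is `φ((1 - t) a + t b) / (t (1 - t)) ≥ 0` if `b < a`. The sum over the coordinates is bounded by means of the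
chain rule for the relative entropy (`tsum_lintegral_entropyFun_nextDensity_le`).

A configuration `ξ` is lifted to a sequence of cells by a conditional distribution, its cells are moved by the
coupling, and the result is superposed again. A point `x` can only be lost together with a cell containing it, so by
Jensen's inequality the cost is at most the sum over the cells of their number of points times `α` of the
probability of change (`transportCost_martonCost_le`). Here a cell counts with its number of points and not just
once, but the excess is due to cells with at least two points, and it vanishes as the means of the cells tend to `0`.
For bounded `α` this follows from Young's inequality (`tsum_lintegral_count_cost_le_of_le`). For the unbounded function
`α_1` only `Π₂ = Π_ν` matters. There it is shown first for bounded densities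
(`tsum_lintegral_count_cost_demboFunction_one_le`), and general densities are cut at rapidly increasing levels along
which the transport kernels are glued (`transportCost_le_of_bounded`).
-/

set_option linter.unusedSectionVars false

noncomputable section

/-! ### Conditional densities with respect to an infinite product -/

section HeadDensity

variable {E : Type*} [MeasurableSpace E]

/-- The sequence with the first `n` terms of `x` and the remaining terms of `z`. -/
def splice (n : ℕ) (x z : ℕ → E) : ℕ → E := fun i => if i < n then x i else z i

lemma measurable_splice (n : ℕ) : Measurable fun q : (ℕ → E) × (ℕ → E) => splice n q.1 q.2 := by
  refine measurable_pi_lambda _ fun i => ?_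
  unfold splice
  split_ifs <;> fun_prop

lemma measurable_update_pair (n : ℕ) :
    Measurable fun q : (ℕ → E) × E => Function.update q.1 n q.2 := by
  refine measurable_pi_lambda _ fun i => ?_
  by_cases h : i = n
  · subst h; simpa using measurable_snd
  · simp only [Function.update_of_ne h]; fun_prop

lemma splice_zero (x z : ℕ → E) : splice 0 x z = z := by
  ext i; simp [splice]

lemma splice_succ_update (n : ℕ) (x z : ℕ → E) (e : E) :
    splice (n + 1) (Function.update x n e) z = splice n x (Function.update z n e) := by
  ext i
  unfold splice
  rcases lt_trichotomy i n with h | h | h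
  · simp [h, h.ne, Nat.lt_succ_of_lt h]
  · subst h; simp
  · have h1 : ¬ i < n := by omega
    have h2 : ¬ i < n + 1 := by omega
    simp [h1, h2, h.ne']

variable (μ : ℕ → Measure E) [∀ i, IsProbabilityMeasure (μ i)]

/-- Replacing the first `n` coordinates by an independent copy of them does not change the product law. -/
lemma map_splice (n : ℕ) :
    ((Measure.infinitePi μ).prod (Measure.infinitePi μ)).map (fun q => splice n q.1 q.2) =
      Measure.infinitePi μ := by
  apply Measure.eq_infinitePi
  intro s t ht
  rw [Measure.map_apply (measurable_splice n) (.pi s.countable_toSet fun i _ => ht i)]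
  have hpre : (fun q : (ℕ → E) × (ℕ → E) => splice n q.1 q.2) ⁻¹' Set.pi s t =
      (Set.pi (s.filter (· < n)) t) ×ˢ (Set.pi (s.filter (¬ · < n)) t) := by
    ext q
    simp only [Set.mem_preimage, Set.mem_pi, Set.mem_prod, splice, Finset.coe_filter,
      Set.mem_ofPred_eq, Finset.mem_coe]
    constructor
    · intro h
      refine ⟨fun i hi => ?_, fun i hi => ?_⟩
      · simpa [hi.2] using h i hi.1
      · simpa [hi.2] using h i hi.1
    · rintro ⟨h1, h2⟩ i hi
      split_ifs with hin
      · exact h1 i ⟨hi, hin⟩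
      · exact h2 i ⟨hi, hin⟩
  rw [hpre, Measure.prod_prod, Measure.infinitePi_pi μ fun i _ => ht i,
    Measure.infinitePi_pi μ fun i _ => ht i, Finset.prod_filter_mul_prod_filter_not]

lemma map_update_infinitePi (n : ℕ) :
    ((Measure.infinitePi μ).prod (μ n)).map (fun q => Function.update q.1 n q.2) =
      Measure.infinitePi μ := by
  apply Measure.eq_infinitePi
  intro s t ht
  rw [Measure.map_apply (measurable_update_pair n) (.pi s.countable_toSet fun i _ => ht i)]
  have hpre : (fun q : (ℕ → E) × E => Function.update q.1 n q.2) ⁻¹' Set.pi s t =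
      (Set.pi (s.erase n) t) ×ˢ (if n ∈ s then t n else Set.univ) := by
    ext q
    simp only [Set.mem_preimage, Set.mem_pi, Set.mem_prod, Finset.mem_coe, Finset.mem_erase]
    constructor
    · intro h
      refine ⟨fun i hi => ?_, ?_⟩
      · simpa [hi.1] using h i hi.2
      · split_ifs with hn
        · simpa using h n hn
        · trivial
    · rintro ⟨h1, h2⟩ i hi
      by_cases hin : i = n
      · subst hin; simpa [hi] using h2
      · simpa [hin] using h1 i ⟨hin, hi⟩
  rw [hpre, Measure.prod_prod, Measure.infinitePi_pi μ fun i _ => ht i]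
  split_ifs with hn
  · rw [mul_comm, Finset.mul_prod_erase s (fun i => μ i (t i)) hn]
  · rw [Finset.erase_eq_of_notMem hn]; simp

lemma lintegral_splice (n : ℕ) {h : (ℕ → E) → ℝ≥0∞} (hh : Measurable h) :
    ∫⁻ x, ∫⁻ z, h (splice n x z) ∂Measure.infinitePi μ ∂Measure.infinitePi μ =
      ∫⁻ x, h x ∂Measure.infinitePi μ := by
  conv_rhs => rw [← map_splice μ n]
  rw [lintegral_map hh (measurable_splice n),
    lintegral_prod (fun q => h (splice n q.1 q.2)) (hh.comp (measurable_splice n)).aemeasurable]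

lemma lintegral_update_infinitePi (n : ℕ) {h : (ℕ → E) → ℝ≥0∞} (hh : Measurable h) :
    ∫⁻ x, ∫⁻ e, h (Function.update x n e) ∂μ n ∂Measure.infinitePi μ =
      ∫⁻ x, h x ∂Measure.infinitePi μ := by
  conv_rhs => rw [← map_update_infinitePi μ n]
  rw [lintegral_map hh (measurable_update_pair n),
    lintegral_prod (fun q => h (Function.update q.1 n q.2))
      (hh.comp (measurable_update_pair n)).aemeasurable]

/-- The density of the law of the first `n` coordinates under `f • ⨂ μ`, as a function on the whole
sequence space. -/
def headDensity (f : (ℕ → E) → ℝ≥0∞) (n : ℕ) (x : ℕ → E) : ℝ≥0∞ :=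
  ∫⁻ z, f (splice n x z) ∂Measure.infinitePi μ

/-- The conditional density of the `n`-th coordinate given the previous ones under `f • ⨂ μ`; it is
set to `1` where the density of the previous coordinates is degenerate. -/
def nextDensity (f : (ℕ → E) → ℝ≥0∞) (n : ℕ) (x : ℕ → E) (e : E) : ℝ≥0∞ :=
  if headDensity μ f n x = 0 ∨ headDensity μ f n x = ∞ then 1
  else headDensity μ f (n + 1) (Function.update x n e) / headDensity μ f n x

variable {f : (ℕ → E) → ℝ≥0∞}

lemma measurable_headDensity (hf : Measurable f) (n : ℕ) : Measurable (headDensity μ f n) :=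
  (hf.comp (measurable_splice n)).lintegral_prod_right'

lemma measurable_nextDensity (hf : Measurable f) (n : ℕ) :
    Measurable fun q : (ℕ → E) × E => nextDensity μ f n q.1 q.2 := by
  have h1 : Measurable fun q : (ℕ → E) × E => headDensity μ f n q.1 :=
    (measurable_headDensity μ hf n).comp measurable_fst
  refine Measurable.ite ?_ measurable_const ?_
  · exact (h1 (measurableSet_singleton 0)).union (h1 (measurableSet_singleton ∞))
  · exact ((measurable_headDensity μ hf (n + 1)).comp (measurable_update_pair n)).div h1

lemma dependsOn_headDensity (n : ℕ) : DependsOn (headDensity μ f n) (Set.Iio n) := by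
  intro x y hxy
  unfold headDensity
  congr 1
  ext z
  congr 1
  ext i
  unfold splice
  split_ifs with h
  · exact hxy i h
  · rfl

lemma update_agree {n : ℕ} {x y : ℕ → E} (hxy : ∀ i ∈ Set.Iio n, x i = y i) (e : E) :
    ∀ i ∈ Set.Iio (n + 1), Function.update x n e i = Function.update y n e i := by
  intro i hi
  by_cases h : i = n
  · subst h; simp
  · rw [Function.update_of_ne h, Function.update_of_ne h]
    exact hxy i (by simp only [Set.mem_Iio] at *; omega)

lemma dependsOn_nextDensity (n : ℕ) : DependsOn (nextDensity μ f n) (Set.Iio n) := by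
  intro x y hxy
  ext e
  unfold nextDensity
  rw [dependsOn_headDensity μ n hxy, dependsOn_headDensity μ (n + 1) (update_agree hxy e)]

lemma headDensity_zero (x : ℕ → E) :
    headDensity μ f 0 x = ∫⁻ z, f z ∂Measure.infinitePi μ := by
  simp [headDensity, splice_zero]

lemma lintegral_headDensity_update (hf : Measurable f) (n : ℕ) (x : ℕ → E) :
    ∫⁻ e, headDensity μ f (n + 1) (Function.update x n e) ∂μ n = headDensity μ f n x := by
  unfold headDensity
  simp_rw [splice_succ_update]
  have hm : Measurable fun z => f (splice n x z) :=
    hf.comp ((measurable_splice n).comp measurable_prodMk_left)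
  rw [lintegral_lintegral_swap
    (f := fun e z => f (splice n x (Function.update z n e)))
    (hm.comp ((measurable_update_pair n).comp measurable_swap)).aemeasurable]
  exact lintegral_update_infinitePi μ n hm

lemma measurable_headDensity_update (hf : Measurable f) (n : ℕ) (x : ℕ → E) :
    Measurable fun e => headDensity μ f (n + 1) (Function.update x n e) :=
  (measurable_headDensity μ hf (n + 1)).comp
    ((measurable_update_pair n).comp measurable_prodMk_left)

lemma measurable_comp_splice {h : (ℕ → E) → ℝ≥0∞} (hh : Measurable h) (n : ℕ) (x : ℕ → E) :
    Measurable fun z => h (splice n x z) :=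
  hh.comp ((measurable_splice n).comp measurable_prodMk_left)

lemma lintegral_nextDensity (hf : Measurable f) (n : ℕ) (x : ℕ → E) :
    ∫⁻ e, nextDensity μ f n x e ∂μ n = 1 := by
  unfold nextDensity
  split_ifs with h
  · simp
  · push Not at h
    simp_rw [div_eq_mul_inv]
    rw [lintegral_mul_const _ (measurable_headDensity_update μ hf n x),
      lintegral_headDensity_update μ hf,
      ENNReal.mul_inv_cancel h.1 h.2]

lemma splice_agree {n : ℕ} (x z : ℕ → E) : ∀ i ∈ Set.Iio n, splice n x z i = x i := by
  intro i hi
  simp only [Set.mem_Iio] at hi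
  simp [splice, hi]

/-- `headDensity μ f n` is the conditional expectation of `f` given the first `n` coordinates, tested
against functions of these coordinates. -/
lemma lintegral_headDensity_mul (hf : Measurable f) (n : ℕ) {h : (ℕ → E) → ℝ≥0∞}
    (hh : Measurable h) (hd : DependsOn h (Set.Iio n)) :
    ∫⁻ x, headDensity μ f n x * h x ∂Measure.infinitePi μ =
      ∫⁻ x, f x * h x ∂Measure.infinitePi μ := by
  rw [← lintegral_splice μ n (h := fun x => f x * h x) (hf.mul hh)]
  refine lintegral_congr fun x => ?_
  unfold headDensity
  rw [← lintegral_mul_const _ (measurable_comp_splice hf n x)]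
  refine lintegral_congr fun z => ?_
  rw [hd (splice_agree x z)]

lemma ae_headDensity_lt_top (hf : Measurable f) (hf1 : ∫⁻ x, f x ∂Measure.infinitePi μ = 1)
    (n : ℕ) : ∀ᵐ x ∂Measure.infinitePi μ, headDensity μ f n x < ∞ := by
  refine ae_lt_top (measurable_headDensity μ hf n) ?_
  have := lintegral_headDensity_mul μ hf n (h := fun _ => 1) measurable_const
    (fun _ _ _ => rfl)
  simp only [mul_one] at this
  rw [this, hf1]
  exact ENNReal.one_ne_top

/-- The factorization of the densities. Where the density of the past vanishes, so does almost surely that of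
its extension, because it integrates to it. -/
lemma ae_headDensity_mul_nextDensity (hf : Measurable f) (n : ℕ) {x : ℕ → E}
    (hx : headDensity μ f n x < ∞) :
    ∀ᵐ e ∂μ n, headDensity μ f (n + 1) (Function.update x n e) =
      headDensity μ f n x * nextDensity μ f n x e := by
  have hint := lintegral_headDensity_update μ hf n x
  by_cases h0 : headDensity μ f n x = 0
  · rw [h0, lintegral_eq_zero_iff (measurable_headDensity_update μ hf n x)] at hint
    filter_upwards [hint] with e he
    simpa [h0] using he
  · refine ae_of_all _ fun e => ?_
    simp only [nextDensity, h0, hx.ne, or_self, if_false]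
    rw [ENNReal.mul_div_cancel h0 hx.ne]

lemma ae_nextDensity_lt_top (hf : Measurable f) (n : ℕ) (x : ℕ → E) :
    ∀ᵐ e ∂μ n, nextDensity μ f n x e < ∞ :=
  ae_lt_top ((measurable_nextDensity μ hf n).comp measurable_prodMk_left)
    (by rw [lintegral_nextDensity μ hf n x]; exact ENNReal.one_ne_top)

end HeadDensity

/-! ### The chain rule for the relative entropy -/

section Entropy

/-- The integrand `a log a - a + 1` of the relative entropy, as a function of the density. -/
def entropyFun (a : ℝ≥0∞) : ℝ≥0∞ := ENNReal.ofReal (InformationTheory.klFun a.toReal)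

lemma measurable_entropyFun : Measurable entropyFun :=
  (InformationTheory.measurable_klFun.comp ENNReal.measurable_toReal).ennreal_ofReal

lemma entropyFun_one : entropyFun 1 = 0 := by
  simp [entropyFun, InformationTheory.klFun_one]

/-- The identity `φ(mg) = m φ(g) + g φ(m) + (m - 1)(g - 1)` for `φ = entropyFun`, rearranged to avoid subtraction. -/
lemma entropyFun_mul {m g : ℝ≥0∞} (hm : m ≠ ∞) (hg : g ≠ ∞) :
    entropyFun (m * g) + (m + g) = m * entropyFun g + g * entropyFun m + (m * g + 1) := by
  lift m to NNReal using hm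
  lift g to NNReal using hg
  have h1 : ∀ a : NNReal, (a : ℝ≥0∞) = ENNReal.ofReal a := fun a => by simp
  have h0 : ∀ a : NNReal, 0 ≤ (a : ℝ) := fun a => a.2
  have hk : ∀ a : NNReal, 0 ≤ InformationTheory.klFun a :=
    fun a => InformationTheory.klFun_nonneg a.2
  unfold entropyFun
  rw [← ENNReal.coe_mul, ENNReal.coe_toReal, ENNReal.coe_toReal, ENNReal.coe_toReal,
    h1 m, h1 g, h1 (m * g), ← ENNReal.ofReal_mul (h0 m), ← ENNReal.ofReal_mul (h0 g),
    ← ENNReal.ofReal_one, ← ENNReal.ofReal_add (h0 m) (h0 g),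
    ← ENNReal.ofReal_add (hk _) (add_nonneg (h0 m) (h0 g)),
    ← ENNReal.ofReal_add (mul_nonneg (h0 m) (hk _)) (mul_nonneg (h0 g) (hk _)),
    ← ENNReal.ofReal_add (h0 (m * g)) zero_le_one,
    ← ENNReal.ofReal_add (by have := hk m; have := hk g; positivity) (by positivity)]
  congr 1
  simp only [InformationTheory.klFun_apply, NNReal.coe_mul]
  rcases eq_or_ne (m : ℝ) 0 with hm0 | hm0
  · rw [hm0]; simp [add_comm]
  rcases eq_or_ne (g : ℝ) 0 with hg0 | hg0
  · rw [hg0]; simp [add_comm]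
  rw [Real.log_mul hm0 hg0]
  ring

/-- Jensen's inequality for the entropy integrand. -/
lemma entropyFun_lintegral_le {α : Type*} [MeasurableSpace α] (P : Measure α)
    [IsProbabilityMeasure P] {F : α → ℝ≥0∞} (hF : Measurable F) (hfin : ∫⁻ x, F x ∂P ≠ ∞) :
    entropyFun (∫⁻ x, F x ∂P) ≤ ∫⁻ x, entropyFun (F x) ∂P := by
  by_cases htop : ∫⁻ x, entropyFun (F x) ∂P = ∞
  · rw [htop]; exact le_top
  have hint : Integrable (fun x => (F x).toReal) P :=
    integrable_toReal_of_lintegral_ne_top hF.aemeasurable hfin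
  have hkm : Measurable fun x => InformationTheory.klFun (F x).toReal :=
    InformationTheory.measurable_klFun.comp hF.ennreal_toReal
  have hk0 : ∀ x, 0 ≤ InformationTheory.klFun (F x).toReal :=
    fun x => InformationTheory.klFun_nonneg ENNReal.toReal_nonneg
  have hkint : Integrable (fun x => InformationTheory.klFun (F x).toReal) P := by
    refine ⟨hkm.aestronglyMeasurable, ?_⟩
    rw [hasFiniteIntegral_iff_ofReal (ae_of_all _ hk0)]
    exact lt_top_iff_ne_top.2 htop
  have hJ := InformationTheory.convexOn_klFun.map_integral_le (μ := P)
    (f := fun x => (F x).toReal) InformationTheory.continuous_klFun.continuousOn isClosed_Ici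
    (ae_of_all _ fun x => ENNReal.toReal_nonneg) hint hkint
  unfold entropyFun
  rw [← ofReal_integral_eq_lintegral_ofReal hkint (ae_of_all _ hk0)]
  refine ENNReal.ofReal_le_ofReal ?_
  rwa [integral_toReal hF.aemeasurable (ae_lt_top hF hfin)] at hJ

variable {E : Type*} [MeasurableSpace E] (μ : ℕ → Measure E) [∀ i, IsProbabilityMeasure (μ i)]
  {f : (ℕ → E) → ℝ≥0∞}

/-- One step of the chain rule, for a fixed past. -/
lemma lintegral_entropyFun_headDensity_update (hf : Measurable f) (n : ℕ) {x : ℕ → E}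
    (hx : headDensity μ f n x < ∞) :
    ∫⁻ e, entropyFun (headDensity μ f (n + 1) (Function.update x n e)) ∂μ n =
      headDensity μ f n x * ∫⁻ e, entropyFun (nextDensity μ f n x e) ∂μ n +
        entropyFun (headDensity μ f n x) := by
  set m := headDensity μ f n x with hm
  have hg : Measurable (nextDensity μ f n x) :=
    (measurable_nextDensity μ hf n).comp measurable_prodMk_left
  have hgl := lintegral_nextDensity μ hf n x
  have h1 : ∫⁻ e, entropyFun (headDensity μ f (n + 1) (Function.update x n e)) ∂μ n =
      ∫⁻ e, entropyFun (m * nextDensity μ f n x e) ∂μ n := by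
    refine lintegral_congr_ae ?_
    filter_upwards [ae_headDensity_mul_nextDensity μ hf n hx] with e he
    rw [he]
  have h2 : ∫⁻ e, (entropyFun (m * nextDensity μ f n x e) + (m + nextDensity μ f n x e)) ∂μ n =
      ∫⁻ e, (m * entropyFun (nextDensity μ f n x e) + nextDensity μ f n x e * entropyFun m +
        (m * nextDensity μ f n x e + 1)) ∂μ n := by
    refine lintegral_congr_ae ?_
    filter_upwards [ae_nextDensity_lt_top μ hf n x] with e he
    exact entropyFun_mul hx.ne he.ne
  have hme : Measurable fun e => m * entropyFun (nextDensity μ f n x e) :=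
    (measurable_entropyFun.comp hg).const_mul m
  rw [lintegral_add_right _ (hg.const_add m), lintegral_add_right _ hg, lintegral_const,
    lintegral_add_right _ ((hg.const_mul m).add_const 1),
    lintegral_add_right _ (hg.mul_const _), lintegral_add_right _ measurable_const,
    lintegral_const_mul (f := fun e => entropyFun (nextDensity μ f n x e)) _
      (measurable_entropyFun.comp hg), lintegral_mul_const _ hg,
    lintegral_const_mul _ hg, lintegral_const, hgl] at h2
  simp only [measure_univ, mul_one, one_mul] at h2
  rw [h1]
  exact (ENNReal.add_left_inj (by finiteness)).1 h2

lemma sum_lintegral_entropyFun_nextDensity (hf : Measurable f)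
    (hf1 : ∫⁻ x, f x ∂Measure.infinitePi μ = 1) (n : ℕ) :
    ∑ i ∈ Finset.range n,
      ∫⁻ x, f x * ∫⁻ e, entropyFun (nextDensity μ f i x e) ∂μ i ∂Measure.infinitePi μ =
      ∫⁻ x, entropyFun (headDensity μ f n x) ∂Measure.infinitePi μ := by
  induction n with
  | zero => simp [headDensity_zero, hf1, entropyFun_one]
  | succ n ih =>
    have hm : Measurable fun x => ∫⁻ e, entropyFun (nextDensity μ f n x e) ∂μ n :=
      (measurable_entropyFun.comp (measurable_nextDensity μ hf n)).lintegral_prod_right'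
    have hd : DependsOn (fun x => ∫⁻ e, entropyFun (nextDensity μ f n x e) ∂μ n)
        (Set.Iio n) := fun x y hxy => by
      simp only [dependsOn_nextDensity μ n hxy]
    rw [Finset.sum_range_succ, ih, ← lintegral_headDensity_mul μ hf n hm hd,
      ← lintegral_update_infinitePi μ n (h := fun x => entropyFun (headDensity μ f (n + 1) x))
        (measurable_entropyFun.comp (measurable_headDensity μ hf (n + 1))),
      add_comm, ← lintegral_add_right (g := fun x => entropyFun (headDensity μ f n x)) _
        (measurable_entropyFun.comp (measurable_headDensity μ hf n))]
    refine lintegral_congr_ae ?_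
    filter_upwards [ae_headDensity_lt_top μ hf hf1 n] with x hx
    exact (lintegral_entropyFun_headDensity_update μ hf n hx).symm

/-- The chain rule for the relative entropy with respect to an infinite product, as an
inequality. -/
theorem tsum_lintegral_entropyFun_nextDensity_le (hf : Measurable f)
    (hf1 : ∫⁻ x, f x ∂Measure.infinitePi μ = 1) :
    ∑' i, ∫⁻ x, f x * ∫⁻ e, entropyFun (nextDensity μ f i x e) ∂μ i ∂Measure.infinitePi μ ≤
      ∫⁻ x, entropyFun (f x) ∂Measure.infinitePi μ := by
  refine ENNReal.tsum_le_of_sum_range_le fun n => ?_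
  rw [sum_lintegral_entropyFun_nextDensity μ hf hf1,
    ← lintegral_splice μ n (h := fun x => entropyFun (f x)) (measurable_entropyFun.comp hf)]
  refine lintegral_mono_ae ?_
  filter_upwards [ae_headDensity_lt_top μ hf hf1 n] with x hx
  exact entropyFun_lintegral_le _ (measurable_comp_splice hf n x) hx.ne

end Entropy

/-! ### Trajectories of transition kernels -/

section Trajectory

variable {F : Type*} [MeasurableSpace F]

/-- The Ionescu-Tulcea theorem for transition kernels that are given on the whole sequence space, the
`n`-th one depending on the first `n` coordinates only. -/
theorem exists_trajectory [Nonempty F] (K : ℕ → Kernel (ℕ → F) F) [∀ n, IsMarkovKernel (K n)]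
    (hK : ∀ n, DependsOn (fun w => K n w) (Set.Iio n)) :
    ∃ N : Measure (ℕ → F), IsProbabilityMeasure N ∧
      ∀ (n : ℕ) (h : (ℕ → F) → ℝ≥0∞), Measurable h → DependsOn h (Set.Iio (n + 1)) →
        ∫⁻ w, h w ∂N = ∫⁻ w, ∫⁻ e, h (Function.update w n e) ∂K n w ∂N := by
  classical
  -- the kernels of Mathlib's theorem act on finite sequences: these are extended by a fixed element
  let w₀ : ℕ → F := fun _ => Classical.arbitrary F
  let ext : (n : ℕ) → ((i : Finset.Iic n) → F) → (ℕ → F) := fun n u i =>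
    if h : i ≤ n then u ⟨i, Finset.mem_Iic.2 h⟩ else w₀ i
  have hext : ∀ n, Measurable (ext n) := by
    intro n
    refine measurable_pi_lambda _ fun i => ?_
    by_cases h : i ≤ n
    · simp only [ext, h, dif_pos]; fun_prop
    · simp only [ext, h, dif_neg, not_false_eq_true]; fun_prop
  have hextr : ∀ (n : ℕ) (w : ℕ → F), ∀ i ∈ Set.Iio (n + 1),
      ext n (Preorder.frestrictLe n w) i = w i := by
    intro n w i hi
    have : i ≤ n := Nat.lt_succ_iff.1 hi
    simp [ext, this, Preorder.frestrictLe]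
  let κ : (n : ℕ) → Kernel ((i : Finset.Iic n) → F) F := fun n => (K (n + 1)).comap (ext n) (hext n)
  have hκ : ∀ n, IsMarkovKernel (κ n) := fun n => inferInstance
  let N := Kernel.trajMeasure (X := fun _ => F) (K 0 w₀) κ
  refine ⟨N, inferInstance, fun n h hh hd => ?_⟩
  cases n with
  | zero =>
    have h0 : N.map (Preorder.frestrictLe (π := fun _ => F) 0) =
        (K 0 w₀).map (MeasurableEquiv.piUnique (fun _ : Finset.Iic 0 => F)).symm := by
      simp only [N]
      rw [Kernel.trajMeasure, Measure.map_comp _ _ (by fun_prop), Kernel.traj_map_frestrictLe,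
        Kernel.partialTraj_self, Measure.id_comp]
    have h1 : ∀ w, h w = h (ext 0 (Preorder.frestrictLe 0 w)) := fun w =>
      hd fun i hi => (hextr 0 w i hi).symm
    have h2 : ∀ w, ∀ e, h (Function.update w 0 e) =
        h (ext 0 ((MeasurableEquiv.piUnique (fun _ : Finset.Iic 0 => F)).symm e)) := by
      intro w e
      refine hd fun i hi => ?_
      have : i = 0 := by simpa using hi
      subst this
      simp [ext]
    have h3 : ∀ w, ∫⁻ e, h (Function.update w 0 e) ∂K 0 w =
        ∫⁻ e, h (ext 0 ((MeasurableEquiv.piUnique (fun _ : Finset.Iic 0 => F)).symm e)) ∂K 0 w₀ := by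
      intro w
      rw [show K 0 w = K 0 w₀ from hK 0 (by simp)]
      exact lintegral_congr (h2 w)
    rw [lintegral_congr h3, lintegral_const, measure_univ, mul_one]
    have hhe : Measurable fun u => h (ext 0 u) := hh.comp (hext 0)
    calc ∫⁻ w, h w ∂N = ∫⁻ w, h (ext 0 (Preorder.frestrictLe 0 w)) ∂N :=
          lintegral_congr h1
      _ = ∫⁻ u, h (ext 0 u) ∂(N.map (Preorder.frestrictLe (π := fun _ => F) 0)) := by
          rw [lintegral_map hhe (by fun_prop)]
      _ = _ := by
          rw [h0, lintegral_map hhe (by fun_prop)]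
  | succ n =>
    have h0 : (N.map (Preorder.frestrictLe (π := fun _ => F) n)) ⊗ₘ κ n =
        N.map (fun x => (Preorder.frestrictLe (π := fun _ => F) n x, x (n + 1))) :=
      Kernel.map_frestrictLe_trajMeasure_compProd_eq_map_trajMeasure
    let G : ((i : Finset.Iic n) → F) × F → ℝ≥0∞ := fun q =>
      h (Function.update (ext n q.1) (n + 1) q.2)
    have hG : Measurable G := hh.comp ((measurable_update_pair (n + 1)).comp
      (((hext n).comp measurable_fst).prodMk measurable_snd))
    have h1 : ∀ w e, h (Function.update w (n + 1) e) = G (Preorder.frestrictLe n w, e) := by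
      intro w e
      refine hd (update_agree (fun i hi => ?_) e)
      exact (hextr n w i hi).symm
    have h2 : ∀ w, h w = G (Preorder.frestrictLe n w, w (n + 1)) := by
      intro w
      rw [← h1, Function.update_eq_self]
    calc ∫⁻ w, h w ∂N = ∫⁻ w, G (Preorder.frestrictLe n w, w (n + 1)) ∂N := lintegral_congr h2
      _ = ∫⁻ q, G q ∂(N.map (fun x => (Preorder.frestrictLe (π := fun _ => F) n x, x (n + 1)))) := by
          rw [lintegral_map hG (by fun_prop)]
      _ = ∫⁻ w, ∫⁻ e, G (Preorder.frestrictLe n w, e) ∂κ n (Preorder.frestrictLe n w) ∂N := by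
          rw [← h0, Measure.lintegral_compProd hG, lintegral_map
            (Measurable.lintegral_kernel_prod_right' hG) (by fun_prop)]
      _ = _ := by
          refine lintegral_congr fun w => ?_
          have : κ n (Preorder.frestrictLe n w) = K (n + 1) w := by
            simp only [κ, Kernel.comap_apply]
            exact hK (n + 1) (hextr n w)
          rw [this]
          exact lintegral_congr fun e => (h1 w e).symm

/-- Two finite measures on a sequence space agree as soon as they agree on the sets that depend on
finitely many coordinates. -/
theorem ext_of_forall_dependsOn {μ₁ μ₂ : Measure (ℕ → F)} [IsFiniteMeasure μ₁]
    (h : ∀ (n : ℕ) (A : Set (ℕ → F)), MeasurableSet A →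
      DependsOn (A.indicator (1 : (ℕ → F) → ℝ≥0∞)) (Set.Iio n) → μ₁ A = μ₂ A) : μ₁ = μ₂ := by
  have key : ∀ A ∈ measurableCylinders (fun _ : ℕ => F), μ₁ A = μ₂ A := by
    intro A hA
    obtain ⟨s, S, hS, rfl⟩ := (mem_measurableCylinders A).1 hA
    refine h (s.sup id + 1) _ (MeasurableSet.cylinder s hS) ?_
    intro x y hxy
    have : s.restrict x = s.restrict y := by
      ext i
      exact hxy i (Nat.lt_succ_of_le (Finset.le_sup (f := id) i.2))
    have hm : x ∈ cylinder s S ↔ y ∈ cylinder s S := by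
      rw [mem_cylinder, mem_cylinder, this]
    by_cases hx : x ∈ cylinder s S
    · rw [Set.indicator_of_mem hx, Set.indicator_of_mem (hm.1 hx)]; rfl
    · rw [Set.indicator_of_notMem hx, Set.indicator_of_notMem (fun h => hx (hm.2 h))]
  refine ext_of_generate_finite _ generateFrom_measurableCylinders.symm
    isPiSystem_measurableCylinders key (key _ (univ_mem_measurableCylinders _))

end Trajectory

/-! ### The maximal coupling of two densities -/

section Coupling

variable {E : Type*} [MeasurableSpace E]

/-- The maximal coupling of the probability measures `a • μ` and `b • μ`: the common part
`min a b • μ` sits on the diagonal, and the remaining parts are coupled independently. If `a = b` almost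
everywhere then the normalizing factor is `0⁻¹ = ∞`, but the product measure that it multiplies is `0`. -/
def maximalCoupling (μ : Measure E) (a b : E → ℝ≥0∞) : Measure (E × E) :=
  (μ.withDensity fun z => min (a z) (b z)).map (fun z => (z, z)) +
    (∫⁻ z, (a z - b z) ∂μ)⁻¹ •
      ((μ.withDensity fun z => a z - b z).prod (μ.withDensity fun z => b z - a z))

variable {μ : Measure E} [IsProbabilityMeasure μ] {a b : E → ℝ≥0∞}

lemma lintegral_maximalCoupling (ha : Measurable a) (hb : Measurable b) {h : E × E → ℝ≥0∞}
    (hh : Measurable h) :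
    ∫⁻ q, h q ∂maximalCoupling μ a b = ∫⁻ z, min (a z) (b z) * h (z, z) ∂μ +
      (∫⁻ z, (a z - b z) ∂μ)⁻¹ *
        ∫⁻ z, (a z - b z) * ∫⁻ z', (b z' - a z') * h (z, z') ∂μ ∂μ := by
  have hd : Measurable fun z : E => (z, z) := by fun_prop
  have hhd : Measurable fun z : E => h (z, z) := hh.comp hd
  unfold maximalCoupling
  rw [lintegral_add_measure, lintegral_smul_measure, lintegral_map hh hd,
    lintegral_withDensity_eq_lintegral_mul _ (ha.min hb) hhd,
    lintegral_prod _ hh.aemeasurable,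
    lintegral_withDensity_eq_lintegral_mul (f := fun z => a z - b z) _
      (ha.sub hb) hh.lintegral_prod_right']
  simp only [Pi.mul_apply, smul_eq_mul]
  congr 2
  refine lintegral_congr fun z => ?_
  have hhz : Measurable fun z' : E => h (z, z') := hh.comp measurable_prodMk_left
  rw [lintegral_withDensity_eq_lintegral_mul (f := fun z => b z - a z) _ (hb.sub ha) hhz]
  rfl

lemma min_add_sub_eq (x y : ℝ≥0∞) : min x y + (x - y) = x := by
  rcases le_total x y with h | h
  · rw [min_eq_left h, tsub_eq_zero_of_le h, add_zero]
  · rw [min_eq_right h, add_tsub_cancel_of_le h]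

lemma lintegral_sub_comm (ha : Measurable a) (hb : Measurable b) (ha1 : ∫⁻ z, a z ∂μ = 1)
    (hb1 : ∫⁻ z, b z ∂μ = 1) : ∫⁻ z, (a z - b z) ∂μ = ∫⁻ z, (b z - a z) ∂μ := by
  have h : ∫⁻ z, (b z + (a z - b z)) ∂μ = ∫⁻ z, (a z + (b z - a z)) ∂μ := by
    refine lintegral_congr fun z => ?_
    rcases le_total (a z) (b z) with h | h <;>
      simp [tsub_eq_zero_of_le h, add_tsub_cancel_of_le h]
  rw [lintegral_add_left hb, lintegral_add_left ha, ha1, hb1] at h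
  exact (ENNReal.add_right_inj ENNReal.one_ne_top).1 h

lemma lintegral_sub_ne_top (ha1 : ∫⁻ z, a z ∂μ = 1) :
    ∫⁻ z, (a z - b z) ∂μ ≠ ∞ :=
  ne_top_of_le_ne_top (by rw [ha1]; exact ENNReal.one_ne_top)
    (lintegral_mono fun z => tsub_le_self)

/-- The residual factor of the maximal coupling integrates out. -/
lemma inv_mul_lintegral_residual (ha : Measurable a) (hb : Measurable b)
    (ha1 : ∫⁻ z, a z ∂μ = 1) (h : E → ℝ≥0∞) (hh : Measurable h) :
    (∫⁻ z, (a z - b z) ∂μ)⁻¹ * ((∫⁻ z, (a z - b z) * h z ∂μ) * ∫⁻ z, (a z - b z) ∂μ) =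
      ∫⁻ z, (a z - b z) * h z ∂μ := by
  by_cases h0 : ∫⁻ z, (a z - b z) ∂μ = 0
  · have h1 : ∫⁻ z, (a z - b z) * h z ∂μ = 0 := by
      rw [lintegral_eq_zero_iff (f := fun z => a z - b z) (ha.sub hb)] at h0
      rw [lintegral_eq_zero_iff (f := fun z => (a z - b z) * h z) ((ha.sub hb).mul hh)]
      filter_upwards [h0] with z hz
      simp only [Pi.zero_apply] at hz ⊢
      rw [hz, zero_mul]
    rw [h1]; simp
  · rw [mul_comm, mul_assoc, ENNReal.mul_inv_cancel h0 (lintegral_sub_ne_top ha1), mul_one]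

lemma lintegral_maximalCoupling_fst (ha : Measurable a) (hb : Measurable b)
    (ha1 : ∫⁻ z, a z ∂μ = 1) (hb1 : ∫⁻ z, b z ∂μ = 1) {h : E → ℝ≥0∞} (hh : Measurable h) :
    ∫⁻ q, h q.1 ∂maximalCoupling μ a b = ∫⁻ z, a z * h z ∂μ := by
  rw [lintegral_maximalCoupling ha hb (h := fun q => h q.1) (hh.comp measurable_fst)]
  have hba : Measurable fun z => b z - a z := hb.sub ha
  have hah : Measurable fun z => (a z - b z) * h z := (ha.sub hb).mul hh
  have hmh : Measurable fun z => min (a z) (b z) * h z := (ha.min hb).mul hh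
  simp_rw [lintegral_mul_const _ hba, ← lintegral_sub_comm ha hb ha1 hb1]
  have : ∀ z, (a z - b z) * ((∫⁻ z, (a z - b z) ∂μ) * h z) =
      (a z - b z) * h z * ∫⁻ z, (a z - b z) ∂μ := fun z => by ring
  simp_rw [this]
  rw [lintegral_mul_const _ hah, inv_mul_lintegral_residual ha hb ha1 h hh,
    ← lintegral_add_left hmh]
  simp_rw [← add_mul, min_add_sub_eq]

lemma lintegral_maximalCoupling_snd (ha : Measurable a) (hb : Measurable b)
    (ha1 : ∫⁻ z, a z ∂μ = 1) (hb1 : ∫⁻ z, b z ∂μ = 1) {h : E → ℝ≥0∞} (hh : Measurable h) :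
    ∫⁻ q, h q.2 ∂maximalCoupling μ a b = ∫⁻ z, b z * h z ∂μ := by
  have hab : Measurable fun z => a z - b z := ha.sub hb
  have hmh : Measurable fun z => min (a z) (b z) * h z := (ha.min hb).mul hh
  rw [lintegral_maximalCoupling ha hb (h := fun q => h q.2) (hh.comp measurable_snd)]
  dsimp only
  rw [lintegral_mul_const _ hab, mul_comm (∫⁻ z, (a z - b z) ∂μ),
    lintegral_sub_comm ha hb ha1 hb1, inv_mul_lintegral_residual hb ha hb1 h hh,
    ← lintegral_add_left hmh]
  simp_rw [← add_mul, min_comm (a _), min_add_sub_eq]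

lemma isProbabilityMeasure_maximalCoupling (ha : Measurable a) (hb : Measurable b)
    (ha1 : ∫⁻ z, a z ∂μ = 1) (hb1 : ∫⁻ z, b z ∂μ = 1) :
    IsProbabilityMeasure (maximalCoupling μ a b) := by
  constructor
  have := lintegral_maximalCoupling_fst ha hb ha1 hb1 (h := fun _ => 1) measurable_const
  simpa [ha1] using this

/-- Under the maximal coupling the two coordinates differ exactly on the residual part. -/
lemma lintegral_maximalCoupling_ne [MeasurableEq E] (ha : Measurable a)
    (hb : Measurable b) (ha1 : ∫⁻ z, a z ∂μ = 1) (hb1 : ∫⁻ z, b z ∂μ = 1) {h : E → ℝ≥0∞}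
    (hh : Measurable h) :
    ∫⁻ q, {q : E × E | q.1 ≠ q.2}.indicator 1 q * h q.1 ∂maximalCoupling μ a b =
      ∫⁻ z, (a z - b z) * h z ∂μ := by
  have hne : MeasurableSet {q : E × E | q.1 ≠ q.2} :=
    (measurableSet_eq_fun measurable_fst measurable_snd).compl
  rw [lintegral_maximalCoupling ha hb
    (h := fun q => {q : E × E | q.1 ≠ q.2}.indicator 1 q * h q.1)
    ((measurable_one.indicator hne).mul (hh.comp measurable_fst))]
  have hba : Measurable fun z => b z - a z := hb.sub ha
  have hah : Measurable fun z => (a z - b z) * h z := (ha.sub hb).mul hh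
  have h1 : ∀ z, (a z - b z) * ∫⁻ z', (b z' - a z') *
      ({q : E × E | q.1 ≠ q.2}.indicator 1 (z, z') * h z) ∂μ =
      (a z - b z) * h z * ∫⁻ z', (b z' - a z') ∂μ := by
    intro z
    rw [mul_assoc, ← lintegral_const_mul _ hba]
    by_cases hz : a z ≤ b z
    · rw [tsub_eq_zero_of_le hz, zero_mul, zero_mul]
    congr 1
    refine lintegral_congr fun z' => ?_
    by_cases hzz : z = z'
    · subst hzz
      rw [tsub_eq_zero_of_le (le_of_not_ge hz)]; simp
    · simp [Set.indicator, hzz, mul_comm]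
  simp_rw [h1]
  rw [lintegral_mul_const _ hah, ← lintegral_sub_comm ha hb ha1 hb1,
    inv_mul_lintegral_residual ha hb ha1 h hh]
  simp

/-- The maximal coupling of densities depending measurably on a parameter, as a kernel. -/
def maximalCouplingKernel {W : Type*} [MeasurableSpace W] (μ : Measure E) [IsProbabilityMeasure μ]
    (a b : W → E → ℝ≥0∞) (ha : Measurable fun q : W × E => a q.1 q.2)
    (hb : Measurable fun q : W × E => b q.1 q.2) : Kernel W (E × E) where
  toFun w := maximalCoupling μ (a w) (b w)
  measurable' := by
    refine Measure.measurable_of_measurable_coe _ fun s hs => ?_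
    have hind : Measurable (s.indicator (1 : E × E → ℝ≥0∞)) := measurable_one.indicator hs
    have haw : ∀ w, Measurable (a w) := fun w => ha.comp measurable_prodMk_left
    have hbw : ∀ w, Measurable (b w) := fun w => hb.comp measurable_prodMk_left
    have happ : ∀ w, maximalCoupling μ (a w) (b w) s =
        ∫⁻ z, min (a w z) (b w z) * s.indicator (1 : E × E → ℝ≥0∞) (z, z) ∂μ +
          (∫⁻ z, (a w z - b w z) ∂μ)⁻¹ * ∫⁻ z, (a w z - b w z) *
            ∫⁻ z', (b w z' - a w z') * s.indicator (1 : E × E → ℝ≥0∞) (z, z') ∂μ ∂μ := by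
      intro w
      rw [← lintegral_indicator_one hs, lintegral_maximalCoupling (haw w) (hbw w) hind]
    simp_rw [happ]
    have hinner : Measurable fun q : W × E =>
        ∫⁻ z', (b q.1 z' - a q.1 z') * s.indicator (1 : E × E → ℝ≥0∞) (q.2, z') ∂μ := by
      refine Measurable.lintegral_prod_right' (f := fun r : (W × E) × E =>
        (b r.1.1 r.2 - a r.1.1 r.2) * s.indicator (1 : E × E → ℝ≥0∞) (r.1.2, r.2)) ?_
      have h1 : Measurable fun r : (W × E) × E => (r.1.1, r.2) := by fun_prop
      have h2 : Measurable fun r : (W × E) × E => (r.1.2, r.2) := by fun_prop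
      exact ((hb.comp h1).sub (ha.comp h1)).mul (hind.comp h2)
    refine Measurable.add ?_ (Measurable.mul ?_ ?_)
    · have h2 : Measurable fun r : W × E => (r.2, r.2) := by fun_prop
      exact Measurable.lintegral_prod_right' ((ha.min hb).mul (hind.comp h2))
    · exact (Measurable.lintegral_prod_right' (ha.sub hb)).inv
    · exact Measurable.lintegral_prod_right' ((ha.sub hb).mul hinner)

end Coupling

/-! ### Convex costs and Jensen's inequality -/

section ConvexCost

/-- Convex nondecreasing functions `[0, 1] → [0, ∞]` that are finite on `[0, 1)`, in the form in which
they are used: at each `s < 1` there is a supporting line of nonnegative slope. -/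
structure IsConvexCost (α : ℝ → ℝ≥0∞) : Prop where
  measurable : Measurable α
  ne_top : ∀ s ∈ Set.Ico (0 : ℝ) 1, α s ≠ ∞
  subgradient : ∀ s ∈ Set.Ico (0 : ℝ) 1, ∃ k : ℝ≥0∞, k ≠ ∞ ∧ ∀ u ∈ Set.Icc (0 : ℝ) 1,
    α s + k * ENNReal.ofReal u ≤ α u + k * ENNReal.ofReal s

variable {α : ℝ → ℝ≥0∞}

lemma IsConvexCost.mono (hα : IsConvexCost α) {s u : ℝ} (hs : 0 ≤ s) (hsu : s ≤ u) (hu : u ≤ 1) :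
    α s ≤ α u := by
  rcases eq_or_lt_of_le (hsu.trans hu) with h1 | h1
  · rw [le_antisymm hsu (h1 ▸ hu)]
  obtain ⟨k, hk, h⟩ := hα.subgradient s ⟨hs, h1⟩
  have h2 := h u ⟨hs.trans hsu, hu⟩
  have h3 : α s + k * ENNReal.ofReal s ≤ α u + k * ENNReal.ofReal s :=
    le_trans (by gcongr) h2
  exact (ENNReal.add_le_add_iff_right (ENNReal.mul_ne_top hk ENNReal.ofReal_ne_top)).1 h3

lemma IsConvexCost.mono_toReal (hα : IsConvexCost α) {s u : ℝ≥0∞} (hsu : s ≤ u) (hu : u ≤ 1) :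
    α s.toReal ≤ α u.toReal :=
  hα.mono ENNReal.toReal_nonneg
    (ENNReal.toReal_mono (ne_top_of_le_ne_top ENNReal.one_ne_top hu) hsu)
    (by simpa using ENNReal.toReal_mono ENNReal.one_ne_top hu)

/-- Jensen's inequality. If the mean is `1` then the variable is almost surely `1`; otherwise the
supporting line at the mean is integrated. -/
lemma IsConvexCost.lintegral_le (hα : IsConvexCost α) {X : Type*} [MeasurableSpace X]
    (Q : Measure X) [IsProbabilityMeasure Q] {U : X → ℝ≥0∞} (hU : Measurable U)
    (hU1 : ∀ x, U x ≤ 1) :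
    α (∫⁻ x, U x ∂Q).toReal ≤ ∫⁻ x, α (U x).toReal ∂Q := by
  set m := ∫⁻ x, U x ∂Q with hm
  have hm1 : m ≤ 1 := by
    calc m ≤ ∫⁻ _, 1 ∂Q := lintegral_mono hU1
      _ = 1 := by simp
  have hmtop : m ≠ ∞ := ne_top_of_le_ne_top ENNReal.one_ne_top hm1
  have hUtop : ∀ x, U x ≠ ∞ := fun x => ne_top_of_le_ne_top ENNReal.one_ne_top (hU1 x)
  rcases eq_or_lt_of_le hm1 with h1 | h1
  · have hae : ∀ᵐ x ∂Q, U x = 1 := by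
      have h2 : ∫⁻ x, (1 - U x) ∂Q = 0 := by
        rw [lintegral_sub hU (by rw [← hm]; exact hmtop) (ae_of_all _ hU1), ← hm, h1]
        simp
      rw [lintegral_eq_zero_iff (f := fun x => 1 - U x) (measurable_const.sub hU)] at h2
      filter_upwards [h2] with x hx
      exact le_antisymm (hU1 x) (tsub_eq_zero_iff_le.1 hx)
    rw [h1]
    have : ∫⁻ x, α (U x).toReal ∂Q = ∫⁻ _, α (1 : ℝ≥0∞).toReal ∂Q := by
      refine lintegral_congr_ae ?_
      filter_upwards [hae] with x hx
      rw [hx]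
    rw [this]; simp
  · have hs : m.toReal ∈ Set.Ico (0 : ℝ) 1 :=
      ⟨ENNReal.toReal_nonneg, by simpa using (ENNReal.toReal_lt_toReal hmtop ENNReal.one_ne_top).2 h1⟩
    obtain ⟨k, hk, h⟩ := hα.subgradient _ hs
    have h2 : ∫⁻ x, (α m.toReal + k * U x) ∂Q ≤ ∫⁻ x, (α (U x).toReal + k * m) ∂Q := by
      refine lintegral_mono fun x => ?_
      have := h (U x).toReal ⟨ENNReal.toReal_nonneg,
        by simpa using ENNReal.toReal_mono ENNReal.one_ne_top (hU1 x)⟩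
      rwa [ENNReal.ofReal_toReal (hUtop x), ENNReal.ofReal_toReal hmtop] at this
    rw [lintegral_add_right _ (hU.const_mul k), lintegral_add_right _ measurable_const,
      lintegral_const_mul _ hU, ← hm] at h2
    simp only [lintegral_const, measure_univ, mul_one] at h2
    exact (ENNReal.add_le_add_iff_right (ENNReal.mul_ne_top hk hmtop)).1 h2

end ConvexCost

/-! ### Images of trajectories -/

section ProductCoupling

variable {E F : Type*} [MeasurableSpace E] [MeasurableSpace F]
  (μ : ℕ → Measure E) [∀ i, IsProbabilityMeasure (μ i)] {f : (ℕ → E) → ℝ≥0∞}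
  {K : ℕ → Kernel (ℕ → F) F} {N : Measure (ℕ → F)} {φ : F → E}

lemma comp_update_apply (w : ℕ → F) (n : ℕ) (e : F) :
    (fun i => φ (Function.update w n e i)) = Function.update (fun i => φ (w i)) n (φ e) := by
  ext i
  by_cases h : i = n
  · subst h; simp
  · simp [h]

lemma measurable_comp_seq (hφ : Measurable φ) : Measurable fun (w : ℕ → F) (i : ℕ) => φ (w i) :=
  measurable_pi_lambda _ fun i => hφ.comp (measurable_pi_apply i)

lemma measurable_lintegral_nextDensity (hf : Measurable f) (n : ℕ) {h : (ℕ → E) → ℝ≥0∞}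
    (hh : Measurable h) :
    Measurable fun x => ∫⁻ z, nextDensity μ f n x z * h (Function.update x n z) ∂μ n :=
  Measurable.lintegral_prod_right'
    ((measurable_nextDensity μ hf n).mul (hh.comp (measurable_update_pair n)))

lemma dependsOn_lintegral_nextDensity (n : ℕ) {h : (ℕ → E) → ℝ≥0∞}
    (hd : DependsOn h (Set.Iio (n + 1))) :
    DependsOn (fun x => ∫⁻ z, nextDensity μ f n x z * h (Function.update x n z) ∂μ n)
      (Set.Iio n) := by
  intro x y hxy
  dsimp only
  rw [dependsOn_nextDensity μ n hxy]
  refine lintegral_congr fun z => ?_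
  rw [hd (update_agree hxy z)]

/-- Integrating a function of the image trajectory `φ ∘ w` over one step of the kernel. -/
lemma lintegral_step (n : ℕ) (w : ℕ → F)
    (hstep : ∀ (h : E → ℝ≥0∞), Measurable h →
      ∫⁻ e, h (φ e) ∂K n w = ∫⁻ z, nextDensity μ f n (fun i => φ (w i)) z * h z ∂μ n)
    {h : (ℕ → E) → ℝ≥0∞} (hh : Measurable h) :
    ∫⁻ e, h (fun i => φ (Function.update w n e i)) ∂K n w =
      ∫⁻ z, nextDensity μ f n (fun i => φ (w i)) z *
        h (Function.update (fun i => φ (w i)) n z) ∂μ n := by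
  simp_rw [comp_update_apply]
  exact hstep (fun z => h (Function.update (fun i => φ (w i)) n z))
    (hh.comp ((measurable_update_pair n).comp measurable_prodMk_left))

/-- A trajectory whose coordinates have the conditional densities of `f • ⨂ μ` has that law. -/
theorem map_trajectory_eq_withDensity [IsProbabilityMeasure N]
    (hN : ∀ (n : ℕ) (h : (ℕ → F) → ℝ≥0∞), Measurable h → DependsOn h (Set.Iio (n + 1)) →
      ∫⁻ w, h w ∂N = ∫⁻ w, ∫⁻ e, h (Function.update w n e) ∂K n w ∂N)
    (hf : Measurable f) (hf1 : ∫⁻ x, f x ∂Measure.infinitePi μ = 1) (hφ : Measurable φ)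
    (hstep : ∀ (n : ℕ) (w : ℕ → F) (h : E → ℝ≥0∞), Measurable h →
      ∫⁻ e, h (φ e) ∂K n w = ∫⁻ z, nextDensity μ f n (fun i => φ (w i)) z * h z ∂μ n) :
    N.map (fun w i => φ (w i)) = (Measure.infinitePi μ).withDensity f := by
  have key : ∀ (n : ℕ) (h : (ℕ → E) → ℝ≥0∞), Measurable h → DependsOn h (Set.Iio n) →
      ∫⁻ w, h (fun i => φ (w i)) ∂N = ∫⁻ x, f x * h x ∂Measure.infinitePi μ := by
    intro n
    induction n with
    | zero =>
      intro h hh hd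
      by_cases hne : Nonempty E
      · obtain ⟨e⟩ := hne
        have hc : ∀ x, h x = h fun _ => e := fun x => hd (by simp)
        simp_rw [fun x => hc x]
        rw [lintegral_mul_const _ hf, hf1]
        simp
      · have := not_nonempty_iff.1 hne
        have hb : (Measure.infinitePi μ) = 0 := Measure.eq_zero_of_isEmpty _
        rw [hb] at hf1
        simp at hf1
    | succ n ih =>
      intro h hh hd
      have hd' : DependsOn (fun w : ℕ → F => h fun i => φ (w i)) (Set.Iio (n + 1)) :=
        fun w w' hw => hd fun i hi => by rw [hw i hi]
      rw [hN n (fun w => h fun i => φ (w i)) (hh.comp (measurable_comp_seq hφ)) hd']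
      simp_rw [lintegral_step μ n _ (hstep n _) hh]
      rw [ih _ (measurable_lintegral_nextDensity μ hf n hh)
        (dependsOn_lintegral_nextDensity μ n hd),
        ← lintegral_headDensity_mul μ hf n (measurable_lintegral_nextDensity μ hf n hh)
        (dependsOn_lintegral_nextDensity μ n hd),
        ← lintegral_headDensity_mul μ hf (n + 1) hh hd,
        ← lintegral_update_infinitePi μ n (h := fun x => headDensity μ f (n + 1) x * h x)
          ((measurable_headDensity μ hf (n + 1)).mul hh)]
      refine lintegral_congr_ae ?_
      filter_upwards [ae_headDensity_lt_top μ hf hf1 n] with x hx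
      have hm : Measurable fun z => nextDensity μ f n x z * h (Function.update x n z) :=
        ((measurable_nextDensity μ hf n).mul (hh.comp (measurable_update_pair n))).comp
          measurable_prodMk_left
      rw [← lintegral_const_mul _ hm]
      refine lintegral_congr_ae ?_
      filter_upwards [ae_headDensity_mul_nextDensity μ hf n hx] with z hz
      rw [hz, mul_assoc]
  have : IsProbabilityMeasure (N.map (fun w i => φ (w i))) :=
    Measure.isProbabilityMeasure_map (measurable_comp_seq hφ).aemeasurable
  refine ext_of_forall_dependsOn fun n A hA hd => ?_
  have := key n (A.indicator 1) (measurable_one.indicator hA) hd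
  rw [withDensity_apply _ hA, ← lintegral_indicator_one hA,
    lintegral_map (measurable_one.indicator hA) (measurable_comp_seq hφ), this,
    ← lintegral_indicator hA]
  refine lintegral_congr fun x => ?_
  by_cases hx : x ∈ A <;> simp [hx]

/-- The future of the image trajectory `φ ∘ w` depends on the past of `w` only through the past of
`φ ∘ w`. -/
lemma exists_forget_future
    (hN : ∀ (n : ℕ) (h : (ℕ → F) → ℝ≥0∞), Measurable h → DependsOn h (Set.Iio (n + 1)) →
      ∫⁻ w, h w ∂N = ∫⁻ w, ∫⁻ e, h (Function.update w n e) ∂K n w ∂N)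
    (hf : Measurable f) (hφ : Measurable φ)
    (hstep : ∀ (n : ℕ) (w : ℕ → F) (h : E → ℝ≥0∞), Measurable h →
      ∫⁻ e, h (φ e) ∂K n w = ∫⁻ z, nextDensity μ f n (fun i => φ (w i)) z * h z ∂μ n)
    (k d : ℕ) (h : (ℕ → E) → ℝ≥0∞) (hh : Measurable h) (hd : DependsOn h (Set.Iio (k + d))) :
    ∃ h' : (ℕ → E) → ℝ≥0∞, Measurable h' ∧ DependsOn h' (Set.Iio k) ∧
      ∀ G : (ℕ → F) → ℝ≥0∞, Measurable G → DependsOn G (Set.Iio k) →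
        ∫⁻ w, G w * h (fun i => φ (w i)) ∂N = ∫⁻ w, G w * h' (fun i => φ (w i)) ∂N := by
  induction d generalizing h with
  | zero => exact ⟨h, hh, hd, fun G _ _ => rfl⟩
  | succ d ih =>
    obtain ⟨h', hh', hd', hG'⟩ := ih _ (measurable_lintegral_nextDensity μ hf (k + d) hh)
      (dependsOn_lintegral_nextDensity μ (k + d) hd)
    refine ⟨h', hh', hd', fun G hG hGd => ?_⟩
    rw [← hG' G hG hGd, hN (k + d) (fun w => G w * h fun i => φ (w i)) (hG.mul (hh.comp (measurable_comp_seq hφ)))]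
    · refine lintegral_congr fun w => ?_
      rw [← lintegral_step μ (k + d) w (hstep _ w) hh,
        ← lintegral_const_mul (f := fun e => h fun i => φ (Function.update w (k + d) e i)) _
          (hh.comp ((measurable_comp_seq hφ).comp
            ((measurable_update_pair (k + d)).comp measurable_prodMk_left)))]
      refine lintegral_congr fun e => ?_
      congr 1
      refine hGd fun i hi => ?_
      have : i ≠ k + d := by have := Set.mem_Iio.1 hi; omega
      simp [this]
    · intro w w' hw
      have h1 : G w = G w' := hGd fun i hi => hw i (by have := Set.mem_Iio.1 hi; simp; omega)
      have h2 : h (fun i => φ (w i)) = h (fun i => φ (w' i)) := hd fun i hi => by rw [hw i hi]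
      simp only [h1, h2]

end ProductCoupling

/-! ### The sequential maximal coupling of two laws on a sequence space -/

section ProductCoupling

lemma ennreal_sub_eq_mul {a b : ℝ≥0∞} (ha : a ≠ ∞) : a - b = a * (1 - b / a) := by
  rcases eq_or_ne a 0 with rfl | h0
  · simp
  · rw [ENNReal.mul_sub fun _ _ => ha, mul_one, ENNReal.mul_div_cancel h0 ha]

variable {E : Type*} [MeasurableSpace E] [StandardBorelSpace E] [Nonempty E]
  (μ : ℕ → Measure E) [∀ i, IsProbabilityMeasure (μ i)] {f₁ f₂ : (ℕ → E) → ℝ≥0∞}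

/-- The sequential maximal coupling of two probability measures `f₁ • ⨂ μ` and `f₂ • ⨂ μ` on a sequence
space, disintegrated along its first marginal. The probability that the `i`-th coordinates differ,
given the whole first sequence, is the mean over the past of the second sequence of the one-step
probability, because the future of the first sequence is irrelevant for it. -/
theorem exists_sequentialCoupling (hf₁ : Measurable f₁) (hf₂ : Measurable f₂)
    (h₁ : ∫⁻ x, f₁ x ∂Measure.infinitePi μ = 1) (h₂ : ∫⁻ x, f₂ x ∂Measure.infinitePi μ = 1) :
    ∃ p : Kernel (ℕ → E) (ℕ → E), IsMarkovKernel p ∧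
      ((Measure.infinitePi μ).withDensity f₁ ⊗ₘ p).snd = (Measure.infinitePi μ).withDensity f₂ ∧
      (∀ i, ∀ᵐ x ∂(Measure.infinitePi μ).withDensity f₁, p x {y | y i ≠ x i} =
        ∫⁻ y, (1 - nextDensity μ f₂ i y (x i) / nextDensity μ f₁ i x (x i)) ∂p x) ∧
      ∀ (i : ℕ) (G : (ℕ → E) → (ℕ → E) → E → ℝ≥0∞),
        (Measurable fun q : ((ℕ → E) × (ℕ → E)) × E => G q.1.1 q.1.2 q.2) →
        (∀ x x' y y', (∀ j ∈ Set.Iio i, x j = x' j) → (∀ j ∈ Set.Iio i, y j = y' j) →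
          G x y = G x' y') →
        ∫⁻ x, ∫⁻ y, G x y (x i) ∂p x ∂(Measure.infinitePi μ).withDensity f₁ =
          ∫⁻ x, ∫⁻ y, ∫⁻ z, nextDensity μ f₁ i x z * G x y z ∂μ i ∂p x
            ∂(Measure.infinitePi μ).withDensity f₁ := by
  classical
  have hX : Measurable fun (w : ℕ → E × E) (i : ℕ) => (w i).1 := measurable_comp_seq measurable_fst
  have hY : Measurable fun (w : ℕ → E × E) (i : ℕ) => (w i).2 := measurable_comp_seq measurable_snd
  have hXE : Measurable fun q : (ℕ → E × E) × E => ((fun i => (q.1 i).1 : ℕ → E), q.2) :=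
    (hX.comp measurable_fst).prodMk measurable_snd
  have hYE : Measurable fun q : (ℕ → E × E) × E => ((fun i => (q.1 i).2 : ℕ → E), q.2) :=
    (hY.comp measurable_fst).prodMk measurable_snd
  have hg₁ : ∀ n x, Measurable (nextDensity μ f₁ n x) := fun n x =>
    (measurable_nextDensity μ hf₁ n).comp measurable_prodMk_left
  have hg₂ : ∀ n x, Measurable (nextDensity μ f₂ n x) := fun n x =>
    (measurable_nextDensity μ hf₂ n).comp measurable_prodMk_left
  let K : ℕ → Kernel (ℕ → E × E) (E × E) := fun n =>
    maximalCouplingKernel (μ n) (fun w => nextDensity μ f₁ n fun i => (w i).1)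
      (fun w => nextDensity μ f₂ n fun i => (w i).2)
      ((measurable_nextDensity μ hf₁ n).comp hXE) ((measurable_nextDensity μ hf₂ n).comp hYE)
  have hKapp : ∀ n w, K n w = maximalCoupling (μ n) (nextDensity μ f₁ n fun i => (w i).1)
      (nextDensity μ f₂ n fun i => (w i).2) := fun n w => rfl
  have hKm : ∀ n, IsMarkovKernel (K n) := fun n => ⟨fun w => by
    rw [hKapp]
    exact isProbabilityMeasure_maximalCoupling (hg₁ n _) (hg₂ n _)
      (lintegral_nextDensity μ hf₁ n _) (lintegral_nextDensity μ hf₂ n _)⟩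
  have hKd : ∀ n, DependsOn (fun w => K n w) (Set.Iio n) := by
    intro n w w' hw
    simp only [hKapp]
    rw [dependsOn_nextDensity μ (f := f₁) n (x := fun i => (w i).1) (y := fun i => (w' i).1)
      fun i hi => by rw [hw i hi],
      dependsOn_nextDensity μ (f := f₂) n (x := fun i => (w i).2) (y := fun i => (w' i).2)
      fun i hi => by rw [hw i hi]]
  have hfst : ∀ (n : ℕ) (w : ℕ → E × E) (h : E → ℝ≥0∞), Measurable h →
      ∫⁻ e, h e.1 ∂K n w = ∫⁻ z, nextDensity μ f₁ n (fun i => (w i).1) z * h z ∂μ n :=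
    fun n w h hh => lintegral_maximalCoupling_fst (hg₁ n _) (hg₂ n _)
      (lintegral_nextDensity μ hf₁ n _) (lintegral_nextDensity μ hf₂ n _) hh
  have hsnd : ∀ (n : ℕ) (w : ℕ → E × E) (h : E → ℝ≥0∞), Measurable h →
      ∫⁻ e, h e.2 ∂K n w = ∫⁻ z, nextDensity μ f₂ n (fun i => (w i).2) z * h z ∂μ n :=
    fun n w h hh => lintegral_maximalCoupling_snd (hg₁ n _) (hg₂ n _)
      (lintegral_nextDensity μ hf₁ n _) (lintegral_nextDensity μ hf₂ n _) hh
  have hne : ∀ (n : ℕ) (w : ℕ → E × E) (h : E → ℝ≥0∞), Measurable h →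
      ∫⁻ q, {q : E × E | q.1 ≠ q.2}.indicator 1 q * h q.1 ∂K n w =
        ∫⁻ z, (nextDensity μ f₁ n (fun i => (w i).1) z -
          nextDensity μ f₂ n (fun i => (w i).2) z) * h z ∂μ n :=
    fun n w h hh => lintegral_maximalCoupling_ne (hg₁ n _) (hg₂ n _)
      (lintegral_nextDensity μ hf₁ n _) (lintegral_nextDensity μ hf₂ n _) hh
  obtain ⟨N, hNp, hN⟩ := exists_trajectory K hKd
  have hlaw₁ := map_trajectory_eq_withDensity μ hN hf₁ h₁ measurable_fst hfst
  have hlaw₂ := map_trajectory_eq_withDensity μ hN hf₂ h₂ measurable_snd hsnd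
  let T : (ℕ → E × E) → (ℕ → E) × (ℕ → E) := fun w => (fun i => (w i).1, fun i => (w i).2)
  have hT : Measurable T := hX.prodMk hY
  let ρ := N.map T
  have hρ : IsProbabilityMeasure ρ := Measure.isProbabilityMeasure_map hT.aemeasurable
  have hρ₁ : ρ.fst = (Measure.infinitePi μ).withDensity f₁ := by
    rw [← hlaw₁, Measure.fst, Measure.map_map measurable_fst hT]; rfl
  have hρ₂ : ρ.snd = (Measure.infinitePi μ).withDensity f₂ := by
    rw [← hlaw₂, Measure.snd, Measure.map_map measurable_snd hT]; rfl
  let p := ρ.condKernel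
  have hdis : (Measure.infinitePi μ).withDensity f₁ ⊗ₘ p = ρ := by
    rw [← hρ₁]; exact ρ.disintegrate ρ.condKernel
  have hP₁ : IsProbabilityMeasure ((Measure.infinitePi μ).withDensity f₁) := by
    rw [← hρ₁]; infer_instance
  have hint : ∀ H : (ℕ → E) × (ℕ → E) → ℝ≥0∞, Measurable H →
      ∫⁻ x, ∫⁻ y, H (x, y) ∂p x ∂(Measure.infinitePi μ).withDensity f₁ =
        ∫⁻ w, H (T w) ∂N := by
    intro H hH
    rw [← Measure.lintegral_compProd hH, hdis, lintegral_map hH hT]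
  have hTupd : ∀ w n e, T (Function.update w n e) =
      (Function.update (T w).1 n e.1, Function.update (T w).2 n e.2) := by
    intro w n e
    exact Prod.ext (comp_update_apply (φ := Prod.fst) w n e) (comp_update_apply (φ := Prod.snd) w n e)
  refine ⟨p, inferInstance, by rw [hdis, hρ₂], fun i => ?_, fun i G hG hGd => ?_⟩
  -- both sides have the same integral over every set depending on finitely many coordinates
  · have hDne : MeasurableSet {q : (ℕ → E) × (ℕ → E) | q.2 i ≠ q.1 i} :=
      (measurableSet_eq_fun ((measurable_pi_apply i).comp measurable_snd)
        ((measurable_pi_apply i).comp measurable_fst)).compl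
    let U : (ℕ → E) × (ℕ → E) → ℝ≥0∞ := {q | q.2 i ≠ q.1 i}.indicator 1
    have hU : Measurable U := measurable_one.indicator hDne
    let V : (ℕ → E) × (ℕ → E) → ℝ≥0∞ := fun q =>
      1 - nextDensity μ f₂ i q.2 (q.1 i) / nextDensity μ f₁ i q.1 (q.1 i)
    have hV : Measurable V := by
      refine measurable_const.sub (Measurable.div ?_ ?_)
      · exact (measurable_nextDensity μ hf₂ i).comp
          (measurable_snd.prodMk ((measurable_pi_apply i).comp measurable_fst))
      · exact (measurable_nextDensity μ hf₁ i).comp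
          (measurable_fst.prodMk ((measurable_pi_apply i).comp measurable_fst))
    have hUp : ∀ x, p x {y | y i ≠ x i} = ∫⁻ y, U (x, y) ∂p x := by
      intro x
      exact (lintegral_indicator_one (hDne.preimage measurable_prodMk_left)).symm
    simp_rw [hUp]
    have hmU : Measurable fun x => ∫⁻ y, U (x, y) ∂p x := hU.lintegral_kernel_prod_right'
    have hmV : Measurable fun x => ∫⁻ y, V (x, y) ∂p x := hV.lintegral_kernel_prod_right'
    have hle : ∀ x, ∫⁻ y, U (x, y) ∂p x ≤ 1 := by
      intro x
      calc ∫⁻ y, U (x, y) ∂p x ≤ ∫⁻ _, 1 ∂p x :=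
            lintegral_mono fun y => Set.indicator_le_self' (fun _ _ => zero_le_one) _
        _ = 1 := by simp
    have hfin : ∫⁻ x, ∫⁻ y, U (x, y) ∂p x ∂(Measure.infinitePi μ).withDensity f₁ ≠ ∞ := by
      refine ne_top_of_le_ne_top ENNReal.one_ne_top ?_
      calc _ ≤ ∫⁻ _, 1 ∂(Measure.infinitePi μ).withDensity f₁ := lintegral_mono hle
        _ = 1 := by simp
    have hcyl : ∀ (n : ℕ) (h : (ℕ → E) → ℝ≥0∞), Measurable h → DependsOn h (Set.Iio n) →
        ∫⁻ x, h x * ∫⁻ y, U (x, y) ∂p x ∂(Measure.infinitePi μ).withDensity f₁ =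
          ∫⁻ x, h x * ∫⁻ y, V (x, y) ∂p x ∂(Measure.infinitePi μ).withDensity f₁ := by
      intro n h hh hd
      -- the test function may be replaced by one of the coordinates up to `i`
      obtain ⟨h', hh', hd', hG'⟩ := exists_forget_future μ hN hf₁ measurable_fst hfst (i + 1) n h hh
        (hd.mono (Set.Iio_subset_Iio (by omega)))
      have hswap : ∀ W : (ℕ → E) × (ℕ → E) → ℝ≥0∞, Measurable W →
          ∫⁻ x, h x * ∫⁻ y, W (x, y) ∂p x ∂(Measure.infinitePi μ).withDensity f₁ =
            ∫⁻ w, W (T w) * h (T w).1 ∂N := by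
        intro W hW
        rw [← hint (fun q => W q * h q.1) (hW.mul (hh.comp measurable_fst))]
        refine lintegral_congr fun x => ?_
        have hWx : Measurable fun y => W (x, y) := hW.comp measurable_prodMk_left
        dsimp only
        rw [lintegral_mul_const _ hWx, mul_comm]
      have hUd : DependsOn (fun w => U (T w)) (Set.Iio (i + 1)) := by
        intro w w' hw
        have := hw i (by simp)
        simp only [U, T, Set.indicator, Set.mem_ofPred_eq, this, Pi.one_apply]
      have hVd : DependsOn (fun w => V (T w)) (Set.Iio (i + 1)) := by
        intro w w' hw
        have hi := hw i (by simp)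
        simp only [V, T, hi]
        rw [dependsOn_nextDensity μ (f := f₁) i (x := fun j => (w j).1) (y := fun j => (w' j).1)
          fun j hj => by rw [hw j (Set.Iio_subset_Iio (Nat.le_succ i) hj)],
          dependsOn_nextDensity μ (f := f₂) i (x := fun j => (w j).2) (y := fun j => (w' j).2)
          fun j hj => by rw [hw j (Set.Iio_subset_Iio (Nat.le_succ i) hj)]]
      have hh'T : Measurable fun w => h' (T w).1 := hh'.comp hX
      have hh'd : DependsOn (fun w => h' (T w).1) (Set.Iio (i + 1)) :=
        fun w w' hw => hd' fun j hj => by simp only [T]; rw [hw j hj]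
      rw [hswap U hU, hswap V hV]
      have e1 := hG' (fun w => U (T w)) (hU.comp hT) hUd
      have e2 := hG' (fun w => V (T w)) (hV.comp hT) hVd
      refine e1.trans (Eq.trans ?_ e2.symm)
      change ∫⁻ w, U (T w) * h' (T w).1 ∂N = ∫⁻ w, V (T w) * h' (T w).1 ∂N
      rw [hN i (fun w => U (T w) * h' (T w).1) ((hU.comp hT).mul hh'T)
        (fun w w' hw => by have := hUd hw; have := hh'd hw; simp_all only),
        hN i (fun w => V (T w) * h' (T w).1) ((hV.comp hT).mul hh'T)
        (fun w w' hw => by have := hVd hw; have := hh'd hw; simp_all only)]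
      refine lintegral_congr fun w => ?_
      simp_rw [hTupd]
      have hmz : Measurable fun z => h' (Function.update (T w).1 i z) :=
        hh'.comp ((measurable_update_pair i).comp measurable_prodMk_left)
      have hUe : ∀ e : E × E, U (Function.update (T w).1 i e.1, Function.update (T w).2 i e.2) =
          {q : E × E | q.1 ≠ q.2}.indicator 1 e := by
        intro e
        by_cases he : e.1 = e.2 <;> simp [U, Set.indicator, he, eq_comm]
      have hVe : ∀ e : E × E, V (Function.update (T w).1 i e.1, Function.update (T w).2 i e.2) =
          1 - nextDensity μ f₂ i (T w).2 e.1 / nextDensity μ f₁ i (T w).1 e.1 := by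
        intro e
        have hag : ∀ (x : ℕ → E) (z : E), ∀ j ∈ Set.Iio i, Function.update x i z j = x j :=
          fun x z j hj => Function.update_of_ne (ne_of_lt (Set.mem_Iio.1 hj)) _ _
        simp only [V, Function.update_self]
        rw [dependsOn_nextDensity μ (f := f₁) i (hag (T w).1 e.1),
          dependsOn_nextDensity μ (f := f₂) i (hag (T w).2 e.2)]
      simp_rw [hUe, hVe]
      rw [hne i w _ hmz, hfst i w (fun z => (1 - nextDensity μ f₂ i (T w).2 z /
        nextDensity μ f₁ i (T w).1 z) * h' (Function.update (T w).1 i z))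
        ((measurable_const.sub ((hg₂ i _).div (hg₁ i _))).mul hmz)]
      refine lintegral_congr_ae ?_
      filter_upwards [ae_nextDensity_lt_top μ hf₁ i (T w).1] with z hz
      rw [← mul_assoc]
      congr 1
      exact ennreal_sub_eq_mul hz.ne
    refine (withDensity_eq_iff hmU.aemeasurable hmV.aemeasurable hfin).1 ?_
    have : IsFiniteMeasure (((Measure.infinitePi μ).withDensity f₁).withDensity
        fun x => ∫⁻ y, U (x, y) ∂p x) := isFiniteMeasure_withDensity hfin
    refine ext_of_forall_dependsOn fun n A hA hd => ?_
    rw [withDensity_apply _ hA, withDensity_apply _ hA, ← lintegral_indicator hA,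
      ← lintegral_indicator hA]
    have := hcyl n _ (measurable_one.indicator hA) hd
    convert this using 2 <;>
    · ext x
      by_cases hx : x ∈ A <;> simp [hx]
  · rw [hint (fun q => G q.1 q.2 (q.1 i)) (hG.comp (measurable_id.prodMk
      ((measurable_pi_apply i).comp measurable_fst))),
      hint (fun q => ∫⁻ z, nextDensity μ f₁ i q.1 z * G q.1 q.2 z ∂μ i)]
    · have hm : Measurable fun w => G (T w).1 (T w).2 ((T w).1 i) :=
        hG.comp (hT.prodMk ((measurable_pi_apply i).comp hX))
      have hag : ∀ (x : ℕ → E) (z : E), ∀ j ∈ Set.Iio i, Function.update x i z j = x j :=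
        fun x z j hj => Function.update_of_ne (ne_of_lt (Set.mem_Iio.1 hj)) _ _
      rw [hN i _ hm]
      · refine lintegral_congr fun w => ?_
        simp_rw [hTupd, Function.update_self, hGd _ _ _ _ (hag (T w).1 _) (hag (T w).2 _)]
        exact hfst i w _ (hG.comp measurable_prodMk_left)
      · intro w w' hw
        have hi := hw i (by simp)
        have := hGd (T w).1 (T w').1 (T w).2 (T w').2
          (fun j hj => by simp only [T]; rw [hw j (Set.Iio_subset_Iio (Nat.le_succ i) hj)])
          (fun j hj => by simp only [T]; rw [hw j (Set.Iio_subset_Iio (Nat.le_succ i) hj)])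
        dsimp only
        rw [this]
        simp only [T, hi]
    · refine Measurable.lintegral_prod_right' (f := fun q : ((ℕ → E) × (ℕ → E)) × E =>
        nextDensity μ f₁ i q.1.1 q.2 * G q.1.1 q.1.2 q.2) (Measurable.mul ?_ hG)
      exact (measurable_nextDensity μ hf₁ i).comp
        ((measurable_fst.comp measurable_fst).prodMk measurable_snd)

/-- The cost of the sequential maximal coupling, coordinate by coordinate. -/
theorem exists_sequentialCoupling_cost (hf₁ : Measurable f₁) (hf₂ : Measurable f₂)
    (h₁ : ∫⁻ x, f₁ x ∂Measure.infinitePi μ = 1) (h₂ : ∫⁻ x, f₂ x ∂Measure.infinitePi μ = 1) :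
    ∃ p : Kernel (ℕ → E) (ℕ → E), IsMarkovKernel p ∧
      ((Measure.infinitePi μ).withDensity f₁ ⊗ₘ p).snd = (Measure.infinitePi μ).withDensity f₂ ∧
      ∀ (α : ℝ → ℝ≥0∞), IsConvexCost α → ∀ (c : E → ℝ≥0∞), Measurable c → ∀ i,
        ∫⁻ x, c (x i) * α (p x {y | y i ≠ x i}).toReal ∂(Measure.infinitePi μ).withDensity f₁ ≤
          ∫⁻ x, ∫⁻ y, ∫⁻ z, nextDensity μ f₁ i x z * (c z *
            α (1 - nextDensity μ f₂ i y z / nextDensity μ f₁ i x z).toReal) ∂μ i ∂p x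
            ∂(Measure.infinitePi μ).withDensity f₁ := by
  obtain ⟨p, hp, hsnd, hu, hstep⟩ := exists_sequentialCoupling μ hf₁ hf₂ h₁ h₂
  refine ⟨p, hp, hsnd, fun α hα c hc i => ?_⟩
  have hdiv : Measurable fun q : ((ℕ → E) × (ℕ → E)) × E =>
      1 - nextDensity μ f₂ i q.1.2 q.2 / nextDensity μ f₁ i q.1.1 q.2 := by
    refine measurable_const.sub (Measurable.div ?_ ?_)
    · exact (measurable_nextDensity μ hf₂ i).comp
        ((measurable_snd.comp measurable_fst).prodMk measurable_snd)
    · exact (measurable_nextDensity μ hf₁ i).comp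
        ((measurable_fst.comp measurable_fst).prodMk measurable_snd)
  rw [← hstep i (fun x y z => c z *
    α (1 - nextDensity μ f₂ i y z / nextDensity μ f₁ i x z).toReal)]
  · refine lintegral_mono_ae ?_
    filter_upwards [hu i] with x hx
    have hm : Measurable fun y =>
        1 - nextDensity μ f₂ i y (x i) / nextDensity μ f₁ i x (x i) :=
      hdiv.comp ((measurable_prodMk_left (x := x)).prodMk measurable_const)
    have hαm : Measurable fun y => α (1 - nextDensity μ f₂ i y (x i) /
      nextDensity μ f₁ i x (x i)).toReal := hα.measurable.comp hm.ennreal_toReal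
    rw [hx, lintegral_const_mul _ hαm]
    gcongr
    exact hα.lintegral_le (p x) hm fun y => tsub_le_self
  · exact (hc.comp measurable_snd).mul (hα.measurable.comp hdiv.ennreal_toReal)
  · intro x x' y y' hx hy
    ext z
    rw [dependsOn_nextDensity μ (f := f₁) i hx, dependsOn_nextDensity μ (f := f₂) i hy]

end ProductCoupling

/-! ### The inequality between cost and entropy in one coordinate -/

section CostFunctions

open InformationTheory

/-- Supporting lines in real form. -/
lemma isConvexCost_ofReal {g : ℝ → ℝ} (hg : Measurable g)
    (hsub : ∀ s ∈ Set.Ico (0 : ℝ) 1, ∃ k, 0 ≤ k ∧ ∀ u ∈ Set.Icc (0 : ℝ) 1, g s + k * (u - s) ≤ g u)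
    (h0 : ∀ u ∈ Set.Icc (0 : ℝ) 1, 0 ≤ g u) : IsConvexCost fun u => ENNReal.ofReal (g u) where
  measurable := hg.ennreal_ofReal
  ne_top _ _ := ENNReal.ofReal_ne_top
  subgradient s hs := by
    obtain ⟨k, hk, h⟩ := hsub s hs
    refine ⟨ENNReal.ofReal k, ENNReal.ofReal_ne_top, fun u hu => ?_⟩
    rw [← ENNReal.ofReal_mul hk, ← ENNReal.ofReal_mul hk,
      ← ENNReal.ofReal_add (h0 s ⟨hs.1, hs.2.le⟩) (mul_nonneg hk hu.1),
      ← ENNReal.ofReal_add (h0 u hu) (mul_nonneg hk hs.1)]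
    refine ENNReal.ofReal_le_ofReal ?_
    have := h u hu
    linarith

/-- The tangent inequality for `x log x`, which remains true at `A = 0`. -/
lemma mul_log_le {A a : ℝ} (hA : 0 ≤ A) (ha : 0 < a) :
    A * Real.log a ≤ A * Real.log A + a - A := by
  rcases eq_or_lt_of_le hA with rfl | hA
  · simp; exact ha.le
  · have h := Real.log_le_sub_one_of_pos (div_pos ha hA)
    rw [Real.log_div ha.ne' hA.ne'] at h
    have h2 := mul_le_mul_of_nonneg_left h hA.le
    rw [mul_sub, mul_sub, mul_div_cancel₀ _ hA.ne'] at h2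
    linarith

/-- The log-sum inequality for `(A, 1)` and `(a, 1)` with weights `t` and `1 - t`; it is behind the convexity of `demboFunction`. -/
lemma log_sum_le {t A a : ℝ} (ht : t ∈ Set.Ioo (0 : ℝ) 1) (hA : 0 ≤ A) (ha : 0 < a) :
    (t * A + (1 - t)) * (Real.log (t * A + (1 - t)) - Real.log (t * a + (1 - t))) ≤
      t * (A * (Real.log A - Real.log a)) := by
  have hB : 0 < t * A + (1 - t) := by nlinarith [ht.1, ht.2, mul_nonneg ht.1.le hA]
  have hb : 0 < t * a + (1 - t) := by nlinarith [ht.1, ht.2, mul_pos ht.1 ha]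
  set B := t * A + (1 - t) with hBdef
  set b := t * a + (1 - t) with hbdef
  -- `log x ≤ x - 1` at `x = B * a / (b * A)` and at `x = B / b`
  have h1 : A * Real.log (B * a / b) ≤ A * Real.log A + B * a / b - A :=
    mul_log_le hA (by positivity)
  have h2 : Real.log (B / b) ≤ B / b - 1 := Real.log_le_sub_one_of_pos (by positivity)
  rw [Real.log_div (by positivity) hb.ne', Real.log_mul hB.ne' ha.ne'] at h1
  rw [Real.log_div hB.ne' hb.ne'] at h2
  have h3 := mul_le_mul_of_nonneg_left h1 ht.1.le
  have h4 := mul_le_mul_of_nonneg_left h2 (sub_nonneg.2 ht.2.le)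
  have h5 : t * (B * a / b) + (1 - t) * (B / b) = B := by
    field_simp
    rw [hbdef]
  have h6 : B * (Real.log B - Real.log b) =
    t * A * (Real.log B - Real.log b) + (1 - t) * (Real.log B - Real.log b) := by
    rw [hBdef]; ring
  rw [h6]
  linarith

lemma isConvexCost_demboFunction {t : ℝ} (ht : t ∈ Set.Icc (0 : ℝ) 1) :
    IsConvexCost (demboFunction t) := by
  rcases eq_or_lt_of_le ht.1 with h0 | h0
  · subst h0
    have h : ∀ s ∈ Set.Ico (0 : ℝ) 1, ∀ u ∈ Set.Icc (0 : ℝ) 1,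
        ((1 - s) * Real.log (1 - s) + s) + -Real.log (1 - s) * (u - s) ≤
          (1 - u) * Real.log (1 - u) + u := by
      intro s hs u hu
      have := mul_log_le (A := 1 - u) (a := 1 - s) (by linarith [hu.2]) (by linarith [hs.2])
      linarith
    have h' := isConvexCost_ofReal (g := fun u => (1 - u) * Real.log (1 - u) + u) (by fun_prop)
      (fun s hs => ⟨-Real.log (1 - s),
        by have := Real.log_nonpos (x := 1 - s) (by linarith [hs.2]) (by linarith [hs.1]); linarith,
        h s hs⟩)
      (fun u hu => by have := h 0 (by simp) u hu; simpa using this)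
    convert h' using 2
    simp [demboFunction]
  rcases eq_or_lt_of_le ht.2 with h1 | h1
  · subst h1
    have hle : ∀ s ∈ Set.Ico (0 : ℝ) 1, ∀ u ∈ Set.Ico (0 : ℝ) 1,
        (-s - Real.log (1 - s)) + s / (1 - s) * (u - s) ≤ -u - Real.log (1 - u) := by
      intro s hs u hu
      have ha : 0 < 1 - s := by linarith [hs.2]
      have hA : 0 < 1 - u := by linarith [hu.2]
      have := Real.log_le_sub_one_of_pos (div_pos hA ha)
      rw [Real.log_div hA.ne' ha.ne'] at this
      have e : s / (1 - s) * (u - s) = 1 - (1 - u) / (1 - s) + s - u := by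
        field_simp; ring
      linarith
    have hnn : ∀ u ∈ Set.Ico (0 : ℝ) 1, 0 ≤ -u - Real.log (1 - u) := fun u hu => by
      have := hle 0 (by simp) u hu; simpa using this
    have hval : ∀ u : ℝ, u < 1 →
        demboFunction 1 u = ENNReal.ofReal (-u - Real.log (1 - u)) := fun u hu => by
      simp [demboFunction, hu]
    refine ⟨?_, fun s hs => ?_, fun s hs => ?_⟩
    · unfold demboFunction
      simp only [one_ne_zero, if_false, if_true]
      exact Measurable.ite measurableSet_Iio (by fun_prop) measurable_const
    · rw [hval s hs.2]; exact ENNReal.ofReal_ne_top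
    · have hk : 0 ≤ s / (1 - s) := div_nonneg hs.1 (by linarith [hs.2])
      refine ⟨ENNReal.ofReal (s / (1 - s)), ENNReal.ofReal_ne_top, fun u hu => ?_⟩
      rcases eq_or_lt_of_le hu.2 with hu1 | hu1
      · subst hu1
        have : demboFunction 1 1 = ∞ := by simp [demboFunction]
        rw [this]; simp
      rw [hval s hs.2, hval u hu1, ← ENNReal.ofReal_mul hk, ← ENNReal.ofReal_mul hk,
        ← ENNReal.ofReal_add (hnn s hs) (mul_nonneg hk hu.1),
        ← ENNReal.ofReal_add (hnn u ⟨hu.1, hu1⟩) (mul_nonneg hk hs.1)]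
      refine ENNReal.ofReal_le_ofReal ?_
      have := hle s hs u ⟨hu.1, hu1⟩
      linarith
  · have ht' : t ∈ Set.Ioo (0 : ℝ) 1 := ⟨h0, h1⟩
    have htt : 0 < t * (1 - t) := mul_pos h0 (by linarith)
    have h : ∀ s ∈ Set.Ico (0 : ℝ) 1, ∀ u ∈ Set.Icc (0 : ℝ) 1,
        (t * (1 - s) * Real.log (1 - s) - (1 - t * s) * Real.log (1 - t * s)) / (t * (1 - t)) +
          (Real.log (1 - t * s) - Real.log (1 - s)) / (1 - t) * (u - s) ≤
          (t * (1 - u) * Real.log (1 - u) - (1 - t * u) * Real.log (1 - t * u)) / (t * (1 - t)) := by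
      intro s hs u hu
      have := log_sum_le ht' (A := 1 - u) (a := 1 - s) (by linarith [hu.2]) (by linarith [hs.2])
      rw [show t * (1 - u) + (1 - t) = 1 - t * u by ring,
        show t * (1 - s) + (1 - t) = 1 - t * s by ring] at this
      have e : (Real.log (1 - t * s) - Real.log (1 - s)) / (1 - t) * (u - s) =
          (t * (Real.log (1 - t * s) - Real.log (1 - s)) * (u - s)) / (t * (1 - t)) := by
        field_simp
      rw [e, ← add_div]
      gcongr
      nlinarith
    have h' := isConvexCost_ofReal (g := fun u =>
        (t * (1 - u) * Real.log (1 - u) - (1 - t * u) * Real.log (1 - t * u)) / (t * (1 - t)))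
      (by fun_prop)
      (fun s hs => ⟨(Real.log (1 - t * s) - Real.log (1 - s)) / (1 - t), by
        refine div_nonneg (sub_nonneg.2 (Real.log_le_log (by linarith [hs.2]) ?_)) (by linarith)
        nlinarith [hs.1], h s hs⟩)
      (fun u hu => by have := h 0 (by simp) u hu; simpa using this)
    convert h' using 2
    simp [demboFunction, h0.ne', h1.ne]

lemma isConvexCost_sq : IsConvexCost fun u => ENNReal.ofReal (u ^ 2) :=
  isConvexCost_ofReal (by fun_prop)
    (fun s hs => ⟨2 * s, by linarith [hs.1], fun u _ => by nlinarith [sq_nonneg (u - s)]⟩)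
    (fun u _ => sq_nonneg u)

/-- The pointwise inequality between a cost and the entropies of two densities `a`, `b`. Under the
maximal coupling a point with densities `a` and `b` moves with probability `(1 - b / a)₊`. -/
def CostEntropyBound (α : ℝ → ℝ≥0∞) (c₁ c₂ : ℝ≥0∞) : Prop :=
  ∀ a b : ℝ≥0∞, a ≠ ∞ → b ≠ ∞ →
    a * α (1 - b / a).toReal ≤ c₁ * entropyFun a + c₂ * entropyFun b

lemma demboFunction_zero_right (t : ℝ) : demboFunction t 0 = 0 := by
  unfold demboFunction
  split_ifs <;> simp_all

/-- It suffices to consider finite densities `b < a`. -/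
lemma costEntropyBound_of_real {α : ℝ → ℝ≥0∞} {c₁ c₂ : ℝ≥0∞} (h0 : α 0 = 0)
    (h : ∀ s r : ℝ, 0 ≤ r → r < s → ENNReal.ofReal s * α (1 - r / s) ≤
      c₁ * ENNReal.ofReal (klFun s) + c₂ * ENNReal.ofReal (klFun r)) :
    CostEntropyBound α c₁ c₂ := by
  intro a b ha hb
  rcases eq_or_ne a 0 with rfl | ha0
  · simp
  rcases le_or_gt a b with hab | hab
  · have : 1 - b / a = 0 := by
      rw [tsub_eq_zero_iff_le, ENNReal.le_div_iff_mul_le (Or.inl ha0) (Or.inl ha), one_mul]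
      exact hab
    rw [this]; simp [h0]
  · have hlt : b.toReal < a.toReal := (ENNReal.toReal_lt_toReal hb ha).2 hab
    have := h a.toReal b.toReal ENNReal.toReal_nonneg hlt
    rw [ENNReal.ofReal_toReal ha] at this
    have hle : b / a ≤ 1 := ENNReal.div_le_of_le_mul (by simpa using hab.le)
    rwa [ENNReal.toReal_sub_of_le hle ENNReal.one_ne_top, ENNReal.toReal_div, ENNReal.toReal_one]

lemma costEntropyBound_demboFunction {t : ℝ} (ht : t ∈ Set.Icc (0 : ℝ) 1) :
    CostEntropyBound (demboFunction t) (ENNReal.ofReal t)⁻¹ (ENNReal.ofReal (1 - t))⁻¹ := by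
  refine costEntropyBound_of_real (demboFunction_zero_right t) fun s r hr hrs => ?_
  have hs : 0 < s := hr.trans_lt hrs
  rcases eq_or_lt_of_le ht.1 with h0 | h0
  · subst h0
    -- the first constant is infinite, so that only `s = 1` matters
    rcases eq_or_ne (klFun s) 0 with hk | hk
    · rw [klFun_eq_zero_iff hs.le] at hk
      subst hk
      simp [demboFunction, klFun_apply]
      exact ENNReal.ofReal_le_ofReal (by linarith)
    · have hk' : ENNReal.ofReal (klFun s) ≠ 0 := by
        simpa using lt_of_le_of_ne (klFun_nonneg hs.le) hk.symm
      simp [ENNReal.top_mul hk']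
  rcases eq_or_lt_of_le ht.2 with h1 | h1
  · subst h1
    -- the second constant is infinite, so that only `r = 1` matters
    rcases eq_or_ne (klFun r) 0 with hk | hk
    · rw [klFun_eq_zero_iff hr] at hk
      subst hk
      have hlt : 1 - 1 / s < 1 := by have := one_div_pos.2 hs; linarith
      simp only [demboFunction, one_ne_zero, if_false, if_true, hlt]
      rw [← ENNReal.ofReal_mul hs.le]
      simp [klFun_apply]
      refine ENNReal.ofReal_le_ofReal (le_of_eq ?_)
      field_simp
      ring
    · have hk' : ENNReal.ofReal (klFun r) ≠ 0 := by
        simpa using lt_of_le_of_ne (klFun_nonneg hr) hk.symm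
      simp [ENNReal.top_mul hk']
  · have h1' : 0 < 1 - t := by linarith
    have hks := klFun_nonneg hs.le
    have hkr := klFun_nonneg hr
    rw [← ENNReal.ofReal_inv_of_pos h0, ← ENNReal.ofReal_inv_of_pos h1',
      ← ENNReal.ofReal_mul (by positivity), ← ENNReal.ofReal_mul (by positivity),
      ← ENNReal.ofReal_add (by positivity) (by positivity)]
    simp only [demboFunction, h0.ne', h1.ne, if_false]
    rw [← ENNReal.ofReal_mul hs.le]
    refine ENNReal.ofReal_le_ofReal ?_
    -- the difference of the two sides is `klFun m / (t * (1 - t))` with `m = (1 - t) s + t r`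
    set m := (1 - t) * s + t * r with hm
    have hmpos : 0 < m := by positivity
    have hkm := klFun_nonneg hmpos.le
    have e1 : 1 - (1 - r / s) = r / s := by ring
    have e2 : 1 - t * (1 - r / s) = m / s := by rw [hm]; field_simp; ring
    have e3 : r * Real.log (r / s) = r * Real.log r - r * Real.log s := by
      rcases eq_or_lt_of_le hr with rfl | hr
      · simp
      · rw [Real.log_div hr.ne' hs.ne']; ring
    rw [e1, e2, Real.log_div hmpos.ne' hs.ne', ← sub_nonneg]
    have e4 : t⁻¹ * klFun s + (1 - t)⁻¹ * klFun r -
        s * ((t * (r / s) * Real.log (r / s) - m / s * (Real.log m - Real.log s)) / (t * (1 - t))) =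
        klFun m / (t * (1 - t)) := by
      have e5 : s * ((t * (r / s) * Real.log (r / s) - m / s * (Real.log m - Real.log s)) /
          (t * (1 - t))) =
          (t * (r * Real.log (r / s)) - m * (Real.log m - Real.log s)) / (t * (1 - t)) := by
        field_simp
      rw [e5, e3]
      field_simp
      simp only [klFun_apply]
      rw [hm]
      ring
    rw [e4]
    positivity

lemma sq_le_klFun_of_le_one {x : ℝ} (h0 : 0 ≤ x) (h1 : x ≤ 1) : (1 - x) ^ 2 ≤ 2 * klFun x := by
  rcases eq_or_lt_of_le h0 with rfl | h0
  · simp [klFun_apply]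
  -- `log (1 / x) ≤ sinh (log (1 / x))`
  have h := Real.self_le_sinh_iff.2 (Real.log_nonneg ((one_le_inv₀ h0).2 h1))
  rw [Real.sinh_log (by positivity), Real.log_inv, inv_inv] at h
  have h2 := mul_le_mul_of_nonneg_left h h0.le
  have e : x * ((x⁻¹ - x) / 2) = (1 - x ^ 2) / 2 := by field_simp
  rw [e] at h2
  rw [klFun_apply]
  nlinarith

lemma sq_le_klFun_of_one_le {x : ℝ} (h1 : 1 ≤ x) : (x - 1) ^ 2 ≤ 2 * x * klFun x := by
  have h0 : 0 < x := by linarith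
  have hw0 : 0 ≤ 1 - x⁻¹ := by
    have := inv_le_one_of_one_le₀ h1; linarith
  have hw1 : |1 - x⁻¹| < 1 := by
    rw [abs_of_nonneg hw0]; have := inv_pos.2 h0; linarith
  -- the first two terms of the series of `- log (1 - w)` at `w = 1 - 1 / x`
  have h := sum_le_hasSum (Finset.range 2) (fun i _ => by positivity)
    (Real.hasSum_pow_div_log_of_abs_lt_one hw1)
  rw [sub_sub_cancel, Real.log_inv, neg_neg] at h
  simp [Finset.sum_range_succ] at h
  have h2 := mul_le_mul_of_nonneg_left h (by positivity : 0 ≤ 2 * x ^ 2)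
  have e : 2 * x ^ 2 * (1 - x⁻¹ + (1 - x⁻¹) ^ 2 / (1 + 1)) = 3 * x ^ 2 - 4 * x + 1 := by
    field_simp; ring
  rw [e] at h2
  rw [klFun_apply]
  nlinarith

lemma costEntropyBound_sq : CostEntropyBound (fun u => ENNReal.ofReal (u ^ 2)) 4 4 := by
  refine costEntropyBound_of_real (by simp) fun s r hr hrs => ?_
  have hs : 0 < s := hr.trans_lt hrs
  have hks := klFun_nonneg hs.le
  have hkr := klFun_nonneg hr
  rw [show (4 : ℝ≥0∞) = ENNReal.ofReal 4 by simp, ← ENNReal.ofReal_mul hs.le,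
    ← ENNReal.ofReal_mul (by norm_num), ← ENNReal.ofReal_mul (by norm_num),
    ← ENNReal.ofReal_add (by positivity) (by positivity)]
  refine ENNReal.ofReal_le_ofReal ?_
  have e : s * (1 - r / s) ^ 2 = (s - r) ^ 2 / s := by field_simp
  rw [e, div_le_iff₀ hs]
  -- each of `s` and `r` contributes according to the side of `1` on which it lies
  rcases le_total 1 r with h1 | h1
  · have := sq_le_klFun_of_one_le (h1.trans hrs.le)
    nlinarith [mul_nonneg hs.le hkr, mul_nonneg hs.le hks]
  rcases le_total 1 s with h2 | h2
  · have a1 := sq_le_klFun_of_one_le h2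
    have a2 := sq_le_klFun_of_le_one hr h1
    have a3 := mul_le_mul_of_nonneg_left a2 hs.le
    nlinarith [sq_nonneg ((s - 1) - (1 - r)), sq_nonneg (1 - r)]
  · have a2 := sq_le_klFun_of_le_one hr h1
    have a3 := mul_le_mul_of_nonneg_left a2 hs.le
    have a4 : (s - r) ^ 2 ≤ s * (1 - r) ^ 2 := by
      have : r ^ 2 ≤ s := by nlinarith
      nlinarith [mul_nonneg (sub_nonneg.2 h2) (sub_nonneg.2 this)]
    nlinarith [mul_nonneg hs.le hkr, mul_nonneg hs.le hks]

/-- Against the density `1`, the cost `demboFunction 1` is at most logarithmic. -/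
lemma mul_demboFunction_one_le {a : ℝ≥0∞} (ha : a ≠ ∞) :
    a * demboFunction 1 (1 - 1 / a).toReal ≤ a * ENNReal.ofReal (Real.log a.toReal) := by
  rcases le_or_gt a 1 with h1 | h1
  · have : 1 - 1 / a = 0 := by
      rw [tsub_eq_zero_iff_le, one_div]
      exact ENNReal.one_le_inv.2 h1
    rw [this]; simp [demboFunction_zero_right]
  · gcongr
    have ha1 : 1 < a.toReal := by
      simpa using (ENNReal.toReal_lt_toReal ENNReal.one_ne_top ha).2 h1
    have hle : 1 / a ≤ 1 := by rw [one_div]; exact ENNReal.inv_le_one.2 h1.le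
    rw [ENNReal.toReal_sub_of_le hle ENNReal.one_ne_top, ENNReal.toReal_div, ENNReal.toReal_one]
    have hpos : 0 < 1 / a.toReal := by positivity
    have hlt : 1 / a.toReal < 1 := by rw [div_lt_one (by linarith)]; exact ha1
    simp only [demboFunction, one_ne_zero, if_false, if_true, sub_lt_self_iff, hpos]
    refine ENNReal.ofReal_le_ofReal ?_
    rw [sub_sub_cancel, one_div, Real.log_inv]
    rw [one_div] at hlt
    linarith

end CostFunctions

/-! ### Uniqueness of the Poisson law -/

section Uniqueness

variable {Z : Type*} [MeasurableSpace Z] {S : Set (Measure Z)} {ν : Measure Z}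

lemma measurable_eval_subtype {A : Set Z} (hA : MeasurableSet A) :
    Measurable fun η : S => (η : Measure Z) A :=
  (Measure.measurable_coe hA).comp measurable_subtype_coe

/-- Evaluations at sets of finite `ν`-measure suffice for measurability. -/
lemma measurable_of_eval_finite [SigmaFinite ν] {X : Type*} [MeasurableSpace X] {κ : X → Measure Z}
    (h : ∀ A, MeasurableSet A → ν A < ∞ → Measurable fun x => κ x A) : Measurable κ := by
  refine Measure.measurable_of_measurable_coe _ fun A hA => ?_
  have hm : ∀ n, MeasurableSet (A ∩ disjointed (spanningSets ν) n) := fun n =>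
    hA.inter (.disjointed (measurableSet_spanningSets ν) n)
  have hsum : (fun x => κ x A) = fun x => ∑' n, κ x (A ∩ disjointed (spanningSets ν) n) := by
    ext x
    rw [← measure_iUnion _ hm]
    · rw [← Set.inter_iUnion, iUnion_disjointed, iUnion_spanningSets, Set.inter_univ]
    · exact fun i j hij => (disjoint_disjointed _ hij).mono Set.inter_subset_right
        Set.inter_subset_right
  rw [hsum]
  exact Measurable.tsum fun n => h _ (hm n)
    ((measure_mono (Set.inter_subset_right.trans (disjointed_subset _ n))).trans_lt
      (measure_spanningSets_lt_top ν n))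

/-- A measure on a set of measures is determined by the joint laws of finitely many evaluations at
sets of finite `ν`-measure. -/
lemma ext_of_map_eval_eq [SigmaFinite ν] {P P' : Measure S} [IsProbabilityMeasure P]
    [IsProbabilityMeasure P']
    (h : ∀ I : Finset {A : Set Z // MeasurableSet A ∧ ν A < ∞},
      P.map (fun (η : S) (A : I) => (η : Measure Z) A.1.1) =
        P'.map (fun (η : S) (A : I) => (η : Measure Z) A.1.1)) : P = P' := by
  let 𝒢 := {A : Set Z // MeasurableSet A ∧ ν A < ∞}
  let ev : S → 𝒢 → ℝ≥0∞ := fun η A => (η : Measure Z) A.1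
  have hev : Measurable ev := measurable_pi_lambda _ fun A => measurable_eval_subtype A.2.1
  have hP : IsProbabilityMeasure (P.map ev) := Measure.isProbabilityMeasure_map hev.aemeasurable
  have hmap : P.map ev = P'.map ev := by
    refine IsProjectiveLimit.unique (P := fun I : Finset 𝒢 => (P.map ev).map I.restrict)
      (fun I => rfl) (fun I => ?_) |>.trans rfl
    show (P'.map ev).map I.restrict = (P.map ev).map I.restrict
    rw [Measure.map_map (Finset.measurable_restrict I) hev,
      Measure.map_map (Finset.measurable_restrict I) hev]
    exact (h I).symm
  have hcomap : (inferInstance : MeasurableSpace S) ≤ MeasurableSpace.comap ev inferInstance := by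
    have hm : Measurable[MeasurableSpace.comap ev inferInstance] (fun η : S => (η : Measure Z)) :=
      @measurable_of_eval_finite _ _ ν _ _ (MeasurableSpace.comap ev inferInstance) _
        fun A hA hA' => (measurable_pi_apply (⟨A, hA, hA'⟩ : 𝒢)).comp (comap_measurable ev)
    exact hm.comap_le
  refine Measure.ext fun B hB => ?_
  obtain ⟨C, hC, rfl⟩ := hcomap B hB
  rw [← Measure.map_apply hev hC, hmap, Measure.map_apply hev hC]

/-- Uniqueness of the law of the Poisson point process. The joint law at arbitrary sets is computed from
the joint law at the atoms of the finite algebra that they generate. -/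
theorem IsPoissonLaw.unique [SigmaFinite ν] {P P' : Measure S} (hP : IsPoissonLaw ν P)
    (hP' : IsPoissonLaw ν P') : P = P' := by
  classical
  have := hP.1
  have := hP'.1
  refine ext_of_map_eval_eq (ν := ν) fun I => ?_
  -- the atoms are the nonempty level sets of the map that records the members of `I` containing a point
  let σ : Z → Finset I := fun z => Finset.univ.filter fun A => z ∈ A.1.1
  have hσm : ∀ s, MeasurableSet (σ ⁻¹' {s}) := by
    intro s
    have : σ ⁻¹' {s} = ⋂ A : I, {z | z ∈ A.1.1 ↔ A ∈ s} := by
      ext z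
      simp only [σ, Set.mem_preimage, Set.mem_singleton_iff, Set.mem_iInter, Set.mem_ofPred_eq,
        Finset.ext_iff, Finset.mem_filter, Finset.mem_univ, true_and]
    rw [this]
    refine MeasurableSet.iInter fun A => ?_
    by_cases hA : A ∈ s
    · simpa [hA] using A.1.2.1
    · have : {z | z ∈ A.1.1 ↔ A ∈ s} = A.1.1ᶜ := by ext; simp [hA]
      rw [this]
      exact A.1.2.1.compl
  let l := Fintype.card {s : Finset I // s.Nonempty}
  let e : Fin l ≃ {s : Finset I // s.Nonempty} := (Fintype.equivFin _).symm
  let At : Fin l → Set Z := fun j => σ ⁻¹' {(e j).1}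
  have hAtm : ∀ j, MeasurableSet (At j) := fun j => hσm _
  have hAtd : Pairwise (Function.onFun Disjoint At) := by
    intro i j hij
    refine Set.disjoint_left.2 fun z hz hz' => hij (e.injective (Subtype.ext ?_))
    exact (Set.mem_singleton_iff.1 hz).symm.trans (Set.mem_singleton_iff.1 hz')
  have hAtf : ∀ j, ν (At j) < ∞ := by
    intro j
    obtain ⟨A, hA⟩ := (e j).2
    refine (measure_mono fun z hz => ?_).trans_lt A.1.2.2
    have hz' : σ z = (e j).1 := hz
    rw [← hz'] at hA
    exact (Finset.mem_filter.1 hA).2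
  have hsum : ∀ (η : S) (A : I), (η : Measure Z) A.1.1 =
      ∑ j, if A ∈ (e j).1 then (η : Measure Z) (At j) else 0 := by
    intro η A
    have h1 : A.1.1 = σ ⁻¹' ((Finset.univ.filter fun s : Finset I => A ∈ s : Finset (Finset I)) :
        Set (Finset I)) := by
      ext z; simp [σ]
    rw [h1, ← sum_measure_preimage_singleton _ fun s _ => hσm s, Finset.sum_filter,
      e.sum_comp (g := fun s => if A ∈ s.1 then (η : Measure Z) (σ ⁻¹' {s.1}) else 0)]
    rw [← Finset.sum_subtype (Finset.univ.filter Finset.Nonempty) (by simp)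
      fun s => if A ∈ s then (η : Measure Z) (σ ⁻¹' {s}) else 0]
    refine (Finset.sum_filter_of_ne fun s _ hs => ?_).symm
    by_contra hne
    exact hs (if_neg fun hA => hne ⟨A, hA⟩)
  let Λ : (Fin l → ℝ≥0∞) → I → ℝ≥0∞ := fun v A => ∑ j, if A ∈ (e j).1 then v j else 0
  have hΛ : Measurable Λ := by
    refine measurable_pi_lambda _ fun A => Finset.measurable_sum _ fun j _ => ?_
    split_ifs <;> fun_prop
  have hAt : Measurable fun (η : S) j => (η : Measure Z) (At j) :=
    measurable_pi_lambda _ fun j => measurable_eval_subtype (hAtm j)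
  have hjoint : P.map (fun (η : S) j => (η : Measure Z) (At j)) =
      P'.map (fun (η : S) j => (η : Measure Z) (At j)) := by
    obtain ⟨h1, h2⟩ := hP.2 l At hAtm hAtd hAtf
    obtain ⟨h1', h2'⟩ := hP'.2 l At hAtm hAtd hAtf
    rw [(iIndepFun_iff_map_fun_eq_pi_map fun j => (measurable_eval_subtype (hAtm j)).aemeasurable).1 h1,
      (iIndepFun_iff_map_fun_eq_pi_map fun j => (measurable_eval_subtype (hAtm j)).aemeasurable).1 h1']
    simp_rw [h2, h2']
  have hfac : (fun (η : S) (A : I) => (η : Measure Z) A.1.1) =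
      Λ ∘ fun (η : S) j => (η : Measure Z) (At j) := by
    ext η A; exact hsum η A
  rw [hfac, ← Measure.map_map hΛ hAt, hjoint, Measure.map_map hΛ hAt]

end Uniqueness

/-! ### The Poisson point process as a superposition of independent cells -/

section PoissonConstruction

open scoped NNReal

variable {Z : Type*} [MeasurableSpace Z]

/-- The sum of the Dirac masses at the first `e.1` terms of the sequence `e.2`. -/
def pointSum (e : ℕ × (ℕ → Z)) : Measure Z := ∑ k ∈ Finset.range e.1, Measure.dirac (e.2 k)

/-- The superposition of a sequence of finite sums of Dirac masses. -/
def superpose (ω : ℕ → ℕ × (ℕ → Z)) : Measure Z := Measure.sum fun i => pointSum (ω i)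

/-- The law of a Poisson number of independent points with law `π`: the point process with law `cellLaw r π`
is Poisson with intensity `r • π`. -/
def cellLaw (r : ℝ≥0) (π : Measure Z) : Measure (ℕ × (ℕ → Z)) :=
  (poissonMeasure r).prod (Measure.infinitePi fun _ => π)

instance (r : ℝ≥0) (π : Measure Z) [IsProbabilityMeasure π] : IsProbabilityMeasure (cellLaw r π) := by
  unfold cellLaw; infer_instance

lemma pointSum_apply (e : ℕ × (ℕ → Z)) {A : Set Z} (hA : MeasurableSet A) :
    pointSum e A = ∑ k ∈ Finset.range e.1, A.indicator 1 (e.2 k) := by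
  simp [pointSum, hA]

lemma superpose_apply (ω : ℕ → ℕ × (ℕ → Z)) {A : Set Z} (hA : MeasurableSet A) :
    superpose ω A = ∑' i, pointSum (ω i) A := Measure.sum_apply _ hA

instance (e : ℕ × (ℕ → Z)) : IsFiniteMeasure (pointSum e) := by
  unfold pointSum; infer_instance

lemma measurable_pointSum : Measurable (pointSum : ℕ × (ℕ → Z) → Measure Z) := by
  refine Measure.measurable_of_measurable_coe _ fun A hA => ?_
  simp_rw [pointSum_apply _ hA]
  refine measurable_from_prod_countable_right fun n => ?_
  exact Finset.measurable_sum (f := fun k (s : ℕ → Z) => A.indicator (1 : Z → ℝ≥0∞) (s k))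
    (Finset.range n) fun k _ => (measurable_one.indicator hA).comp (measurable_pi_apply k)

lemma measurable_superpose : Measurable (superpose : (ℕ → ℕ × (ℕ → Z)) → Measure Z) := by
  refine Measure.measurable_of_measurable_coe _ fun A hA => ?_
  simp_rw [superpose_apply _ hA]
  exact Measurable.tsum fun i =>
    ((Measure.measurable_coe hA).comp measurable_pointSum).comp (measurable_pi_apply i)

lemma integral_prod_infinitePi {E : Type*} [MeasurableSpace E] (μ : ℕ → Measure E)
    [∀ i, IsProbabilityMeasure (μ i)] {g : ℕ → E → ℂ} (hg : ∀ i, Measurable (g i)) (n : ℕ) :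
    ∫ ω, ∏ i ∈ Finset.range n, g i (ω i) ∂Measure.infinitePi μ =
      ∏ i ∈ Finset.range n, ∫ e, g i e ∂μ i := by
  have h := ((iIndepFun_infinitePi (P := μ) (X := g) hg).precomp
    (Fin.val_injective (n := n))).integral_fun_prod_eq_prod_integral
    fun i => ((hg i).comp (measurable_pi_apply _)).aestronglyMeasurable
  simp_rw [Finset.prod_range]
  refine h.trans (Finset.prod_congr rfl fun i _ => ?_)
  conv_rhs => rw [← Measure.infinitePi_map_eval μ i]
  rw [integral_map (measurable_pi_apply _).aemeasurable (hg i).aestronglyMeasurable]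

/-- The generating functional of a Poisson number of independent points. -/
lemma integral_prod_cellLaw (r : ℝ≥0) (π : Measure Z) [IsProbabilityMeasure π] {h : Z → ℂ}
    (hh : Measurable h) (h1 : ∀ z, ‖h z‖ ≤ 1) :
    ∫ e, ∏ k ∈ Finset.range e.1, h (e.2 k) ∂cellLaw r π = Complex.exp (r * (∫ z, h z ∂π - 1)) := by
  have hm : Measurable fun e : ℕ × (ℕ → Z) => ∏ k ∈ Finset.range e.1, h (e.2 k) := by
    refine measurable_from_prod_countable_right fun n => ?_
    exact Finset.measurable_prod (f := fun k (s : ℕ → Z) => h (s k)) (Finset.range n)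
      fun k _ => hh.comp (measurable_pi_apply k)
  have hint : Integrable (fun e : ℕ × (ℕ → Z) => ∏ k ∈ Finset.range e.1, h (e.2 k))
      ((poissonMeasure r).prod (Measure.infinitePi fun _ => π)) := by
    refine Integrable.of_bound hm.aestronglyMeasurable 1 (.of_forall fun e => ?_)
    rw [norm_prod]
    exact Finset.prod_le_one (fun _ _ => norm_nonneg _) fun _ _ => h1 _
  rw [cellLaw, integral_prod _ hint]
  simp_rw [integral_prod_infinitePi (fun _ => π) fun _ => hh]
  rw [integral_poissonMeasure]
  simp only [Finset.prod_const, Finset.card_range, Complex.real_smul]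
  set c := ∫ z, h z ∂π
  calc ∑' n : ℕ, ((Real.exp (-r) * r ^ n / n.factorial : ℝ) : ℂ) * c ^ n
      = ∑' n : ℕ, (Real.exp (-r) : ℂ) * ((r * c) ^ n / n.factorial) := by
        congr with n
        push_cast
        rw [mul_pow]
        ring
    _ = Real.exp (-r) * ∑' n : ℕ, ((r * c) ^ n / n.factorial) := tsum_mul_left
    _ = Complex.exp (r * (c - 1)) := by
        rw [(NormedSpace.expSeries_div_hasSum_exp (r * c)).tsum_eq, ← Complex.exp_eq_exp_ℂ,
          Complex.ofReal_exp, ← Complex.exp_add]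
        push_cast
        ring_nf

variable (lam : ℕ → ℝ≥0) (π : ℕ → Measure Z) [∀ i, IsProbabilityMeasure (π i)]

lemma lintegral_poissonMeasure (r : ℝ≥0) (f : ℕ → ℝ≥0∞) :
    ∫⁻ n, f n ∂poissonMeasure r =
      ∑' n : ℕ, ENNReal.ofReal (Real.exp (-r) * r ^ n / n.factorial) * f n := by
  rw [poissonMeasure, lintegral_sum_measure]
  simp

lemma lintegral_natCast_poissonMeasure (r : ℝ≥0) : ∫⁻ n : ℕ, (n : ℝ≥0∞) ∂poissonMeasure r = r := by
  have h1 := lintegral_poissonMeasure r 1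
  simp only [Pi.one_apply, lintegral_const, measure_univ, mul_one] at h1
  rw [lintegral_poissonMeasure, tsum_eq_zero_add' ENNReal.summable]
  simp only [Nat.cast_zero, mul_zero, zero_add]
  calc _ = ∑' n : ℕ, (r : ℝ≥0∞) * ENNReal.ofReal (Real.exp (-r) * r ^ n / n.factorial) := by
        refine tsum_congr fun n => ?_
        rw [← ENNReal.ofReal_natCast, ← ENNReal.ofReal_coe_nnreal,
          ← ENNReal.ofReal_mul (by positivity), ← ENNReal.ofReal_mul (by positivity)]
        congr 1
        rw [Nat.factorial_succ]
        push_cast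
        field_simp
        ring
    _ = r := by rw [ENNReal.tsum_mul_left, ← h1, mul_one]

/-- The mean measure of `cellLaw r π`. -/
lemma lintegral_pointSum_cellLaw (r : ℝ≥0) (π : Measure Z) [IsProbabilityMeasure π] {A : Set Z}
    (hA : MeasurableSet A) : ∫⁻ e, pointSum e A ∂cellLaw r π = r * π A := by
  have hm : Measurable fun e : ℕ × (ℕ → Z) => pointSum e A :=
    (Measure.measurable_coe hA).comp measurable_pointSum
  rw [cellLaw, lintegral_prod _ hm.aemeasurable]
  have h1 : ∀ n : ℕ, ∫⁻ s, pointSum (n, s) A ∂(Measure.infinitePi fun _ : ℕ => π) = n * π A := by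
    intro n
    simp_rw [pointSum_apply _ hA]
    rw [lintegral_finsetSum (f := fun k (s : ℕ → Z) => A.indicator (1 : Z → ℝ≥0∞) (s k)) _
      fun k _ => (measurable_one.indicator hA).comp (measurable_pi_apply k)]
    have : ∀ k, ∫⁻ s : ℕ → Z, A.indicator 1 (s k) ∂(Measure.infinitePi fun _ : ℕ => π) = π A := by
      intro k
      rw [← lintegral_indicator_one hA]
      conv_rhs => rw [← Measure.infinitePi_map_eval (fun _ : ℕ => π) k]
      rw [lintegral_map (measurable_one.indicator hA) (measurable_pi_apply _)]
    simp [this]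
  simp_rw [h1]
  rw [lintegral_mul_const _ (by fun_prop)]
  rw [lintegral_natCast_poissonMeasure]

lemma lintegral_superpose {A : Set Z} (hA : MeasurableSet A) :
    ∫⁻ ω, superpose ω A ∂Measure.infinitePi (fun i => cellLaw (lam i) (π i)) =
      Measure.sum (fun i => (lam i : ℝ≥0∞) • π i) A := by
  simp_rw [superpose_apply _ hA]
  rw [lintegral_tsum (f := fun i (ω : ℕ → ℕ × (ℕ → Z)) => pointSum (ω i) A)
    fun i => (((Measure.measurable_coe hA).comp measurable_pointSum).comp
    (measurable_pi_apply i)).aemeasurable, Measure.sum_apply _ hA]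
  refine tsum_congr fun i => ?_
  have h := lintegral_map ((Measure.measurable_coe hA).comp measurable_pointSum)
    (measurable_pi_apply i) (μ := Measure.infinitePi (fun i => cellLaw (lam i) (π i)))
  have h2 := lintegral_pointSum_cellLaw (lam i) (π i) hA
  rw [← Measure.infinitePi_map_eval (fun i => cellLaw (lam i) (π i)) i] at h2
  exact h.symm.trans h2

lemma toReal_pointSum (e : ℕ × (ℕ → Z)) {A : Set Z} (hA : MeasurableSet A) :
    (pointSum e A).toReal = ∑ k ∈ Finset.range e.1, A.indicator 1 (e.2 k) := by
  rw [pointSum_apply _ hA, ENNReal.toReal_sum]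
  · refine Finset.sum_congr rfl fun k _ => ?_
    by_cases h : e.2 k ∈ A <;> simp [h]
  · intro k _
    by_cases h : e.2 k ∈ A <;> simp [h]

open Complex in
/-- The joint characteristic function of the numbers of points in disjoint sets. -/
lemma integral_exp_superpose {l : ℕ} {A : Fin l → Set Z} (hA : ∀ j, MeasurableSet (A j))
    (hd : Pairwise (Function.onFun Disjoint A))
    (hf : ∀ j, Measure.sum (fun i => (lam i : ℝ≥0∞) • π i) (A j) < ∞) (t : Fin l → ℝ) :
    ∫ ω, exp ((∑ j, t j * (superpose ω (A j)).toReal : ℝ) * I)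
        ∂Measure.infinitePi (fun i => cellLaw (lam i) (π i)) =
      exp (∑ j, (Measure.sum (fun i => (lam i : ℝ≥0∞) • π i) (A j)).toReal *
        (exp (t j * I) - 1)) := by
  set ν := Measure.sum (fun i => (lam i : ℝ≥0∞) • π i) with hν
  set P := Measure.infinitePi (fun i => cellLaw (lam i) (π i)) with hP
  let h : Z → ℂ := fun z => exp ((∑ j, t j * (A j).indicator 1 z : ℝ) * I)
  have hh : Measurable h := by
    have : Measurable fun z => ∑ j, t j * (A j).indicator (1 : Z → ℝ) z :=
      Finset.measurable_sum _ fun j _ => (measurable_one.indicator (hA j)).const_mul _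
    fun_prop
  have h1 : ∀ z, ‖h z‖ ≤ 1 := fun z => (norm_exp_ofReal_mul_I _).le
  -- at most one of the indicators is nonzero
  have hsub : ∀ z, h z - 1 = ∑ j, (A j).indicator (1 : Z → ℂ) z * (exp (t j * I) - 1) := by
    intro z
    by_cases hz : ∃ j, z ∈ A j
    · obtain ⟨j, hj⟩ := hz
      have hne : ∀ k, k ≠ j → z ∉ A k := fun k hk hzk => Set.disjoint_left.1 (hd hk) hzk hj
      rw [Finset.sum_eq_single j (fun k _ hk => by simp [hne k hk]) (by simp)]
      simp only [h]
      rw [Finset.sum_eq_single j (fun k _ hk => by simp [hne k hk]) (by simp)]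
      simp [hj]
    · push Not at hz
      simp [h, hz]
  have hint : ∀ i, ∫ z, h z ∂π i - 1 = ∑ j, (π i).real (A j) * (exp (t j * I) - 1) := by
    intro i
    have hI : Integrable h (π i) := Integrable.of_bound hh.aestronglyMeasurable 1 (.of_forall h1)
    have : ∫ z, h z ∂π i - 1 = ∫ z, (h z - 1) ∂π i := by
      rw [integral_sub hI (integrable_const _)]; simp
    rw [this]
    simp_rw [hsub]
    have hIj : ∀ j, Integrable ((A j).indicator (1 : Z → ℂ)) (π i) := fun j =>
      (integrable_indicator_iff (hA j)).2 (integrable_const _)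
    rw [integral_finsetSum _ fun j _ => (hIj j).mul_const _]
    refine Finset.sum_congr rfl fun j _ => ?_
    rw [integral_mul_const]
    congr 1
    rw [integral_indicator (hA j)]
    simp
  -- the superposition of finitely many cells
  have hfin : ∀ N : ℕ, ∫ ω, exp ((∑ j, t j * (∑ i ∈ Finset.range N, (pointSum (ω i) (A j)).toReal) : ℝ)
      * I) ∂P = exp (∑ j, (∑ i ∈ Finset.range N, (lam i * π i (A j)).toReal) *
        (exp (t j * I) - 1)) := by
    intro N
    have e1 : ∀ e : ℕ × (ℕ → Z), ∏ k ∈ Finset.range e.1, h (e.2 k) =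
        exp ((∑ j, t j * (pointSum e (A j)).toReal : ℝ) * I) := by
      intro e
      simp only [h]
      rw [← exp_sum]
      congr 1
      simp_rw [toReal_pointSum _ (hA _), Finset.mul_sum]
      rw [Finset.sum_comm]
      push_cast
      rw [Finset.sum_mul]
    have e2 : ∀ ω : ℕ → ℕ × (ℕ → Z),
        exp ((∑ j, t j * (∑ i ∈ Finset.range N, (pointSum (ω i) (A j)).toReal) : ℝ) * I) =
          ∏ i ∈ Finset.range N, ∏ k ∈ Finset.range (ω i).1, h ((ω i).2 k) := by
      intro ω
      simp_rw [e1]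
      rw [← exp_sum]
      congr 1
      simp_rw [Finset.mul_sum]
      rw [Finset.sum_comm]
      push_cast
      rw [Finset.sum_mul]
    have hm : Measurable fun e : ℕ × (ℕ → Z) => ∏ k ∈ Finset.range e.1, h (e.2 k) := by
      refine measurable_from_prod_countable_right fun n => ?_
      exact Finset.measurable_prod (f := fun k (s : ℕ → Z) => h (s k)) (Finset.range n)
        fun k _ => hh.comp (measurable_pi_apply k)
    simp_rw [e2]
    rw [hP, integral_prod_infinitePi _ fun _ => hm]
    rw [Finset.prod_congr rfl fun i _ => integral_prod_cellLaw (lam i) (π i) hh h1]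
    simp_rw [hint]
    rw [← exp_sum]
    congr 1
    simp_rw [Finset.mul_sum, ofReal_sum, Finset.sum_mul]
    rw [Finset.sum_comm]
    refine Finset.sum_congr rfl fun j _ => Finset.sum_congr rfl fun i _ => ?_
    rw [ENNReal.toReal_mul]
    simp [Measure.real]
    ring
  have hae : ∀ᵐ ω ∂P, ∀ j, superpose ω (A j) < ∞ := by
    rw [ae_all_iff]
    intro j
    refine ae_lt_top ((Measure.measurable_coe (hA j)).comp measurable_superpose) ?_
    rw [hP, lintegral_superpose lam π (hA j)]
    exact (hf j).ne
  have hmt : ∀ j, Measurable fun e : ℕ × (ℕ → Z) => (pointSum e (A j)).toReal := fun j =>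
    ((Measure.measurable_coe (hA j)).comp measurable_pointSum).ennreal_toReal
  have hlim : Filter.Tendsto (fun N : ℕ => ∫ ω,
      exp ((∑ j, t j * (∑ i ∈ Finset.range N, (pointSum (ω i) (A j)).toReal) : ℝ) * I) ∂P)
      Filter.atTop (nhds (∫ ω, exp ((∑ j, t j * (superpose ω (A j)).toReal : ℝ) * I) ∂P)) := by
    refine tendsto_integral_of_dominated_convergence (fun _ => 1) (fun N => ?_)
      (integrable_const _) (fun N => .of_forall fun ω => (norm_exp_ofReal_mul_I _).le) ?_
    · refine Measurable.aestronglyMeasurable ?_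
      have : Measurable fun ω : ℕ → ℕ × (ℕ → Z) =>
          ∑ j, t j * (∑ i ∈ Finset.range N, (pointSum (ω i) (A j)).toReal) :=
        Finset.measurable_sum _ fun j _ => (Finset.measurable_sum _ fun i _ =>
          (hmt j).comp (measurable_pi_apply i)).const_mul _
      fun_prop
    · filter_upwards [hae] with ω hω
      have hc : Continuous fun v : Fin l → ℝ => exp ((∑ j, t j * v j : ℝ) * I) := by fun_prop
      refine (hc.tendsto _).comp (tendsto_pi_nhds.2 fun j => ?_)
      have hj := (hω j).ne
      rw [superpose_apply _ (hA j)] at hj ⊢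
      rw [ENNReal.tsum_toReal_eq fun i => measure_ne_top _ _]
      exact (ENNReal.summable_toReal hj).hasSum.tendsto_sum_nat
  have hlim2 : Filter.Tendsto (fun N : ℕ =>
      exp (∑ j, (∑ i ∈ Finset.range N, (lam i * π i (A j)).toReal) * (exp (t j * I) - 1)))
      Filter.atTop (nhds (exp (∑ j, (ν (A j)).toReal * (exp (t j * I) - 1)))) := by
    have hc : Continuous fun v : Fin l → ℝ => exp (∑ j, (v j : ℂ) * (exp (t j * I) - 1)) := by
      fun_prop
    have := (hc.tendsto (fun j => (ν (A j)).toReal)).comp (f := fun (N : ℕ) j =>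
      ∑ i ∈ Finset.range N, (lam i * π i (A j)).toReal) (x := Filter.atTop)
      (tendsto_pi_nhds.2 fun j => ?_)
    · simpa [Function.comp_def] using this
    · have hj := (hf j).ne
      have hs : ν (A j) = ∑' i, lam i * π i (A j) := by
        rw [hν, Measure.sum_apply _ (hA j)]; rfl
      rw [hs] at hj ⊢
      rw [ENNReal.tsum_toReal_eq fun i => ENNReal.mul_ne_top (by simp) (measure_ne_top _ _)]
      exact (ENNReal.summable_toReal hj).hasSum.tendsto_sum_nat
  simp_rw [hfin] at hlim
  exact tendsto_nhds_unique hlim hlim2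

/-- The numbers of points in disjoint sets are independent Poisson variables. -/
theorem iIndepFun_superpose {l : ℕ} {A : Fin l → Set Z} (hA : ∀ j, MeasurableSet (A j))
    (hd : Pairwise (Function.onFun Disjoint A))
    (hf : ∀ j, Measure.sum (fun i => (lam i : ℝ≥0∞) • π i) (A j) < ∞) :
    iIndepFun (fun j ω => superpose ω (A j))
      (Measure.infinitePi (fun i => cellLaw (lam i) (π i))) ∧
    ∀ j, (Measure.infinitePi (fun i => cellLaw (lam i) (π i))).map (fun ω => superpose ω (A j)) =
      (poissonMeasure (Measure.sum (fun i => (lam i : ℝ≥0∞) • π i) (A j)).toNNReal).map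
        (fun n : ℕ => (n : ℝ≥0∞)) := by
  set ν := Measure.sum (fun i => (lam i : ℝ≥0∞) • π i) with hν
  set P := Measure.infinitePi (fun i => cellLaw (lam i) (π i)) with hP
  have hm : ∀ j, Measurable fun ω : ℕ → ℕ × (ℕ → Z) => superpose ω (A j) := fun j =>
    (Measure.measurable_coe (hA j)).comp measurable_superpose
  have hmr : ∀ j, Measurable fun ω : ℕ → ℕ × (ℕ → Z) => (superpose ω (A j)).toReal := fun j =>
    (hm j).ennreal_toReal
  have hae : ∀ j, (fun ω => ENNReal.ofReal (superpose ω (A j)).toReal) =ᵐ[P]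
      fun ω => superpose ω (A j) := by
    intro j
    have : ∀ᵐ ω ∂P, superpose ω (A j) < ∞ := by
      refine ae_lt_top (hm j) ?_
      rw [hP, lintegral_superpose lam π (hA j)]
      exact (hf j).ne
    filter_upwards [this] with ω hω using ENNReal.ofReal_toReal hω.ne
  have hmap : ∀ j, P.map (fun ω => (superpose ω (A j)).toReal) =
      (poissonMeasure (ν (A j)).toNNReal).map (Nat.cast : ℕ → ℝ) := by
    intro j
    have := Measure.isProbabilityMeasure_map (μ := P) (hmr j).aemeasurable
    have : IsProbabilityMeasure ((poissonMeasure (ν (A j)).toNNReal).map (Nat.cast : ℕ → ℝ)) :=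
      Measure.isProbabilityMeasure_map (by fun_prop)
    refine Measure.ext_of_charFun ?_
    ext t
    rw [charFun_map_cast_poissonMeasure, charFun_apply_real, integral_map (hmr j).aemeasurable
      (by fun_prop)]
    have h := integral_exp_superpose lam π (l := 1) (A := fun _ => A j) (fun _ => hA j)
      (fun a b hab => (hab (Subsingleton.elim _ _)).elim) (fun _ => hf j) (fun _ => t)
    simp only [Finset.univ_unique, Finset.sum_singleton] at h
    push_cast at h
    exact h
  have hind : iIndepFun (fun j ω => (superpose ω (A j)).toReal) P := by
    rw [iIndepFun_iff_charFun_pi fun j => (hmr j).aemeasurable]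
    intro t
    rw [charFun_apply, integral_map (by fun_prop) (by fun_prop)]
    simp_rw [hmap, charFun_map_cast_poissonMeasure]
    rw [← Complex.exp_sum]
    have h := integral_exp_superpose lam π hA hd hf t.ofLp
    refine Eq.trans ?_ (h.trans ?_)
    · refine integral_congr_ae (.of_forall fun ω => ?_)
      simp [PiLp.inner_apply]
    · rfl
  refine ⟨?_, fun j => ?_⟩
  · exact (hind.comp (fun _ => ENNReal.ofReal) fun _ => ENNReal.measurable_ofReal).congr hae
  · rw [← Measure.map_congr (hae j)]
    have := Measure.map_map (μ := P) ENNReal.measurable_ofReal (hmr j)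
    rw [Function.comp_def] at this
    rw [← this, hmap, Measure.map_map ENNReal.measurable_ofReal (by fun_prop)]
    congr 1
    ext n
    simp

end PoissonConstruction

/-! ### Spaces of configurations -/

section ConfigurationSpace

open scoped NNReal Topology

variable {Z : Type*} [MeasurableSpace Z]

/-- What the argument uses of a space `S` of measures: its elements are locally finite, and a countable sum
of Dirac masses belongs to it as soon as it is finite on the members of a given sequence of sets of finite
`ν`-measure. -/
structure IsConfigurationSpace [TopologicalSpace Z] (ν : Measure Z) (S : Set (Measure Z)) : Prop where
  isLocallyFiniteMeasure : ∀ ξ ∈ S, IsLocallyFiniteMeasure ξ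
  exists_superpose_mem : ∃ C : ℕ → Set Z, (∀ n, MeasurableSet (C n)) ∧ (∀ n, ν (C n) < ∞) ∧
    ∀ ω, (∀ n, superpose ω (C n) < ∞) → superpose ω ∈ S

lemma superpose_eq_sum_dirac (ω : ℕ → ℕ × (ℕ → Z)) :
    superpose ω = Measure.sum fun j : Σ i, Fin (ω i).1 => Measure.dirac ((ω j.1).2 j.2) := by
  ext A hA
  rw [superpose_apply _ hA, Measure.sum_apply _ hA, ENNReal.tsum_sigma']
  refine tsum_congr fun i => ?_
  rw [pointSum_apply _ hA, Finset.sum_range, tsum_fintype]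
  simp [hA]

lemma isFiniteConfiguration_restrict_sum_dirac {ι : Type*} (a : ι → Z) {A : Set Z}
    (hA : MeasurableSet A) (h : Measure.sum (fun j => Measure.dirac (a j)) A < ∞) :
    IsFiniteConfiguration ((Measure.sum fun j => Measure.dirac (a j)).restrict A) := by
  classical
  rw [Measure.sum_apply _ hA] at h
  have hfin : {j | 1 ≤ Measure.dirac (a j) A}.Finite :=
    ENNReal.finite_const_le_of_tsum_ne_top h.ne one_ne_zero
  have hmem : ∀ j, j ∉ hfin.toFinset → a j ∉ A := by
    intro j hj hjA
    exact hj (hfin.mem_toFinset.2 (by simp [hA, hjA]))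
  have hmem' : ∀ j ∈ hfin.toFinset, a j ∈ A := by
    intro j hj
    by_contra hjA
    have := hfin.mem_toFinset.1 hj
    simp [hA, hjA] at this
  refine ⟨hfin.toFinset.card, fun k => a (hfin.toFinset.equivFin.symm k), ?_⟩
  ext B hB
  rw [Measure.restrict_apply hB, Measure.sum_apply _ (hB.inter hA),
    tsum_eq_sum (s := hfin.toFinset) fun j hj => by simp [hB.inter hA, hmem j hj],
    Measure.finsetSum_apply]
  rw [hfin.toFinset.equivFin.symm.sum_comp (fun j => Measure.dirac (a j) B), Finset.sum_coe_sort
    hfin.toFinset (fun j => Measure.dirac (a j) B)]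
  refine Finset.sum_congr rfl fun j hj => ?_
  by_cases hjB : a j ∈ B <;> simp [hB.inter hA, hB, hjB, hmem' j hj]

lemma isFiniteConfiguration_restrict_superpose (ω : ℕ → ℕ × (ℕ → Z)) {A : Set Z}
    (hA : MeasurableSet A) (h : superpose ω A < ∞) :
    IsFiniteConfiguration ((superpose ω).restrict A) := by
  rw [superpose_eq_sum_dirac] at h ⊢
  exact isFiniteConfiguration_restrict_sum_dirac _ hA h

lemma IsFiniteConfiguration.measure_lt_top {ξ : Measure Z} {A : Set Z}
    (h : IsFiniteConfiguration (ξ.restrict A)) : ξ A < ∞ := by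
  obtain ⟨k, a, h⟩ := h
  rw [← Measure.restrict_apply_univ, h]
  simp

lemma isConfigurationSpace_configurations [MetricSpace Z] [BorelSpace Z] {ν : Measure Z}
    (h : ∀ (x : Z) (r : ℝ), ν (Metric.closedBall x r) < ∞) :
    IsConfigurationSpace ν (configurations Z) where
  isLocallyFiniteMeasure ξ hξ :=
    ⟨fun x => ⟨_, Metric.closedBall_mem_nhds x one_pos, (hξ x 1).measure_lt_top⟩⟩
  exists_superpose_mem := by
    rcases isEmpty_or_nonempty Z with hZ | ⟨⟨x₀⟩⟩
    · exact ⟨fun _ => ∅, by simp, by simp, fun ω _ x => hZ.elim x⟩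
    refine ⟨fun n => Metric.closedBall x₀ n, fun n => measurableSet_closedBall, fun n => h _ _,
      fun ω hω x r => isFiniteConfiguration_restrict_superpose ω measurableSet_closedBall ?_⟩
    obtain ⟨n, hn⟩ := exists_nat_ge (r + dist x x₀)
    exact (measure_mono (Metric.closedBall_subset_closedBall' hn)).trans_lt (hω n)

lemma isConfigurationSpace_locallyFiniteConfigurations [TopologicalSpace Z]
    [SecondCountableTopology Z] [OpensMeasurableSpace Z] {ν : Measure Z}
    [IsLocallyFiniteMeasure ν] : IsConfigurationSpace ν (locallyFiniteConfigurations Z) where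
  isLocallyFiniteMeasure ξ hξ := ⟨fun x => by
    obtain ⟨U, hU, hx, h⟩ := hξ x
    exact ⟨U, hU.mem_nhds hx, h.measure_lt_top⟩⟩
  exists_superpose_mem := by
    let F := ν.finiteSpanningSetsInOpen'
    have ho : ∀ n, IsOpen (F.set n) := F.set_mem
    refine ⟨F.set, fun n => (ho n).measurableSet, F.finite, fun ω hω x => ?_⟩
    obtain ⟨n, hn⟩ := Set.mem_iUnion.1 (F.spanning ▸ Set.mem_univ x)
    exact ⟨F.set n, ho n, hn,
      isFiniteConfiguration_restrict_superpose ω (ho n).measurableSet (hω n)⟩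

lemma isConfigurationSpace_finiteMeasures [TopologicalSpace Z] {ν : Measure Z} [IsFiniteMeasure ν] :
    IsConfigurationSpace ν (finiteMeasures Z) where
  isLocallyFiniteMeasure ξ hξ := by
    have : IsFiniteMeasure ξ := hξ
    infer_instance
  exists_superpose_mem := ⟨fun _ => Set.univ, fun _ => .univ, fun _ => measure_lt_top _ _,
    fun ω hω => ⟨hω 0⟩⟩

variable (lam : ℕ → ℝ≥0) (π : ℕ → Measure Z) [∀ i, IsProbabilityMeasure (π i)]

/-- Existence of the Poisson law on `S`, in the form of a measurable representation of the Poisson point process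
as a function of independent cells. -/
theorem IsConfigurationSpace.exists_map_isPoissonLaw [TopologicalSpace Z] [Nonempty Z] {ν : Measure Z}
    {S : Set (Measure Z)} (hS : IsConfigurationSpace ν S)
    (hν : ν = Measure.sum fun i => (lam i : ℝ≥0∞) • π i) :
    ∃ Φ : (ℕ → ℕ × (ℕ → Z)) → S, Measurable Φ ∧
      (∀ᵐ ω ∂Measure.infinitePi fun i => cellLaw (lam i) (π i), (Φ ω : Measure Z) = superpose ω) ∧
      IsPoissonLaw ν ((Measure.infinitePi fun i => cellLaw (lam i) (π i)).map Φ) := by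
  classical
  set P := Measure.infinitePi fun i => cellLaw (lam i) (π i) with hP
  obtain ⟨C, hC, hCf, hCS⟩ := hS.exists_superpose_mem
  let Ω₀ : Set (ℕ → ℕ × (ℕ → Z)) := {ω | ∀ n, superpose ω (C n) < ∞}
  have hmC : ∀ n, Measurable fun ω : ℕ → ℕ × (ℕ → Z) => superpose ω (C n) := fun n =>
    (Measure.measurable_coe (hC n)).comp measurable_superpose
  have hΩ₀ : MeasurableSet Ω₀ := by
    have : Ω₀ = ⋂ n, {ω | superpose ω (C n) < ∞} := by ext; simp [Ω₀]
    rw [this]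
    exact .iInter fun n => measurableSet_lt (hmC n) measurable_const
  have hae : ∀ᵐ ω ∂P, ω ∈ Ω₀ := by
    refine ae_all_iff.2 fun n => ae_lt_top (hmC n) ?_
    rw [hP, lintegral_superpose lam π (hC n), ← hν]
    exact (hCf n).ne
  -- on a null set the configuration is replaced by the empty one
  let z₀ : Z := Classical.arbitrary Z
  let ω₀ : ℕ → ℕ × (ℕ → Z) := fun _ => (0, fun _ => z₀)
  have hω₀ : ω₀ ∈ Ω₀ := fun n => by
    rw [superpose_apply _ (hC n)]
    simp [ω₀, pointSum]
  let g : (ℕ → ℕ × (ℕ → Z)) → (ℕ → ℕ × (ℕ → Z)) := fun ω => if ω ∈ Ω₀ then ω else ω₀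
  have hg : Measurable g := Measurable.ite hΩ₀ measurable_id measurable_const
  have hgm : ∀ ω, g ω ∈ Ω₀ := by
    intro ω
    by_cases h : ω ∈ Ω₀
    · simp [g, h]
    · simp [g, h, hω₀]
  let Φ : (ℕ → ℕ × (ℕ → Z)) → S := fun ω => ⟨superpose (g ω), hCS _ (hgm ω)⟩
  have hΦ : Measurable Φ := (measurable_superpose.comp hg).subtype_mk
  have hΦs : ∀ᵐ ω ∂P, (Φ ω : Measure Z) = superpose ω := by
    filter_upwards [hae] with ω hω
    simp only [Φ, g, if_pos hω]
  refine ⟨Φ, hΦ, hΦs, Measure.isProbabilityMeasure_map hΦ.aemeasurable, fun l A hA hd hf => ?_⟩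
  rw [hν] at hf
  obtain ⟨h1, h2⟩ := iIndepFun_superpose lam π hA hd hf
  rw [← hP] at h1 h2
  have heq : ∀ j, (fun ω => superpose ω (A j)) =ᵐ[P] fun ω => (Φ ω : Measure Z) (A j) := fun j => by
    filter_upwards [hΦs] with ω hω
    rw [hω]
  have hmap : ∀ j, (P.map Φ).map (fun η : S => (η : Measure Z) (A j)) =
      P.map (fun ω => superpose ω (A j)) := by
    intro j
    rw [Measure.map_map (measurable_eval_subtype (hA j)) hΦ, Measure.map_congr (heq j)]
    rfl
  have hmω : ∀ j, Measurable fun ω : ℕ → ℕ × (ℕ → Z) => (Φ ω : Measure Z) (A j) := fun j =>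
    (measurable_eval_subtype (hA j)).comp hΦ
  refine ⟨?_, fun j => ?_⟩
  · have := Measure.isProbabilityMeasure_map (μ := P) hΦ.aemeasurable
    rw [iIndepFun_iff_map_fun_eq_pi_map fun j => (measurable_eval_subtype (hA j)).aemeasurable]
    have h3 := (iIndepFun_iff_map_fun_eq_pi_map fun j => (hmω j).aemeasurable).1 (h1.congr heq)
    rw [Measure.map_map (measurable_pi_lambda _ fun j => measurable_eval_subtype (hA j)) hΦ]
    refine Eq.trans h3 ?_
    congr 1
    ext1 j
    rw [hmap, ← Measure.map_congr (heq j)]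
  · rw [hmap, h2, hν]

lemma exists_nat_mul_sqrt_pow_le (M : ℝ≥0) {δ : ℝ≥0} (hδ : 0 < δ) : ∃ N : ℕ, 0 < N ∧
    NNReal.sqrt (M / N) ≤ 1 ∧ N * NNReal.sqrt (M / N) ^ 3 ≤ δ := by
  set η := min 1 (δ / (M + 1)) with hη
  have hη0 : 0 < η := lt_min one_pos (by positivity)
  obtain ⟨N, hN⟩ := exists_nat_ge (M / η ^ 2)
  have hN1 : (0 : ℝ≥0) < (N + 1 : ℕ) := by positivity
  have hs : NNReal.sqrt (M / (N + 1 : ℕ)) ≤ η := by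
    rw [NNReal.sqrt_le_iff_le_sq, div_le_iff₀ hN1]
    rw [div_le_iff₀ (by positivity)] at hN
    calc M ≤ N * η ^ 2 := hN
      _ ≤ η ^ 2 * (N + 1 : ℕ) := by push_cast; rw [mul_comm]; gcongr; simp
  refine ⟨N + 1, N.succ_pos, hs.trans (min_le_left _ _), ?_⟩
  rw [pow_succ, NNReal.sq_sqrt, ← mul_assoc, mul_div_cancel₀ _ hN1.ne']
  calc M * NNReal.sqrt (M / (N + 1 : ℕ)) ≤ (M + 1) * (δ / (M + 1)) := by
        gcongr
        · simp
        · exact hs.trans (min_le_right _ _)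
    _ = δ := mul_div_cancel₀ _ (by positivity)

/-- A `σ`-finite measure can be cut into countably many small pieces. With pieces of mass `s i ^ 2`, the
sum of the `s i ^ 3` can be made small even if the total mass is infinite. -/
theorem exists_eq_sum_sq_smul [Nonempty Z] (ν : Measure Z) [SFinite ν] {ε : ℝ≥0∞} (hε : ε ≠ 0) :
    ∃ (s : ℕ → ℝ≥0) (π : ℕ → Measure Z), (∀ i, IsProbabilityMeasure (π i)) ∧ (∀ i, s i ≤ 1) ∧
      ∑' i, (s i : ℝ≥0∞) ^ 3 ≤ ε ∧
      ν = Measure.sum fun i => ((s i ^ 2 : ℝ≥0) : ℝ≥0∞) • π i := by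
  classical
  obtain ⟨δ, hδ, hδε⟩ := ENNReal.exists_pos_sum_of_countable hε ℕ
  let m : ℕ → Measure Z := sfiniteSeq ν
  let M : ℕ → ℝ≥0 := fun n => (m n Set.univ).toNNReal
  have hM : ∀ n, (M n : ℝ≥0∞) = m n Set.univ := fun n => ENNReal.coe_toNNReal (measure_ne_top _ _)
  choose N hN hs1 hs3 using fun n => exists_nat_mul_sqrt_pow_le (M n) (hδ n)
  have hprob : ∀ n, ∃ p : Measure Z, IsProbabilityMeasure p ∧ m n = (M n : ℝ≥0∞) • p := by
    intro n
    by_cases h0 : m n = 0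
    · exact ⟨Measure.dirac (Classical.arbitrary Z), inferInstance, by
        rw [hM, h0]; simp⟩
    · have hne : m n Set.univ ≠ 0 := by simpa using h0
      have : NeZero (m n) := ⟨h0⟩
      refine ⟨(m n Set.univ)⁻¹ • m n, inferInstance, ?_⟩
      rw [hM, smul_smul, ENNReal.mul_inv_cancel hne (measure_ne_top _ _), one_smul]
  choose p hp hmp using hprob
  let s : ℕ × ℕ → ℝ≥0 := fun q => if q.2 < N q.1 then NNReal.sqrt (M q.1 / N q.1) else 0
  have hsum : ∀ n (F : ℝ≥0 → ℝ≥0∞), F 0 = 0 →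
      ∑' j, F (s (n, j)) = N n * F (NNReal.sqrt (M n / N n)) := by
    intro n F hF
    rw [tsum_eq_sum (s := Finset.range (N n)) fun j hj => by
      simp only [s, if_neg (fun h => hj (Finset.mem_range.2 h)), hF]]
    rw [Finset.sum_congr rfl (g := fun _ => F (NNReal.sqrt (M n / N n))) fun j hj => by
      simp [s, Finset.mem_range.1 hj]]
    simp
  let e : ℕ ≃ ℕ × ℕ := Nat.pairEquiv.symm
  refine ⟨fun i => s (e i), fun i => p (e i).1, fun i => hp _, fun i => ?_, ?_, ?_⟩
  · simp only [s]
    split_ifs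
    exacts [hs1 _, zero_le]
  · rw [e.tsum_eq fun q => (s q : ℝ≥0∞) ^ 3,
      ENNReal.tsum_prod (f := fun n j => (s (n, j) : ℝ≥0∞) ^ 3)]
    refine le_trans (ENNReal.tsum_le_tsum fun n => ?_) hδε.le
    rw [hsum n (fun x => (x : ℝ≥0∞) ^ 3) (by simp)]
    exact_mod_cast hs3 n
  · ext A hA
    rw [Measure.sum_apply _ hA]
    simp only [Measure.smul_apply, smul_eq_mul]
    rw [e.tsum_eq fun q => ((s q ^ 2 : ℝ≥0) : ℝ≥0∞) * p q.1 A,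
      ENNReal.tsum_prod (f := fun n j => ((s (n, j) ^ 2 : ℝ≥0) : ℝ≥0∞) * p n A)]
    conv_lhs => rw [← sum_sfiniteSeq ν]
    rw [Measure.sum_apply _ hA]
    refine tsum_congr fun n => ?_
    rw [ENNReal.tsum_mul_right, hsum n (fun x => ((x ^ 2 : ℝ≥0) : ℝ≥0∞)) (by simp)]
    have : (N n : ℝ≥0) * NNReal.sqrt (M n / N n) ^ 2 = M n := by
      rw [NNReal.sq_sqrt]
      exact mul_div_cancel₀ _ (by exact_mod_cast (hN n).ne')
    have h2 : (N n : ℝ≥0∞) * ((NNReal.sqrt (M n / N n) ^ 2 : ℝ≥0) : ℝ≥0∞) = M n := by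
      exact_mod_cast this
    rw [h2]
    change m n A = _
    rw [hmp n]
    simp

end ConfigurationSpace

/-! ### From sequences of cells to configurations -/

section Transfer

variable {Z : Type*} [MeasurableSpace Z]

/-- Locally finite measures are determined by their values on countably many sets. -/
lemma exists_countable_determining (Z : Type*) [MeasurableSpace Z] [TopologicalSpace Z]
    [SecondCountableTopology Z] [BorelSpace Z] :
    ∃ 𝒜 : Set (Set Z), 𝒜.Countable ∧ (∀ A ∈ 𝒜, MeasurableSet A) ∧
      ∀ ξ ξ' : Measure Z, IsLocallyFiniteMeasure ξ → (∀ A ∈ 𝒜, ξ A = ξ' A) → ξ = ξ' := by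
  let B := TopologicalSpace.countableBasis Z
  have hB := TopologicalSpace.isBasis_countableBasis Z
  have hBc : B.Countable := TopologicalSpace.countable_countableBasis Z
  let 𝒜 : Set (Set Z) := Set.sInter '' {F | F.Finite ∧ F ⊆ B}
  have hBA : B ⊆ 𝒜 := fun U hU => ⟨{U}, ⟨Set.finite_singleton U, by simpa using hU⟩, by simp⟩
  have hm : ∀ A ∈ 𝒜, MeasurableSet A := by
    rintro _ ⟨F, ⟨hF, hFB⟩, rfl⟩
    exact .sInter hF.countable fun U hU => (hB.isOpen (hFB hU)).measurableSet
  have hc : 𝒜.Countable := (Set.countable_ofPred_finite_subset hBc).image _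
  refine ⟨𝒜, hc, hm, fun ξ ξ' hξ h => ?_⟩
  refine Measure.ext_of_generateFrom_of_cover_subset (S := 𝒜) (T := {U ∈ B | ξ U ≠ ∞})
    (le_antisymm ?_ ?_) ?_ (fun U hU => hBA hU.1) (hBc.mono fun U hU => hU.1) ?_
    (fun U hU => hU.2) h
  · rw [BorelSpace.measurable_eq (α := Z), hB.borel_eq_generateFrom]
    exact MeasurableSpace.generateFrom_mono hBA
  · exact MeasurableSpace.generateFrom_le hm
  · rintro _ ⟨F, ⟨hF, hFB⟩, rfl⟩ _ ⟨G, ⟨hG, hGB⟩, rfl⟩ -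
    exact ⟨F ∪ G, ⟨hF.union hG, Set.union_subset hFB hGB⟩, Set.sInter_union F G⟩
  · refine Set.eq_univ_of_forall fun x => ?_
    obtain ⟨V, hV, hVf⟩ := hξ.finiteAtNhds x
    obtain ⟨U, hU, hxU, hUV⟩ := hB.mem_nhds_iff.1 hV
    exact ⟨U, ⟨hU, ((measure_mono hUV).trans_lt hVf).ne⟩, hxU⟩

section Singletons

variable [StandardBorelSpace Z]

lemma measurable_pointSum_singleton :
    Measurable fun q : (ℕ × (ℕ → Z)) × Z => pointSum q.1 {q.2} := by
  simp_rw [pointSum_apply _ (measurableSet_singleton _)]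
  have h : Measurable fun q : ℕ × ((ℕ → Z) × Z) =>
      ∑ k ∈ Finset.range q.1, ({q.2.2} : Set Z).indicator (1 : Z → ℝ≥0∞) (q.2.1 k) := by
    refine measurable_from_prod_countable_right fun n => ?_
    refine Finset.measurable_sum (f := fun k (q : (ℕ → Z) × Z) =>
      ({q.2} : Set Z).indicator (1 : Z → ℝ≥0∞) (q.1 k)) (Finset.range n) fun k _ => ?_
    have hs : MeasurableSet {q : (ℕ → Z) × Z | q.1 k = q.2} :=
      measurableSet_eq_fun ((measurable_pi_apply k).comp measurable_fst) measurable_snd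
    exact measurable_one.indicator hs
  have hq : Measurable fun q : (ℕ × (ℕ → Z)) × Z => (q.1.1, (q.1.2, q.2)) := by fun_prop
  exact h.comp hq

lemma measurable_eval_prodMk {E : Type*} [MeasurableSpace E] (i : ℕ) :
    Measurable fun q : (ℕ → E) × Z => (q.1 i, q.2) :=
  ((measurable_pi_apply i).comp measurable_fst).prodMk measurable_snd

lemma measurable_pointSum_eval_singleton (i : ℕ) :
    Measurable fun q : (ℕ → ℕ × (ℕ → Z)) × Z => pointSum (q.1 i) {q.2} := by
  have h := measurable_pointSum_singleton.comp (measurable_eval_prodMk (Z := Z) i)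
  exact h

lemma measurable_superpose_singleton :
    Measurable fun q : (ℕ → ℕ × (ℕ → Z)) × Z => superpose q.1 {q.2} := by
  simp_rw [superpose_apply _ (measurableSet_singleton _)]
  exact Measurable.tsum measurable_pointSum_eval_singleton

lemma measurable_pointSum_singleton_div (i : ℕ) :
    Measurable fun q : (ℕ → ℕ × (ℕ → Z)) × Z => pointSum (q.1 i) {q.2} / superpose q.1 {q.2} :=
  (measurable_pointSum_eval_singleton i).div measurable_superpose_singleton

lemma measurable_pointSum_singleton_div_left (i : ℕ) (x : Z) :
    Measurable fun ω : ℕ → ℕ × (ℕ → Z) => pointSum (ω i) {x} / superpose ω {x} := by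
  have h := (measurable_pointSum_singleton_div (Z := Z) i).comp (measurable_prodMk_right (y := x))
  exact h

lemma measurable_pointSum_singleton_div_right (i : ℕ) (ω : ℕ → ℕ × (ℕ → Z)) :
    Measurable fun x : Z => pointSum (ω i) {x} / superpose ω {x} := by
  have h := (measurable_pointSum_singleton_div (Z := Z) i).comp (measurable_prodMk_left (x := ω))
  exact h

lemma measurable_pointSum_singleton_div_swap (i : ℕ) :
    Measurable fun q : Z × (ℕ → ℕ × (ℕ → Z)) => pointSum (q.2 i) {q.1} / superpose q.2 {q.1} := by
  have h := (measurable_pointSum_singleton_div (Z := Z) i).comp measurable_swap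
  exact h

lemma ae_superpose_singleton_ne_zero (ω : ℕ → ℕ × (ℕ → Z)) :
    ∀ᵐ x ∂superpose ω, superpose ω {x} ≠ 0 := by
  suffices ∀ᵐ x ∂Measure.sum fun j : Σ i, Fin (ω i).1 => Measure.dirac ((ω j.1).2 j.2),
      superpose ω {x} ≠ 0 by rwa [← superpose_eq_sum_dirac] at this
  rw [Measure.ae_sum_iff]
  intro j
  rw [ae_dirac_eq, Filter.eventually_pure]
  refine ((zero_lt_one' ℝ≥0∞).trans_le ?_).ne'
  rw [superpose_eq_sum_dirac]
  exact le_trans (by simp) (Measure.le_sum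
    (fun j : Σ i, Fin (ω i).1 => Measure.dirac ((ω j.1).2 j.2)) j _)

/-- A cell gets at most its number of points from `ξ`, if each point `x` of `ξ` is shared in proportion to
the multiplicities. -/
lemma lintegral_pointSum_div_le (ξ : Measure Z) (e : ℕ × (ℕ → Z)) :
    ∫⁻ x, pointSum e {x} / ξ {x} ∂ξ ≤ e.1 := by
  have h : ∀ x, pointSum e {x} / ξ {x} =
      ∑ k ∈ Finset.range e.1, ({e.2 k} : Set Z).indicator (fun _ => (ξ {e.2 k})⁻¹) x := by
    intro x
    rw [pointSum_apply _ (measurableSet_singleton _), div_eq_mul_inv, Finset.sum_mul]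
    refine Finset.sum_congr rfl fun k _ => ?_
    by_cases hx : e.2 k = x
    · simp [hx]
    · simp [hx, Ne.symm hx]
  simp_rw [h]
  rw [lintegral_finsetSum _ fun k _ => measurable_const.indicator (measurableSet_singleton _)]
  calc _ ≤ ∑ k ∈ Finset.range e.1, (1 : ℝ≥0∞) := by
        refine Finset.sum_le_sum fun k _ => ?_
        rw [lintegral_indicator_const (measurableSet_singleton _)]
        exact ENNReal.inv_mul_le_one _
    _ = e.1 := by simp

lemma tsum_pointSum_div {ω : ℕ → ℕ × (ℕ → Z)} {x : Z} (h0 : superpose ω {x} ≠ 0)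
    (h1 : superpose ω {x} ≠ ∞) : ∑' i, pointSum (ω i) {x} / superpose ω {x} = 1 := by
  simp_rw [div_eq_mul_inv]
  rw [ENNReal.tsum_mul_right, ← superpose_apply _ (measurableSet_singleton _),
    ENNReal.mul_inv_cancel h0 h1]

lemma tsum_pointSum_div_le (ω : ℕ → ℕ × (ℕ → Z)) (x : Z) :
    ∑' i, pointSum (ω i) {x} / superpose ω {x} ≤ 1 := by
  simp_rw [div_eq_mul_inv]
  rw [ENNReal.tsum_mul_right, ← superpose_apply _ (measurableSet_singleton _)]
  exact ENNReal.mul_inv_le_one _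

/-- A point of the superposition can be lost only with a cell that contains it. -/
lemma one_sub_superpose_div_le {ω : ℕ → ℕ × (ℕ → Z)} (ω' : ℕ → ℕ × (ℕ → Z)) {x : Z}
    (h0 : superpose ω {x} ≠ 0) (h1 : superpose ω {x} ≠ ∞) :
    1 - superpose ω' {x} / superpose ω {x} ≤
      ∑' i, pointSum (ω i) {x} / superpose ω {x} *
        {ω' : ℕ → ℕ × (ℕ → Z) | ω' i ≠ ω i}.indicator 1 ω' := by
  rw [tsub_le_iff_right, superpose_apply ω' (measurableSet_singleton _),
    div_eq_mul_inv (∑' i, _), ← ENNReal.tsum_mul_right, ← ENNReal.tsum_add,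
    ← tsum_pointSum_div h0 h1]
  refine ENNReal.tsum_le_tsum fun i => ?_
  by_cases h : ω' i = ω i
  · simp [h, div_eq_mul_inv]
  · simp [h]

end Singletons

/-- Jensen's inequality for convex combinations. -/
lemma IsConvexCost.tsum_le {α : ℝ → ℝ≥0∞} (hα : IsConvexCost α) {w u : ℕ → ℝ≥0∞}
    (hw : ∑' i, w i = 1) (hu : ∀ i, u i ≤ 1) :
    α (∑' i, w i * u i).toReal ≤ ∑' i, w i * α (u i).toReal := by
  let Q : Measure ℕ := Measure.sum fun i => w i • Measure.dirac i
  have hQ : ∀ g : ℕ → ℝ≥0∞, ∫⁻ i, g i ∂Q = ∑' i, w i * g i := by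
    intro g
    simp [Q, lintegral_sum_measure]
  have : IsProbabilityMeasure Q := ⟨by
    have := hQ 1
    simpa [hw] using this⟩
  have h := hα.lintegral_le Q (U := u) (measurable_of_countable u) hu
  rwa [hQ, hQ] at h

variable [TopologicalSpace Z] [SecondCountableTopology Z] [BorelSpace Z] [StandardBorelSpace Z]
  {S : Set (Measure Z)}

set_option maxHeartbeats 1000000 in
/-- A coupling of the laws of two sequences of cells induces a coupling of the laws of their superpositions. The
first configuration is lifted to a random sequence of cells by a conditional distribution. By
Jensen's inequality, the cost is at most the sum over the cells of their numbers of points,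
weighted by the cost of the probability that the cell changes. -/
theorem transportCost_martonCost_le [Nonempty Z] (hS : ∀ ξ ∈ S, IsLocallyFiniteMeasure ξ)
    {P₁ P₂ : Measure (ℕ → ℕ × (ℕ → Z))} [IsProbabilityMeasure P₁] [IsProbabilityMeasure P₂]
    {Φ : (ℕ → ℕ × (ℕ → Z)) → S} (hΦ : Measurable Φ)
    (h₁ : ∀ᵐ ω ∂P₁, (Φ ω : Measure Z) = superpose ω)
    (h₂ : ∀ᵐ ω ∂P₂, (Φ ω : Measure Z) = superpose ω)
    (p : Kernel (ℕ → ℕ × (ℕ → Z)) (ℕ → ℕ × (ℕ → Z))) [IsMarkovKernel p] (hp : (P₁ ⊗ₘ p).snd = P₂)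
    {α : ℝ → ℝ≥0∞} (hα : IsConvexCost α) :
    transportCost (martonCost α) (P₂.map Φ) (P₁.map Φ) ≤
      ∑' i, ∫⁻ ω, (ω i).1 * α (p ω {ω' | ω' i ≠ ω i}).toReal ∂P₁ := by
  have hm₁ : IsProbabilityMeasure (P₁.map Φ) := Measure.isProbabilityMeasure_map hΦ.aemeasurable
  let Q : Kernel S (ℕ → ℕ × (ℕ → Z)) := condDistrib id Φ P₁
  have hQ : (P₁.map Φ) ⊗ₘ Q = P₁.map fun ω => (Φ ω, ω) := compProd_map_condDistrib aemeasurable_id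
  have hΦid : Measurable fun ω => (Φ ω, ω) := hΦ.prodMk measurable_id
  let q : Kernel S S := (p ∘ₖ Q).map Φ
  have hq : IsMarkovKernel q := Kernel.IsMarkovKernel.map _ hΦ
  have hQP : Q ∘ₘ (P₁.map Φ) = P₁ := by
    rw [condDistrib_comp_map hΦ.aemeasurable aemeasurable_id, Measure.map_id]
  have hsnd : ((P₁.map Φ) ⊗ₘ q).snd = P₂.map Φ := by
    rw [Measure.snd_compProd, ← hp, Measure.snd_compProd]
    conv_rhs => rw [← hQP]
    rw [Measure.comp_assoc, Measure.map_comp _ _ hΦ]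
  refine (iInf_le_of_le ((P₁.map Φ) ⊗ₘ q) <| iInf_le_of_le q <| iInf_le_of_le hq <|
    iInf_le_of_le (Measure.fst_compProd _ _) <| iInf_le_of_le hsnd <| iInf_le_of_le rfl le_rfl).trans ?_
  -- the conditional distributions are concentrated on the fibers of `Φ`
  obtain ⟨𝒜, h𝒜c, h𝒜m, h𝒜⟩ := exists_countable_determining Z
  have hfib : ∀ᵐ ξ : S ∂P₁.map Φ, ∀ᵐ ω ∂Q ξ, (Φ ω : Measure Z) = ξ := by
    have : ∀ᵐ x ∂(P₁.map Φ) ⊗ₘ Q, ∀ A ∈ 𝒜, (Φ x.2 : Measure Z) A = (x.1 : Measure Z) A := by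
      rw [hQ, ae_ball_iff h𝒜c]
      intro A hA
      have hs : MeasurableSet {x : S × (ℕ → ℕ × (ℕ → Z)) |
          (Φ x.2 : Measure Z) A = (x.1 : Measure Z) A} :=
        measurableSet_eq_fun ((measurable_eval_subtype (h𝒜m A hA)).comp (hΦ.comp measurable_snd))
          ((measurable_eval_subtype (h𝒜m A hA)).comp measurable_fst)
      rw [ae_map_iff hΦid.aemeasurable hs]
      exact .of_forall fun ω => rfl
    filter_upwards [Measure.ae_ae_of_ae_compProd this] with ξ hξ
    filter_upwards [hξ] with ω hω
    exact h𝒜 _ _ (hS _ (Φ ω).2) hω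
  have hlift : ∀ᵐ ξ : S ∂P₁.map Φ, ∀ᵐ ω ∂Q ξ, (Φ ω : Measure Z) = superpose ω := by
    refine Measure.ae_ae_of_ae_comp ?_
    rwa [hQP]
  have hlift₂ : ∀ᵐ ξ : S ∂P₁.map Φ, ∀ᵐ ω ∂Q ξ, ∀ᵐ ω' ∂p ω, (Φ ω' : Measure Z) = superpose ω' := by
    refine Measure.ae_ae_of_ae_comp ?_
    rw [hQP]
    refine Measure.ae_ae_of_ae_comp ?_
    rwa [← Measure.snd_compProd, hp]
  let u : ℕ → (ℕ → ℕ × (ℕ → Z)) → ℝ≥0∞ := fun i ω => p ω {ω' | ω' i ≠ ω i}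
  have hD : ∀ i, MeasurableSet {x : (ℕ → ℕ × (ℕ → Z)) × (ℕ → ℕ × (ℕ → Z)) | x.2 i ≠ x.1 i} :=
    fun i => (measurableSet_eq_fun ((measurable_pi_apply i).comp measurable_snd)
      ((measurable_pi_apply i).comp measurable_fst)).compl
  have hu : ∀ i, Measurable (u i) := fun i => Kernel.measurable_kernel_prodMk_left (hD i)
  have hu1 : ∀ i ω, u i ω ≤ 1 := fun i ω => prob_le_one
  have hαu : ∀ i, Measurable fun ω => α (u i ω).toReal := fun i =>
    hα.measurable.comp (hu i).ennreal_toReal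
  let w : ℕ → (ℕ → ℕ × (ℕ → Z)) → Z → ℝ≥0∞ := fun i ω x => pointSum (ω i) {x} / superpose ω {x}
  have hw : ∀ i, Measurable fun y : Z × (ℕ → ℕ × (ℕ → Z)) => w i y.2 y.1 :=
    measurable_pointSum_singleton_div_swap
  have hcell : Measurable fun ω : ℕ → ℕ × (ℕ → Z) => ∑' i, ((ω i).1 : ℝ≥0∞) * α (u i ω).toReal :=
    Measurable.tsum fun i => Measurable.mul
      ((measurable_of_countable (fun n : ℕ => (n : ℝ≥0∞))).comp
        (measurable_fst.comp (measurable_pi_apply i))) (hαu i)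
  calc ∫⁻ ξ, martonCost α ξ (q ξ) ∂P₁.map Φ
      ≤ ∫⁻ ξ, ∫⁻ ω, ∑' i, ((ω i).1 : ℝ≥0∞) * α (u i ω).toReal ∂Q ξ ∂P₁.map Φ := by
        refine lintegral_mono_ae ?_
        filter_upwards [hfib, hlift, hlift₂] with ξ hξ hξs hξ₂
        have hlf := hS _ ξ.2
        -- `ξ` itself is a superposition of cells
        obtain ⟨ω₀, hω₀⟩ : ∃ ω₀, (ξ : Measure Z) = superpose ω₀ := by
          obtain ⟨ω₀, hω₀, hω₀'⟩ := (hξ.and hξs).exists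
          exact ⟨ω₀, hω₀.symm.trans hω₀'⟩
        have hsf : SFinite (ξ : Measure Z) := by
          rw [hω₀]; unfold superpose; infer_instance
        have hx : ∀ᵐ x ∂(ξ : Measure Z), (ξ : Measure Z) {x} ≠ 0 := by
          rw [hω₀]; exact ae_superpose_singleton_ne_zero ω₀
        have hmean : ∀ x, (ξ : Measure Z) {x} ≠ 0 →
            ∫⁻ χ : S, (1 - (χ : Measure Z) {x} / (ξ : Measure Z) {x}) ∂q ξ ≤
              ∫⁻ ω, ∑' i, w i ω x * u i ω ∂Q ξ := by
          intro x hx0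
          have hxt : (ξ : Measure Z) {x} ≠ ∞ := isCompact_singleton.measure_lt_top.ne
          have hmx : Measurable fun χ : S => 1 - (χ : Measure Z) {x} / (ξ : Measure Z) {x} :=
            ((measurable_eval_subtype (measurableSet_singleton x)).div_const _).const_sub 1
          rw [Kernel.map_apply _ hΦ, lintegral_map hmx hΦ, Kernel.lintegral_comp _ _ _
            (g := fun ω => 1 - (Φ ω : Measure Z) {x} / (ξ : Measure Z) {x}) (hmx.comp hΦ)]
          refine lintegral_mono_ae ?_
          filter_upwards [hξ, hξs, hξ₂] with ω h1 h2 h3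
          rw [h1] at h2
          calc ∫⁻ ω', (1 - (Φ ω' : Measure Z) {x} / (ξ : Measure Z) {x}) ∂p ω
              ≤ ∫⁻ ω', ∑' i, w i ω x * {ω' : ℕ → ℕ × (ℕ → Z) | ω' i ≠ ω i}.indicator 1 ω' ∂p ω := by
                refine lintegral_mono_ae ?_
                filter_upwards [h3] with ω' h3
                rw [h3, h2]
                rw [h2] at hx0 hxt
                exact one_sub_superpose_div_le ω' hx0 hxt
            _ = ∑' i, w i ω x * u i ω := by
                have hDi : ∀ i, MeasurableSet {ω' : ℕ → ℕ × (ℕ → Z) | ω' i ≠ ω i} := fun i =>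
                  (hD i).preimage measurable_prodMk_left
                rw [lintegral_tsum fun i =>
                  ((measurable_one.indicator (hDi i)).const_mul _).aemeasurable]
                refine tsum_congr fun i => ?_
                rw [lintegral_const_mul _ (measurable_one.indicator (hDi i)),
                  lintegral_indicator_one (hDi i)]
        calc martonCost α ξ (q ξ)
            ≤ ∫⁻ x, ∫⁻ ω, ∑' i, w i ω x * α (u i ω).toReal ∂Q ξ ∂(ξ : Measure Z) := by
              refine lintegral_mono_ae ?_
              filter_upwards [hx] with x hx0
              have hxt : (ξ : Measure Z) {x} ≠ ∞ := isCompact_singleton.measure_lt_top.ne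
              have hwu : ∀ ω, ∑' i, w i ω x * u i ω ≤ 1 := fun ω =>
                (ENNReal.tsum_le_tsum fun i => mul_le_of_le_one_right' (hu1 i ω)).trans
                  (tsum_pointSum_div_le ω x)
              have hwum : Measurable fun ω => ∑' i, w i ω x * u i ω :=
                Measurable.tsum fun i => (measurable_pointSum_singleton_div_left i x).mul (hu i)
              refine (hα.mono_toReal (hmean x hx0) ?_).trans
                ((hα.lintegral_le (Q ξ) hwum hwu).trans (lintegral_mono_ae ?_))
              · calc _ ≤ ∫⁻ _, 1 ∂Q ξ := lintegral_mono hwu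
                  _ = 1 := by simp
              · filter_upwards [hξ, hξs] with ω h1 h2
                rw [h1] at h2
                rw [h2] at hx0 hxt
                exact hα.tsum_le (tsum_pointSum_div hx0 hxt) fun i => hu1 i ω
          _ = ∫⁻ ω, ∫⁻ x, ∑' i, w i ω x * α (u i ω).toReal ∂(ξ : Measure Z) ∂Q ξ := by
              refine lintegral_lintegral_swap (Measurable.aemeasurable ?_)
              exact Measurable.tsum fun i => (hw i).mul ((hαu i).comp measurable_snd)
          _ ≤ ∫⁻ ω, ∑' i, ((ω i).1 : ℝ≥0∞) * α (u i ω).toReal ∂Q ξ := by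
              refine lintegral_mono_ae ?_
              filter_upwards [hξ, hξs] with ω h1 h2
              rw [h1] at h2
              have hwω : ∀ i, Measurable fun x => w i ω x := fun i =>
                measurable_pointSum_singleton_div_right i ω
              rw [lintegral_tsum fun i => ((hwω i).mul_const _).aemeasurable]
              refine ENNReal.tsum_le_tsum fun i => ?_
              rw [lintegral_mul_const _ (hwω i)]
              gcongr
              rw [h2]
              exact lintegral_pointSum_div_le _ _
    _ = ∫⁻ ω, ∑' i, ((ω i).1 : ℝ≥0∞) * α (u i ω).toReal ∂P₁ := by
        conv_rhs => rw [← hQP]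
        rw [Measure.lintegral_bind (Kernel.aemeasurable _) hcell.aemeasurable]
    _ = _ := by
        refine lintegral_tsum fun i => Measurable.aemeasurable ?_
        exact Measurable.mul
          ((measurable_of_countable (fun n : ℕ => (n : ℝ≥0∞))).comp
            (measurable_fst.comp (measurable_pi_apply i))) (hαu i)

end Transfer

/-! ### Cells with several points -/

section PoissonExcess

open scoped NNReal

/-- The number of points in excess of the first one has small exponential moments: a cell of small mean
`r` has two points with probability `O(r ^ 2)`. -/
lemma lintegral_exp_excess_poissonMeasure_le {r : ℝ≥0} (hr : r ≤ 1) {m : ℝ} (hm : 0 ≤ m) :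
    ∫⁻ n : ℕ, ENNReal.ofReal (Real.exp (m * (n - 1 : ℕ)) - 1) ∂poissonMeasure r ≤
      ENNReal.ofReal (Real.exp (Real.exp m)) * (r : ℝ≥0∞) ^ 2 := by
  rw [lintegral_poissonMeasure]
  have hsum : ENNReal.ofReal (Real.exp (Real.exp m)) =
      ∑' n : ℕ, ENNReal.ofReal (Real.exp m ^ n / n.factorial) := by
    have h := NormedSpace.expSeries_div_hasSum_exp (Real.exp m)
    rw [← Real.exp_eq_exp_ℝ] at h
    rw [← h.tsum_eq, ENNReal.ofReal_tsum_of_nonneg (fun n => by positivity) h.summable]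
  rw [hsum, ← ENNReal.tsum_mul_right]
  refine ENNReal.tsum_le_tsum fun n => ?_
  rcases lt_or_ge n 2 with hn | hn
  · have : n - 1 = 0 := by omega
    simp [this]
  · rw [← ENNReal.ofReal_coe_nnreal, ← ENNReal.ofReal_pow (by positivity),
      ← ENNReal.ofReal_mul (by positivity), ← ENNReal.ofReal_mul (by positivity)]
    refine ENNReal.ofReal_le_ofReal ?_
    have hr0 : (0 : ℝ) ≤ r := r.2
    have hr1 : (r : ℝ) ≤ 1 := by exact_mod_cast hr
    have h1 : Real.exp (-r) ≤ 1 := Real.exp_le_one_iff.2 (by linarith)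
    have h2 : (r : ℝ) ^ n ≤ r ^ 2 := pow_le_pow_of_le_one hr0 hr1 hn
    have h3 : Real.exp (m * (n - 1 : ℕ)) - 1 ≤ Real.exp m ^ n := by
      rw [← Real.exp_nat_mul, mul_comm m]
      have : Real.exp (((n - 1 : ℕ) : ℝ) * m) ≤ Real.exp (n * m) := by
        gcongr
        exact_mod_cast Nat.sub_le n 1
      linarith
    have h4 : 0 ≤ Real.exp (m * (n - 1 : ℕ)) - 1 := by
      have := Real.one_le_exp (x := m * (n - 1 : ℕ)) (by positivity)
      linarith
    calc Real.exp (-r) * r ^ n / n.factorial * (Real.exp (m * (n - 1 : ℕ)) - 1)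
        ≤ 1 * r ^ 2 / n.factorial * Real.exp m ^ n := by gcongr
      _ = Real.exp m ^ n / n.factorial * r ^ 2 := by ring

lemma lintegral_sq_excess_poissonMeasure_le {r : ℝ≥0} (hr : r ≤ 1) :
    ∫⁻ n : ℕ, ((n - 1 : ℕ) : ℝ≥0∞) ^ 2 ∂poissonMeasure r ≤
      2 * ENNReal.ofReal (Real.exp (Real.exp 1)) * (r : ℝ≥0∞) ^ 2 := by
  rw [mul_assoc]
  refine le_trans ?_ (mul_le_mul_right (lintegral_exp_excess_poissonMeasure_le hr zero_le_one) 2)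
  rw [← lintegral_const_mul _ (by fun_prop)]
  refine lintegral_mono fun n => ?_
  dsimp only
  rw [← ENNReal.ofReal_natCast, ← ENNReal.ofReal_pow (by positivity),
    show (2 : ℝ≥0∞) = ENNReal.ofReal 2 by simp, ← ENNReal.ofReal_mul (by norm_num)]
  refine ENNReal.ofReal_le_ofReal ?_
  have := Real.quadratic_le_exp_of_nonneg (x := ((n - 1 : ℕ) : ℝ)) (by positivity)
  have h0 : (0 : ℝ) ≤ ((n - 1 : ℕ) : ℝ) := by positivity
  rw [one_mul]
  nlinarith

/-- Young's inequality for the conjugate functions `klFun` and `exp - 1`, at scale `m`. -/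
lemma mul_ofReal_le_entropyFun {a : ℝ≥0∞} (ha : a ≠ ∞) {e m : ℝ} (he : 0 ≤ e) (hm : 0 < m) :
    a * ENNReal.ofReal e ≤
      ENNReal.ofReal (1 / m) * (entropyFun a + ENNReal.ofReal (Real.exp (m * e) - 1)) := by
  have hk := InformationTheory.klFun_nonneg (x := a.toReal) ENNReal.toReal_nonneg
  have he1 : 0 ≤ Real.exp (m * e) - 1 := by
    have := Real.one_le_exp (x := m * e) (by positivity)
    linarith
  conv_lhs => rw [← ENNReal.ofReal_toReal ha]
  unfold entropyFun
  rw [← ENNReal.ofReal_add hk he1, ← ENNReal.ofReal_mul ENNReal.toReal_nonneg,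
    ← ENNReal.ofReal_mul (by positivity)]
  refine ENNReal.ofReal_le_ofReal ?_
  have h := mul_log_le (A := a.toReal) ENNReal.toReal_nonneg (Real.exp_pos (m * e))
  rw [Real.log_exp] at h
  rw [one_div, ← div_eq_inv_mul, le_div_iff₀ hm, InformationTheory.klFun_apply]
  linarith

/-- The elementary inequality `e * log a ≤ s ^ 3 * (log a) ^ 4 + e ^ 2 / s` for a positive integer `e`,
where `(log a) ^ 4 ≤ 24 * a`. -/
lemma natCast_mul_log_le (e : ℕ) (s : ℝ≥0) {a : ℝ≥0∞} (ha : a ≠ ∞) :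
    (e : ℝ≥0∞) * ENNReal.ofReal (Real.log a.toReal) ≤
      24 * (s : ℝ≥0∞) ^ 3 * a + (s : ℝ≥0∞)⁻¹ * (e : ℝ≥0∞) ^ 2 := by
  rcases Nat.eq_zero_or_pos e with rfl | he
  · simp
  rcases eq_or_ne s 0 with rfl | hs
  · simp [he.ne']
  rcases le_or_gt (Real.log a.toReal) 0 with hL | hL
  · simp [ENNReal.ofReal_of_nonpos hL]
  set L := Real.log a.toReal with hLdef
  have ha0 : 0 < a.toReal := by
    rcases ENNReal.toReal_nonneg.eq_or_lt' with h | h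
    · rw [hLdef, h] at hL; simp at hL
    · exact h
  have hs0 : (0 : ℝ) < s := by exact_mod_cast pos_iff_ne_zero.2 hs
  have he1 : (1 : ℝ) ≤ e := by exact_mod_cast he
  have hexp : L ^ 4 ≤ 24 * a.toReal := by
    have := Real.pow_div_factorial_le_exp L hL.le 4
    rw [hLdef, Real.exp_log ha0, ← hLdef, div_le_iff₀ (by positivity)] at this
    norm_num [Nat.factorial] at this
    linarith
  have hs' : (s : ℝ≥0∞)⁻¹ = ENNReal.ofReal ((s : ℝ)⁻¹) := by
    rw [ENNReal.ofReal_inv_of_pos hs0, ENNReal.ofReal_coe_nnreal]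
  conv_rhs => rw [← ENNReal.ofReal_toReal ha]
  rw [hs', ← ENNReal.ofReal_coe_nnreal, ← ENNReal.ofReal_natCast,
    show (24 : ℝ≥0∞) = ENNReal.ofReal 24 by simp, ← ENNReal.ofReal_pow hs0.le,
    ← ENNReal.ofReal_pow (by positivity), ← ENNReal.ofReal_mul (by positivity),
    ← ENNReal.ofReal_mul (by positivity), ← ENNReal.ofReal_mul (by positivity),
    ← ENNReal.ofReal_mul (by positivity), ← ENNReal.ofReal_add (by positivity) (by positivity)]
  refine ENNReal.ofReal_le_ofReal ?_
  have h1 : (s : ℝ) ^ 3 * L ^ 4 ≤ 24 * (s : ℝ) ^ 3 * a.toReal := by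
    have := mul_le_mul_of_nonneg_left hexp (pow_nonneg hs0.le 3)
    linarith
  rcases le_or_gt (s * L) e with h | h
  · have h2 : e * L ≤ (s : ℝ)⁻¹ * (e : ℝ) ^ 2 := by
      rw [← div_eq_inv_mul, le_div_iff₀ hs0]
      nlinarith
    have : 0 ≤ 24 * (s : ℝ) ^ 3 * a.toReal := by positivity
    linarith
  · have h3 : (s * L) ≤ (s * L) ^ 3 := le_self_pow₀ (he1.trans h.le) (by norm_num)
    have h2 : e * L ≤ (s : ℝ) ^ 3 * L ^ 4 := by
      have := mul_le_mul_of_nonneg_right (h.le.trans h3) hL.le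
      calc e * L ≤ (s * L) ^ 3 * L := this
        _ = _ := by ring
    have : 0 ≤ (s : ℝ)⁻¹ * (e : ℝ) ^ 2 := by positivity
    linarith

end PoissonExcess

/-! ### The cost of the sequential coupling -/

section CouplingCost

open scoped NNReal

variable {E : Type*} [MeasurableSpace E] (μ : ℕ → Measure E) [∀ i, IsProbabilityMeasure (μ i)]
  {f₁ f₂ : (ℕ → E) → ℝ≥0∞} {p : Kernel (ℕ → E) (ℕ → E)} [IsMarkovKernel p]
  {α : ℝ → ℝ≥0∞} {c₁ c₂ : ℝ≥0∞}

lemma measurable_lintegral_entropyFun_nextDensity {f : (ℕ → E) → ℝ≥0∞} (hf : Measurable f) (i : ℕ) :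
    Measurable fun x => ∫⁻ z, entropyFun (nextDensity μ f i x z) ∂μ i :=
  Measurable.lintegral_prod_right'
    (f := fun q : (ℕ → E) × E => entropyFun (nextDensity μ f i q.1 q.2))
    (measurable_entropyFun.comp (measurable_nextDensity μ hf i))

lemma measurable_nextDensity_right {f : (ℕ → E) → ℝ≥0∞} (hf : Measurable f) (i : ℕ) (x : ℕ → E) :
    Measurable fun z => nextDensity μ f i x z :=
  (measurable_nextDensity μ hf i).comp measurable_prodMk_left

lemma tsum_lintegral_withDensity_entropyFun_nextDensity_le {f : (ℕ → E) → ℝ≥0∞} (hf : Measurable f)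
    (h : ∫⁻ x, f x ∂Measure.infinitePi μ = 1) :
    ∑' i, ∫⁻ x, ∫⁻ z, entropyFun (nextDensity μ f i x z) ∂μ i
        ∂(Measure.infinitePi μ).withDensity f ≤
      ∫⁻ x, entropyFun (f x) ∂Measure.infinitePi μ := by
  refine le_trans (le_of_eq (tsum_congr fun i => ?_))
    (tsum_lintegral_entropyFun_nextDensity_le μ hf h)
  exact lintegral_withDensity_eq_lintegral_mul _ hf
    (measurable_lintegral_entropyFun_nextDensity μ hf i)

/-- The cost of the sequential coupling when each coordinate is counted once. -/
theorem tsum_lintegral_cost_le (hb : CostEntropyBound α c₁ c₂)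
    (hf₁ : Measurable f₁) (hf₂ : Measurable f₂)
    (h₁ : ∫⁻ x, f₁ x ∂Measure.infinitePi μ = 1) (h₂ : ∫⁻ x, f₂ x ∂Measure.infinitePi μ = 1)
    (hp : ((Measure.infinitePi μ).withDensity f₁ ⊗ₘ p).snd = (Measure.infinitePi μ).withDensity f₂) :
    ∑' i, ∫⁻ x, ∫⁻ y, ∫⁻ z, nextDensity μ f₁ i x z *
        α (1 - nextDensity μ f₂ i y z / nextDensity μ f₁ i x z).toReal ∂μ i ∂p x
        ∂(Measure.infinitePi μ).withDensity f₁ ≤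
      c₁ * ∫⁻ x, entropyFun (f₁ x) ∂Measure.infinitePi μ +
        c₂ * ∫⁻ x, entropyFun (f₂ x) ∂Measure.infinitePi μ := by
  set P₁ := (Measure.infinitePi μ).withDensity f₁ with hP₁
  have hprob : IsProbabilityMeasure P₁ := ⟨by rw [hP₁, withDensity_apply _ .univ]; simpa using h₁⟩
  let Φ : ((ℕ → E) → ℝ≥0∞) → ℕ → (ℕ → E) → ℝ≥0∞ := fun f i x =>
    ∫⁻ z, entropyFun (nextDensity μ f i x z) ∂μ i
  have hΦ₁ : ∀ i, Measurable (Φ f₁ i) := measurable_lintegral_entropyFun_nextDensity μ hf₁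
  have hΦ₂ : ∀ i, Measurable (Φ f₂ i) := measurable_lintegral_entropyFun_nextDensity μ hf₂
  calc _ ≤ ∑' i, (c₁ * ∫⁻ x, Φ f₁ i x ∂P₁ +
        c₂ * ∫⁻ y, Φ f₂ i y ∂(Measure.infinitePi μ).withDensity f₂) := by
        refine ENNReal.tsum_le_tsum fun i => ?_
        calc _ ≤ ∫⁻ x, ∫⁻ y, (c₁ * Φ f₁ i x + c₂ * Φ f₂ i y) ∂p x ∂P₁ := by
              refine lintegral_mono fun x => lintegral_mono fun y => ?_
              have hm₁ : Measurable fun z => entropyFun (nextDensity μ f₁ i x z) :=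
                measurable_entropyFun.comp (measurable_nextDensity_right μ hf₁ i x)
              have hm₂ : Measurable fun z => entropyFun (nextDensity μ f₂ i y z) :=
                measurable_entropyFun.comp (measurable_nextDensity_right μ hf₂ i y)
              simp only [Φ]
              rw [← lintegral_const_mul _ hm₁, ← lintegral_const_mul _ hm₂,
                ← lintegral_add_left (hm₁.const_mul _)]
              refine lintegral_mono_ae ?_
              filter_upwards [ae_nextDensity_lt_top μ hf₁ i x, ae_nextDensity_lt_top μ hf₂ i y]
                with z hz₁ hz₂ using hb _ _ hz₁.ne hz₂.ne
          _ = c₁ * ∫⁻ x, Φ f₁ i x ∂P₁ + c₂ * ∫⁻ x, ∫⁻ y, Φ f₂ i y ∂p x ∂P₁ := by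
              rw [← lintegral_const_mul _ (hΦ₁ i), ← lintegral_const_mul _ (hΦ₂ i).lintegral_kernel,
                ← lintegral_add_left ((hΦ₁ i).const_mul _)]
              refine lintegral_congr fun x => ?_
              rw [lintegral_add_left measurable_const, lintegral_const_mul _ (hΦ₂ i)]
              simp
          _ = _ := by
              rw [← hp, Measure.snd_compProd, Measure.lintegral_bind (Kernel.aemeasurable _)
                (hΦ₂ i).aemeasurable]
    _ = c₁ * ∑' i, ∫⁻ x, Φ f₁ i x ∂P₁ +
        c₂ * ∑' i, ∫⁻ y, Φ f₂ i y ∂(Measure.infinitePi μ).withDensity f₂ := by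
        rw [ENNReal.tsum_add, ENNReal.tsum_mul_left, ENNReal.tsum_mul_left]
    _ ≤ _ := by
        gcongr
        · exact tsum_lintegral_withDensity_entropyFun_nextDensity_le μ hf₁ h₁
        · exact tsum_lintegral_withDensity_entropyFun_nextDensity_le μ hf₂ h₂

variable {n : E → ℕ} {s : ℕ → ℝ≥0}

/-- The part of the cost due to cells with one point, plus the part due to the excess points. -/
lemma lintegral_count_cost_le (i : ℕ)
    {P₁ : Measure (ℕ → E)} {G : (ℕ → E) → E → ℝ≥0∞}
    (hG : Measurable fun q : (ℕ → E) × E => G q.1 q.2)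
    (h : ∀ x y, ∀ᵐ z ∂μ i, nextDensity μ f₁ i x z * (((n z - 1 : ℕ) : ℝ≥0∞) *
      α (1 - nextDensity μ f₂ i y z / nextDensity μ f₁ i x z).toReal) ≤ G x z) :
    ∫⁻ x, ∫⁻ y, ∫⁻ z, nextDensity μ f₁ i x z * ((n z : ℝ≥0∞) *
        α (1 - nextDensity μ f₂ i y z / nextDensity μ f₁ i x z).toReal) ∂μ i ∂p x ∂P₁ ≤
      ∫⁻ x, ∫⁻ y, ∫⁻ z, nextDensity μ f₁ i x z *
        α (1 - nextDensity μ f₂ i y z / nextDensity μ f₁ i x z).toReal ∂μ i ∂p x ∂P₁ +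
      ∫⁻ x, ∫⁻ z, G x z ∂μ i ∂P₁ := by
  rw [← lintegral_add_right _ hG.lintegral_prod_right']
  refine lintegral_mono fun x => ?_
  have hc : ∫⁻ z, G x z ∂μ i = ∫⁻ _, (∫⁻ z, G x z ∂μ i) ∂p x := by simp
  dsimp only
  rw [hc, ← lintegral_add_right _ measurable_const]
  refine lintegral_mono fun y => ?_
  dsimp only
  have hGx : Measurable (G x) := hG.comp measurable_prodMk_left
  rw [← lintegral_add_right _ hGx]
  refine lintegral_mono_ae ?_
  filter_upwards [h x y] with z hz
  refine le_trans ?_ (add_le_add_right hz _)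
  rw [← mul_add, ← one_add_mul]
  gcongr
  have : n z ≤ 1 + (n z - 1) := by omega
  exact_mod_cast this

/-- The cost of the sequential coupling of Poisson cells with small means, for a bounded cost. The error
term vanishes when `m` tends to infinity and then the sum of the `s i ^ 3` to `0`. -/
theorem tsum_lintegral_count_cost_le_of_le (hα : IsConvexCost α) (hb : CostEntropyBound α c₁ c₂)
    {A : ℝ≥0∞} (hA : α 1 ≤ A)
    (hn : Measurable n) (hμ : ∀ i, (μ i).map n = poissonMeasure (s i ^ 2)) (hs : ∀ i, s i ≤ 1)
    (hf₁ : Measurable f₁) (hf₂ : Measurable f₂)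
    (h₁ : ∫⁻ x, f₁ x ∂Measure.infinitePi μ = 1) (h₂ : ∫⁻ x, f₂ x ∂Measure.infinitePi μ = 1)
    (hp : ((Measure.infinitePi μ).withDensity f₁ ⊗ₘ p).snd = (Measure.infinitePi μ).withDensity f₂)
    {m : ℝ} (hm : 0 < m) :
    ∑' i, ∫⁻ x, ∫⁻ y, ∫⁻ z, nextDensity μ f₁ i x z * ((n z : ℝ≥0∞) *
        α (1 - nextDensity μ f₂ i y z / nextDensity μ f₁ i x z).toReal) ∂μ i ∂p x
        ∂(Measure.infinitePi μ).withDensity f₁ ≤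
      c₁ * ∫⁻ x, entropyFun (f₁ x) ∂Measure.infinitePi μ +
        c₂ * ∫⁻ x, entropyFun (f₂ x) ∂Measure.infinitePi μ +
      A * ENNReal.ofReal (1 / m) * (∫⁻ x, entropyFun (f₁ x) ∂Measure.infinitePi μ +
        ENNReal.ofReal (Real.exp (Real.exp m)) * ∑' i, (s i : ℝ≥0∞) ^ 3) := by
  set P₁ := (Measure.infinitePi μ).withDensity f₁ with hP₁
  have hprob : IsProbabilityMeasure P₁ := ⟨by rw [hP₁, withDensity_apply _ .univ]; simpa using h₁⟩
  let ψ : E → ℝ≥0∞ := fun z => ENNReal.ofReal (Real.exp (m * (n z - 1 : ℕ)) - 1)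
  have hψ : Measurable ψ :=
    (measurable_of_countable fun k : ℕ => ENNReal.ofReal (Real.exp (m * (k - 1 : ℕ)) - 1)).comp hn
  have hψi : ∀ i, ∫⁻ z, ψ z ∂μ i ≤
      ENNReal.ofReal (Real.exp (Real.exp m)) * (s i : ℝ≥0∞) ^ 3 := by
    intro i
    have h := lintegral_exp_excess_poissonMeasure_le (r := s i ^ 2)
      (pow_le_one₀ (zero_le) (hs i)) hm.le
    rw [← hμ, lintegral_map (measurable_of_countable _) hn] at h
    refine h.trans ?_
    refine mul_le_mul_right ?_ _
    push_cast
    rw [← pow_mul]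
    exact pow_le_pow_of_le_one zero_le (by exact_mod_cast hs i) (by norm_num)
  let G : ℕ → (ℕ → E) → E → ℝ≥0∞ := fun i x z =>
    A * ENNReal.ofReal (1 / m) * (entropyFun (nextDensity μ f₁ i x z) + ψ z)
  have hG : ∀ i, Measurable fun q : (ℕ → E) × E => G i q.1 q.2 := fun i =>
    ((measurable_entropyFun.comp (measurable_nextDensity μ hf₁ i)).add
      (hψ.comp measurable_snd)).const_mul _
  have hle : ∀ i x y, ∀ᵐ z ∂μ i, nextDensity μ f₁ i x z * (((n z - 1 : ℕ) : ℝ≥0∞) *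
      α (1 - nextDensity μ f₂ i y z / nextDensity μ f₁ i x z).toReal) ≤ G i x z := by
    intro i x y
    filter_upwards [ae_nextDensity_lt_top μ hf₁ i x] with z hz
    have h1 : α (1 - nextDensity μ f₂ i y z / nextDensity μ f₁ i x z).toReal ≤ A := by
      have := hα.mono_toReal (s := 1 - nextDensity μ f₂ i y z / nextDensity μ f₁ i x z) (u := 1)
        tsub_le_self le_rfl
      exact this.trans (by simpa using hA)
    have h2 := mul_ofReal_le_entropyFun hz.ne (e := ((n z - 1 : ℕ) : ℝ)) (by positivity) hm
    rw [ENNReal.ofReal_natCast] at h2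
    calc _ ≤ nextDensity μ f₁ i x z * (((n z - 1 : ℕ) : ℝ≥0∞) * A) := by gcongr
      _ = A * (nextDensity μ f₁ i x z * ((n z - 1 : ℕ) : ℝ≥0∞)) := by ring
      _ ≤ A * (ENNReal.ofReal (1 / m) * (entropyFun (nextDensity μ f₁ i x z) + ψ z)) := by gcongr
      _ = G i x z := by simp only [G]; rw [mul_assoc]
  calc _ ≤ ∑' i, (∫⁻ x, ∫⁻ y, ∫⁻ z, nextDensity μ f₁ i x z *
        α (1 - nextDensity μ f₂ i y z / nextDensity μ f₁ i x z).toReal ∂μ i ∂p x ∂P₁ +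
        A * ENNReal.ofReal (1 / m) *
          (∫⁻ x, ∫⁻ z, entropyFun (nextDensity μ f₁ i x z) ∂μ i ∂P₁ +
            ENNReal.ofReal (Real.exp (Real.exp m)) * (s i : ℝ≥0∞) ^ 3)) := by
        refine ENNReal.tsum_le_tsum fun i => ?_
        refine (lintegral_count_cost_le μ i (hG i) (hle i)).trans ?_
        gcongr
        have hmx : ∀ x, Measurable fun z => entropyFun (nextDensity μ f₁ i x z) := fun x =>
          measurable_entropyFun.comp (measurable_nextDensity_right μ hf₁ i x)
        have hin : ∀ x, ∫⁻ z, G i x z ∂μ i = A * ENNReal.ofReal (1 / m) *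
            (∫⁻ z, entropyFun (nextDensity μ f₁ i x z) ∂μ i + ∫⁻ z, ψ z ∂μ i) := fun x => by
          simp only [G]
          rw [lintegral_const_mul (f := fun z => entropyFun (nextDensity μ f₁ i x z) + ψ z) _
            ((hmx x).add hψ), lintegral_add_left (hmx x)]
        simp_rw [hin]
        have hm' := measurable_lintegral_entropyFun_nextDensity μ hf₁ i
        rw [lintegral_const_mul _ (hm'.add_const _), lintegral_add_left hm']
        gcongr
        simpa using hψi i
    _ = ∑' i, ∫⁻ x, ∫⁻ y, ∫⁻ z, nextDensity μ f₁ i x z *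
        α (1 - nextDensity μ f₂ i y z / nextDensity μ f₁ i x z).toReal ∂μ i ∂p x ∂P₁ +
        A * ENNReal.ofReal (1 / m) *
          (∑' i, ∫⁻ x, ∫⁻ z, entropyFun (nextDensity μ f₁ i x z) ∂μ i ∂P₁ +
            ENNReal.ofReal (Real.exp (Real.exp m)) * ∑' i, (s i : ℝ≥0∞) ^ 3) := by
        rw [ENNReal.tsum_add, ENNReal.tsum_mul_left, ENNReal.tsum_add, ENNReal.tsum_mul_left]
    _ ≤ _ := by
        gcongr
        · exact tsum_lintegral_cost_le μ hb hf₁ hf₂ h₁ h₂ hp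
        · exact tsum_lintegral_withDensity_entropyFun_nextDensity_le μ hf₁ h₁

lemma nextDensity_const_one (i : ℕ) (x : ℕ → E) (z : E) : nextDensity μ (fun _ => 1) i x z = 1 := by
  simp [nextDensity, headDensity]

/-- The cost of the sequential coupling of Poisson cells with small means with their product law, for the
unbounded cost `demboFunction 1` and a bounded density. -/
theorem tsum_lintegral_count_cost_demboFunction_one_le
    (hn : Measurable n) (hμ : ∀ i, (μ i).map n = poissonMeasure (s i ^ 2)) (hs : ∀ i, s i ≤ 1)
    (hf₁ : Measurable f₁) (h₁ : ∫⁻ x, f₁ x ∂Measure.infinitePi μ = 1)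
    {M : ℝ≥0∞} (hM : ∀ x, f₁ x ≤ M)
    (hp : ((Measure.infinitePi μ).withDensity f₁ ⊗ₘ p).snd =
      (Measure.infinitePi μ).withDensity fun _ => 1) :
    ∑' i, ∫⁻ x, ∫⁻ y, ∫⁻ z, nextDensity μ f₁ i x z * ((n z : ℝ≥0∞) * demboFunction 1
        (1 - nextDensity μ (fun _ => 1) i y z / nextDensity μ f₁ i x z).toReal) ∂μ i ∂p x
        ∂(Measure.infinitePi μ).withDensity f₁ ≤
      ∫⁻ x, entropyFun (f₁ x) ∂Measure.infinitePi μ +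
      M * (24 + 2 * ENNReal.ofReal (Real.exp (Real.exp 1))) * ∑' i, (s i : ℝ≥0∞) ^ 3 := by
  set P₁ := (Measure.infinitePi μ).withDensity f₁ with hP₁
  set C := ENNReal.ofReal (Real.exp (Real.exp 1)) with hC
  have hone : (1 : ℝ) ∈ Set.Icc (0 : ℝ) 1 := ⟨zero_le_one, le_rfl⟩
  let G : ℕ → (ℕ → E) → E → ℝ≥0∞ := fun i x z => nextDensity μ f₁ i x z *
    (((n z - 1 : ℕ) : ℝ≥0∞) * ENNReal.ofReal (Real.log (nextDensity μ f₁ i x z).toReal))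
  have hnm : Measurable fun z => ((n z - 1 : ℕ) : ℝ≥0∞) :=
    (measurable_of_countable fun k : ℕ => ((k - 1 : ℕ) : ℝ≥0∞)).comp hn
  have hG : ∀ i, Measurable fun q : (ℕ → E) × E => G i q.1 q.2 := fun i =>
    (measurable_nextDensity μ hf₁ i).mul ((hnm.comp measurable_snd).mul
      (Real.measurable_log.comp (measurable_nextDensity μ hf₁ i).ennreal_toReal).ennreal_ofReal)
  have hle : ∀ i x y, ∀ᵐ z ∂μ i, nextDensity μ f₁ i x z * (((n z - 1 : ℕ) : ℝ≥0∞) *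
      demboFunction 1 (1 - nextDensity μ (fun _ => 1) i y z / nextDensity μ f₁ i x z).toReal) ≤
      G i x z := by
    intro i x y
    filter_upwards [ae_nextDensity_lt_top μ hf₁ i x] with z hz
    rw [nextDensity_const_one, mul_left_comm]
    simp only [G]
    rw [mul_left_comm (nextDensity μ f₁ i x z)]
    exact mul_le_mul_right (mul_demboFunction_one_le hz.ne) _
  have herr : ∀ i, ∫⁻ x, ∫⁻ z, G i x z ∂μ i ∂P₁ ≤
      M * (24 + 2 * C) * (s i : ℝ≥0∞) ^ 3 := by
    intro i
    have hGi : Measurable fun x => ∫⁻ z, G i x z ∂μ i := (hG i).lintegral_prod_right'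
    have hd : DependsOn (fun x => ∫⁻ z, G i x z ∂μ i) (Set.Iio i) := fun x y hxy => by
      simp only [G, dependsOn_nextDensity μ i hxy]
    rw [hP₁, lintegral_withDensity_eq_lintegral_mul _ hf₁ hGi]
    have hhead := lintegral_headDensity_mul μ hf₁ i hGi hd
    have hsq : ∫⁻ z, ((n z - 1 : ℕ) : ℝ≥0∞) ^ 2 ∂μ i ≤ 2 * C * (s i : ℝ≥0∞) ^ 4 := by
      have h := lintegral_sq_excess_poissonMeasure_le (r := s i ^ 2)
        (pow_le_one₀ zero_le (hs i))
      rw [← hμ, lintegral_map (measurable_of_countable _) hn] at h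
      refine h.trans (le_of_eq ?_)
      push_cast
      rw [← pow_mul]
    have hs3 : (s i : ℝ≥0∞)⁻¹ * (s i : ℝ≥0∞) ^ 4 ≤ (s i : ℝ≥0∞) ^ 3 := by
      rw [pow_succ', ← mul_assoc]
      exact mul_le_of_le_one_left' (ENNReal.inv_mul_le_one _)
    calc ∫⁻ x, f₁ x * ∫⁻ z, G i x z ∂μ i ∂Measure.infinitePi μ
        = ∫⁻ x, headDensity μ f₁ i x * ∫⁻ z, G i x z ∂μ i ∂Measure.infinitePi μ := hhead.symm
      _ ≤ ∫⁻ _, M * (24 + 2 * C) * (s i : ℝ≥0∞) ^ 3 ∂Measure.infinitePi μ := by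
          refine lintegral_mono_ae ?_
          filter_upwards [ae_headDensity_lt_top μ hf₁ h₁ i] with x hx
          have hmx := measurable_nextDensity_right μ hf₁ i x
          have hGx : Measurable (G i x) := (hG i).comp measurable_prodMk_left
          rw [← lintegral_const_mul _ hGx]
          calc ∫⁻ z, headDensity μ f₁ i x * G i x z ∂μ i
              ≤ ∫⁻ z, M * (24 * (s i : ℝ≥0∞) ^ 3 * nextDensity μ f₁ i x z +
                  (s i : ℝ≥0∞)⁻¹ * ((n z - 1 : ℕ) : ℝ≥0∞) ^ 2) ∂μ i := by
                refine lintegral_mono_ae ?_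
                filter_upwards [ae_headDensity_mul_nextDensity μ hf₁ i hx,
                  ae_nextDensity_lt_top μ hf₁ i x] with z hz hzt
                simp only [G]
                rw [← mul_assoc, ← hz]
                refine mul_le_mul' ?_ (natCast_mul_log_le _ _ hzt.ne)
                calc headDensity μ f₁ (i + 1) (Function.update x i z)
                    ≤ ∫⁻ _, M ∂Measure.infinitePi μ := lintegral_mono fun _ => hM _
                  _ = M := by simp
            _ = M * (24 * (s i : ℝ≥0∞) ^ 3 * 1 +
                  (s i : ℝ≥0∞)⁻¹ * ∫⁻ z, ((n z - 1 : ℕ) : ℝ≥0∞) ^ 2 ∂μ i) := by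
                rw [lintegral_const_mul (f := fun z => 24 * (s i : ℝ≥0∞) ^ 3 *
                    nextDensity μ f₁ i x z + (s i : ℝ≥0∞)⁻¹ * ((n z - 1 : ℕ) : ℝ≥0∞) ^ 2) _
                    ((hmx.const_mul _).add ((hnm.pow_const 2).const_mul _)),
                  lintegral_add_left (hmx.const_mul _), lintegral_const_mul _ hmx,
                  lintegral_const_mul _ (hnm.pow_const 2), lintegral_nextDensity μ hf₁]
            _ ≤ M * (24 * (s i : ℝ≥0∞) ^ 3 * 1 +
                  (s i : ℝ≥0∞)⁻¹ * (2 * C * (s i : ℝ≥0∞) ^ 4)) := by gcongr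
            _ = M * (24 * (s i : ℝ≥0∞) ^ 3 +
                  2 * C * ((s i : ℝ≥0∞)⁻¹ * (s i : ℝ≥0∞) ^ 4)) := by ring
            _ ≤ M * (24 * (s i : ℝ≥0∞) ^ 3 + 2 * C * (s i : ℝ≥0∞) ^ 3) := by gcongr
            _ = M * (24 + 2 * C) * (s i : ℝ≥0∞) ^ 3 := by ring
      _ = _ := by simp
  calc _ ≤ ∑' i, (∫⁻ x, ∫⁻ y, ∫⁻ z, nextDensity μ f₁ i x z * demboFunction 1
        (1 - nextDensity μ (fun _ => 1) i y z / nextDensity μ f₁ i x z).toReal ∂μ i ∂p x ∂P₁ +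
        M * (24 + 2 * C) * (s i : ℝ≥0∞) ^ 3) :=
        ENNReal.tsum_le_tsum fun i => (lintegral_count_cost_le μ i (hG i) (hle i)).trans
            (add_le_add_right (herr i) _)
    _ = ∑' i, ∫⁻ x, ∫⁻ y, ∫⁻ z, nextDensity μ f₁ i x z * demboFunction 1
        (1 - nextDensity μ (fun _ => 1) i y z / nextDensity μ f₁ i x z).toReal ∂μ i ∂p x ∂P₁ +
        M * (24 + 2 * C) * ∑' i, (s i : ℝ≥0∞) ^ 3 := by
        rw [ENNReal.tsum_add, ENNReal.tsum_mul_left]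
    _ ≤ _ := by
        gcongr
        refine (tsum_lintegral_cost_le μ (costEntropyBound_demboFunction hone) hf₁
          measurable_const h₁ (by simp) hp).trans ?_
        simp [entropyFun_one]

end CouplingCost

/-! ### Gluing kernels -/

section Gluing

variable {E : Type*} [MeasurableSpace E]

lemma transportCost_le {c : E → Measure E → ℝ≥0∞} {P₁ P₂ : Measure E} [SFinite P₁] (p : Kernel E E)
    [IsMarkovKernel p] (hp : p ∘ₘ P₁ = P₂) : transportCost c P₂ P₁ ≤ ∫⁻ x, c x (p x) ∂P₁ :=
  iInf_le_of_le (P₁ ⊗ₘ p) <| iInf_le_of_le p <| iInf_le_of_le inferInstance <|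
    iInf_le_of_le (Measure.fst_compProd _ _) <|
    iInf_le_of_le ((Measure.snd_compProd _ _).trans hp) <| iInf_le_of_le rfl le_rfl

lemma exists_kernel_of_transportCost_lt {c : E → Measure E → ℝ≥0∞} {P₁ P₂ : Measure E} [SFinite P₁]
    {b : ℝ≥0∞} (h : transportCost c P₂ P₁ < b) :
    ∃ p : Kernel E E, IsMarkovKernel p ∧ p ∘ₘ P₁ = P₂ ∧ ∫⁻ x, c x (p x) ∂P₁ < b := by
  unfold transportCost at h
  simp only [iInf_lt_iff] at h
  obtain ⟨N, p, hp, -, hsnd, rfl, hlt⟩ := h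
  exact ⟨p, hp, (Measure.snd_compProd _ _).symm.trans hsnd, hlt⟩

/-- Kernels can be glued along a countable partition of the source: the transport cost from a mixture of
mutually singular measures is at most the mean of the transport costs. -/
theorem transportCost_le_tsum_cond {c : E → Measure E → ℝ≥0∞} {P₁ P₂ : Measure E}
    [IsProbabilityMeasure P₁] [IsProbabilityMeasure P₂] {j : E → ℕ} (hj : Measurable j) :
    transportCost c P₂ P₁ ≤
      ∑' k, P₁ (j ⁻¹' {k}) * transportCost c P₂ (cond P₁ (j ⁻¹' {k})) := by
  let D : ℕ → Set E := fun k => j ⁻¹' {k}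
  have hD : ∀ k, MeasurableSet (D k) := fun k => hj (measurableSet_singleton k)
  refine ENNReal.le_of_forall_pos_le_add fun ε hε htop => ?_
  obtain ⟨δ, hδ, hδε⟩ := ENNReal.exists_pos_sum_of_countable
    (ENNReal.coe_pos.2 hε).ne' ℕ
  have hex : ∀ k, ∃ p : Kernel E E, IsMarkovKernel p ∧ p ∘ₘ (P₁.restrict (D k)) = P₁ (D k) • P₂ ∧
      ∫⁻ x in D k, c x (p x) ∂P₁ ≤ P₁ (D k) * transportCost c P₂ (cond P₁ (D k)) + δ k := by
    intro k
    by_cases h0 : P₁ (D k) = 0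
    · refine ⟨Kernel.const _ P₂, inferInstance, ?_, ?_⟩
      · rw [Measure.restrict_eq_zero.2 h0, h0]; simp
      · rw [Measure.restrict_eq_zero.2 h0]; simp
    · have hcond : IsProbabilityMeasure (cond P₁ (D k)) := cond_isProbabilityMeasure h0
      have hres : P₁.restrict (D k) = P₁ (D k) • cond P₁ (D k) := by
        rw [ProbabilityTheory.cond, smul_smul, ENNReal.mul_inv_cancel h0 (measure_ne_top _ _),
          one_smul]
      have hfin : transportCost c P₂ (cond P₁ (D k)) ≠ ∞ := by
        intro htop'
        have := ENNReal.le_tsum (f := fun k => P₁ (D k) * transportCost c P₂ (cond P₁ (D k))) k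
        rw [htop', ENNReal.mul_top h0] at this
        exact htop.ne (top_le_iff.1 this)
      obtain ⟨p, hp, hsnd, hlt⟩ := exists_kernel_of_transportCost_lt
        (ENNReal.lt_add_right hfin (ENNReal.coe_pos.2 (hδ k)).ne')
      refine ⟨p, hp, ?_, ?_⟩
      · rw [hres, Measure.bind_smul, hsnd]
      · rw [hres, lintegral_smul_measure, smul_eq_mul]
        calc _ ≤ P₁ (D k) * (transportCost c P₂ (cond P₁ (D k)) + δ k) := by gcongr
          _ ≤ _ := by
            rw [mul_add]
            gcongr
            exact mul_le_of_le_one_left' prob_le_one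
  choose p hp hsnd hcost using hex
  let q : Kernel E E := ⟨fun x => p (j x) x, by
    have h : Measurable fun y : ℕ × E => p y.1 y.2 :=
      measurable_from_prod_countable_right fun k => (p k).measurable
    exact h.comp (hj.prodMk measurable_id)⟩
  have hq : IsMarkovKernel q := ⟨fun x => (hp (j x)).isProbabilityMeasure x⟩
  have hqD : ∀ k, ∀ x ∈ D k, q x = p k x := by
    rintro k x rfl
    rfl
  have hsum : P₁ = Measure.sum fun k => P₁.restrict (D k) := by
    rw [← Measure.restrict_iUnion (fun a b hab => ?_) hD]
    · have : ⋃ k, D k = Set.univ := Set.eq_univ_of_forall fun x => Set.mem_iUnion.2 ⟨j x, rfl⟩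
      rw [this, Measure.restrict_univ]
    · exact Set.disjoint_left.2 fun x hx hx' => hab (hx.symm.trans hx')
  have hint : ∀ F G : E → ℝ≥0∞, (∀ k, ∀ x ∈ D k, F x = G x) → ∀ k,
      ∫⁻ x in D k, F x ∂P₁ = ∫⁻ x in D k, G x ∂P₁ := fun F G h k =>
    setLIntegral_congr_fun (hD k) (h k)
  have hqP : q ∘ₘ P₁ = P₂ := by
    ext B hB
    rw [Measure.bind_apply hB (Kernel.aemeasurable _)]
    conv_lhs => rw [hsum]
    rw [lintegral_sum_measure]
    have : ∀ k, ∫⁻ x in D k, q x B ∂P₁ = P₁ (D k) * P₂ B := by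
      intro k
      rw [setLIntegral_congr_fun (hD k) (g := fun x => p k x B) fun x hx => by
        rw [hqD k x hx], ← Measure.bind_apply hB (Kernel.aemeasurable _), hsnd]
      simp
    simp_rw [this]
    rw [ENNReal.tsum_mul_right, ← measure_iUnion (fun a b hab => ?_) hD]
    · have : ⋃ k, D k = Set.univ := Set.eq_univ_of_forall fun x => Set.mem_iUnion.2 ⟨j x, rfl⟩
      rw [this]; simp
    · exact Set.disjoint_left.2 fun x hx hx' => hab (hx.symm.trans hx')
  calc transportCost c P₂ P₁ ≤ ∫⁻ x, c x (q x) ∂P₁ := transportCost_le q hqP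
    _ = ∑' k, ∫⁻ x in D k, c x (p k x) ∂P₁ := by
        conv_lhs => rw [hsum]
        rw [lintegral_sum_measure]
        exact tsum_congr fun k => setLIntegral_congr_fun (hD k) fun x hx => by rw [hqD k x hx]
    _ ≤ ∑' k, (P₁ (D k) * transportCost c P₂ (cond P₁ (D k)) + δ k) :=
        ENNReal.tsum_le_tsum hcost
    _ ≤ _ := by
        rw [ENNReal.tsum_add]
        gcongr

end Gluing

/-! ### From bounded to arbitrary densities -/

section EntropySplitting

open scoped NNReal

variable {E : Type*} [MeasurableSpace E] {γ : Measure E} [IsProbabilityMeasure γ]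

/-- The entropy contributed by normalizing a density: `a * φ (x / a) + 1 = φ x + a + x * log (1 / a)`
for `φ = klFun`. -/
lemma mul_entropyFun_div {a : ℝ≥0} (ha : a ≠ 0) (ha1 : a ≤ 1) (x : ℝ≥0) :
    (a : ℝ≥0∞) * entropyFun ((a : ℝ≥0∞)⁻¹ * x) + 1 =
      entropyFun x + a + x * ENNReal.ofReal (-Real.log a) := by
  have ha0 : (0 : ℝ) < a := by exact_mod_cast pos_iff_ne_zero.2 ha
  have hx0 : (0 : ℝ) ≤ x := x.2
  have hl : 0 ≤ -Real.log a := by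
    have := Real.log_nonpos ha0.le (by exact_mod_cast ha1)
    linarith
  have h1 := InformationTheory.klFun_nonneg (x := (a : ℝ)⁻¹ * x) (by positivity)
  have h2 := InformationTheory.klFun_nonneg hx0
  unfold entropyFun
  rw [ENNReal.toReal_mul, ENNReal.toReal_inv, ENNReal.coe_toReal, ENNReal.coe_toReal,
    ← ENNReal.ofReal_coe_nnreal (p := a), ← ENNReal.ofReal_coe_nnreal (p := x), ← ENNReal.ofReal_one,
    ← ENNReal.ofReal_mul ha0.le, ← ENNReal.ofReal_mul hx0,
    ← ENNReal.ofReal_add (by positivity) (by positivity), ← ENNReal.ofReal_add h2 ha0.le,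
    ← ENNReal.ofReal_add (by positivity) (by positivity)]
  congr 1
  rw [InformationTheory.klFun_apply, InformationTheory.klFun_apply]
  rcases hx0.eq_or_lt with h | h
  · rw [← h]; simp; ring
  · rw [Real.log_mul (by positivity) h.ne', Real.log_inv]
    field_simp
    ring

/-- Far out, the integral `a` of a density over a set is small, together with `a * log (1 / a)`. -/
lemma exists_threshold {g : E → ℝ≥0} (hg : Measurable g) (h1 : ∫⁻ x, g x ∂γ = 1) {η : ℝ≥0∞}
    (hη : η ≠ 0) (L : ℝ≥0) : ∃ K : ℝ≥0, L ≤ K ∧ ∀ A : Set E, (∀ x ∈ A, K ≤ g x) →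
      ∫⁻ x in A, g x ∂γ + ENNReal.ofReal (Real.negMulLog (∫⁻ x in A, g x ∂γ).toReal) ≤ η := by
  -- the function `a + a * log (1 / a)` is continuous at `0`
  have hcont : Filter.Tendsto (fun a : ℝ≥0∞ => a + ENNReal.ofReal (Real.negMulLog a.toReal)) (nhds 0)
      (nhds 0) := by
    have h2 : Filter.Tendsto (fun a : ℝ≥0∞ => ENNReal.ofReal (Real.negMulLog a.toReal)) (nhds 0)
        (nhds (ENNReal.ofReal (Real.negMulLog 0))) :=
      ENNReal.tendsto_ofReal ((Real.continuous_negMulLog.tendsto 0).comp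
        (ENNReal.tendsto_toReal ENNReal.zero_ne_top))
    simpa using Filter.Tendsto.add Filter.tendsto_id h2
  obtain ⟨δ, hδ, hδη⟩ := ENNReal.nhds_zero_basis.eventually_iff.1
    (hcont.eventually (ge_mem_nhds (pos_iff_ne_zero.2 hη)))
  obtain ⟨δ', hδ', hA⟩ := exists_pos_setLIntegral_lt_of_measure_lt
    (by rw [h1]; exact ENNReal.one_ne_top) hδ.ne'
  obtain ⟨K, hK⟩ := ENNReal.exists_nat_gt (ENNReal.inv_ne_top.2 hδ'.ne')
  refine ⟨max L K, le_max_left _ _, fun A hAg => hδη (hA A ?_)⟩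
  have hK0 : (K : ℝ≥0∞) ≠ 0 := fun h0 => by simp [h0] at hK
  have hmark := mul_meas_ge_le_lintegral (μ := γ) (f := fun x => (g x : ℝ≥0∞)) (by fun_prop) K
  rw [h1] at hmark
  calc γ A ≤ γ {x | (K : ℝ≥0∞) ≤ g x} := by
        refine measure_mono fun x hx => ?_
        have := (le_max_right L (K : ℝ≥0)).trans (hAg x hx)
        show (K : ℝ≥0∞) ≤ g x
        exact_mod_cast this
    _ ≤ (K : ℝ≥0∞)⁻¹ := by
        rw [← one_div, ENNReal.le_div_iff_mul_le (.inl hK0) (.inl (by simp)), mul_comm]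
        exact hmark
    _ < δ' := ENNReal.inv_lt_iff_inv_lt.1 hK

/-- If the transport-entropy inequality `T(γ | f • γ) ≤ H(f • γ | γ)` holds for all bounded densities then it
holds for all densities. The density is cut at high levels, so that the entropy of the index of
the level is small. -/
theorem transportCost_le_of_bounded {c : E → Measure E → ℝ≥0∞}
    (hb : ∀ f : E → ℝ≥0∞, Measurable f → ∫⁻ x, f x ∂γ = 1 → (∃ M : ℝ≥0∞, M ≠ ∞ ∧ ∀ x, f x ≤ M) →
      transportCost c γ (γ.withDensity f) ≤ ∫⁻ x, entropyFun (f x) ∂γ)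
    {g : E → ℝ≥0} (hg : Measurable g) (h1 : ∫⁻ x, g x ∂γ = 1) :
    transportCost c γ (γ.withDensity fun x => g x) ≤ ∫⁻ x, entropyFun (g x) ∂γ := by
  set P₁ := γ.withDensity fun x => (g x : ℝ≥0∞) with hP₁
  have hprob : IsProbabilityMeasure P₁ := ⟨by rw [hP₁, withDensity_apply _ .univ]; simpa using h1⟩
  refine ENNReal.le_of_forall_pos_le_add fun ε hε htop => ?_
  obtain ⟨η, hη, hηε⟩ := ENNReal.exists_pos_sum_of_countable (ENNReal.coe_pos.2 hε).ne' ℕ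
  choose K hKk hK using fun k : ℕ => exists_threshold (γ := γ) hg h1 (ENNReal.coe_pos.2 (hη k)).ne' k
  have hfind : ∀ x, ∃ k, g x < K k := fun x => by
    obtain ⟨k, hk⟩ := exists_nat_gt (g x)
    exact ⟨k, hk.trans_le (hKk k)⟩
  classical
  let j : E → ℕ := fun x => Nat.find (hfind x)
  have hj : Measurable j := measurable_find hfind fun k => measurableSet_lt hg measurable_const
  let D : ℕ → Set E := fun k => j ⁻¹' {k}
  have hD : ∀ k, MeasurableSet (D k) := fun k => hj (measurableSet_singleton k)
  have hDlt : ∀ k, ∀ x ∈ D k, g x < K k := by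
    rintro k x rfl
    exact Nat.find_spec (hfind x)
  have hDge : ∀ k, ∀ x ∈ D (k + 1), K k ≤ g x := by
    intro k x hx
    have hx' : j x = k + 1 := hx
    exact not_lt.1 (Nat.find_min (hfind x) (m := k) (by change k < j x; omega))
  have hcover : ∀ Q : Measure E, ∑' k, Q (D k) = Q Set.univ := by
    intro Q
    rw [← measure_iUnion (fun a b hab => ?_) hD]
    · congr 1
      exact Set.eq_univ_of_forall fun x => Set.mem_iUnion.2 ⟨j x, rfl⟩
    · exact Set.disjoint_left.2 fun x hx hx' => hab (hx.symm.trans hx')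
  let a : ℕ → ℝ≥0∞ := fun k => ∫⁻ x in D k, g x ∂γ
  have ha : ∀ k, P₁ (D k) = a k := fun k => by rw [hP₁, withDensity_apply _ (hD k)]
  have ha1 : ∀ k, a k ≤ 1 := fun k => ha k ▸ prob_le_one
  have hat : ∀ k, a k ≠ ∞ := fun k => ne_top_of_le_ne_top ENNReal.one_ne_top (ha1 k)
  let ℓ : ℕ → ℝ≥0∞ := fun k => ENNReal.ofReal (Real.negMulLog (a k).toReal)
  let T : ℕ → ℝ≥0∞ := fun k => a k * transportCost c γ (cond P₁ (D k))
  -- the contribution of the set where the density lies between two consecutive levels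
  have hT : ∀ k, T k + γ (D k) ≤ ∫⁻ x in D k, entropyFun (g x) ∂γ + a k + ℓ k := by
    intro k
    by_cases h0 : a k = 0
    · have hae : ∀ᵐ x ∂γ.restrict (D k), (g x : ℝ≥0∞) = 0 :=
        (lintegral_eq_zero_iff (by fun_prop)).1 h0
      have : ∫⁻ x in D k, entropyFun (g x) ∂γ = γ (D k) := by
        rw [lintegral_congr_ae (g := fun _ => 1) (by
          filter_upwards [hae] with x hx
          simp [hx, entropyFun, InformationTheory.klFun_apply])]
        simp
      simp [T, h0, this]
    · set b : ℝ≥0 := (a k).toNNReal with hb'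
      have hab : (b : ℝ≥0∞) = a k := ENNReal.coe_toNNReal (hat k)
      have hb0 : b ≠ 0 := fun h => h0 (by rw [← hab, h]; simp)
      have hb1 : b ≤ 1 := by
        have := ha1 k
        rw [← hab] at this
        exact_mod_cast this
      let f : E → ℝ≥0∞ := fun x => (b : ℝ≥0∞)⁻¹ * (D k).indicator (fun x => (g x : ℝ≥0∞)) x
      have hfm : Measurable f := (hg.coe_nnreal_ennreal.indicator (hD k)).const_mul _
      have hcond : cond P₁ (D k) = γ.withDensity f := by
        rw [ProbabilityTheory.cond, ha, ← hab, hP₁, restrict_withDensity (hD k), ← withDensity_indicator (hD k),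
          ← withDensity_smul _ (hg.coe_nnreal_ennreal.indicator (hD k))]
        rfl
      have hf1 : ∫⁻ x, f x ∂γ = 1 := by
        simp only [f]
        rw [lintegral_const_mul _ (hg.coe_nnreal_ennreal.indicator (hD k)),
          lintegral_indicator (hD k)]
        change (b : ℝ≥0∞)⁻¹ * a k = 1
        rw [← hab, ENNReal.inv_mul_cancel (by exact_mod_cast hb0) (by simp)]
      have hfM : ∀ x, f x ≤ (b : ℝ≥0∞)⁻¹ * K k := by
        intro x
        simp only [f]
        gcongr
        by_cases hx : x ∈ D k
        · simpa [hx] using (hDlt k x hx).le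
        · simp [hx]
      have hle := hb f hfm hf1 ⟨_, ENNReal.mul_ne_top
        (ENNReal.inv_ne_top.2 (by exact_mod_cast hb0)) (by simp), hfM⟩
      have hφf : Measurable fun x => entropyFun (f x) := measurable_entropyFun.comp hfm
      calc T k + γ (D k) ≤ ∫⁻ x, b * entropyFun (f x) ∂γ + γ (D k) := by
            simp only [T]
            rw [hcond, ← hab, lintegral_const_mul _ hφf]
            gcongr
        _ = ∫⁻ x in D k, (b * entropyFun (f x) + 1) ∂γ + ∫⁻ x in (D k)ᶜ, b * entropyFun (f x) ∂γ := by
            rw [lintegral_add_right _ measurable_const, add_right_comm,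
              lintegral_add_compl _ (hD k)]
            simp
        _ = ∫⁻ x in D k, (entropyFun (g x) + b + g x * ENNReal.ofReal (-Real.log b)) ∂γ +
              ∫⁻ x in (D k)ᶜ, b ∂γ := by
            congr 1
            · refine setLIntegral_congr_fun (hD k) fun x hx => ?_
              simp only [f, Set.indicator_of_mem hx]
              exact mul_entropyFun_div hb0 hb1 (g x)
            · refine setLIntegral_congr_fun (hD k).compl fun x hx => ?_
              simp [f, Set.indicator_of_notMem hx, entropyFun, InformationTheory.klFun_apply]
        _ = ∫⁻ x in D k, entropyFun (g x) ∂γ + b * (γ (D k) + γ (D k)ᶜ) +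
              a k * ENNReal.ofReal (-Real.log b) := by
            rw [lintegral_add_right _ (hg.coe_nnreal_ennreal.mul_const _),
              lintegral_add_right _ measurable_const,
              lintegral_mul_const _ hg.coe_nnreal_ennreal]
            simp only [lintegral_const, Measure.restrict_apply_univ, a]
            ring
        _ = _ := by
            rw [measure_add_measure_compl (hD k), measure_univ, mul_one, hab]
            congr 1
            simp only [ℓ, Real.negMulLog]
            rw [← hab, ENNReal.coe_toReal, ← ENNReal.ofReal_coe_nnreal,
              ← ENNReal.ofReal_mul b.coe_nonneg]
            congr 1
            ring
  have hasum : ∑' k, a k = 1 := by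
    simp_rw [← ha]
    rw [hcover, measure_univ]
  -- the lowest level set has almost full mass, hence a small entropy contribution as well
  have hℓ0 : ℓ 0 ≤ ∑' k, a (k + 1) := by
    have h2 : ∑' k, a k = a 0 + ∑' k, a (k + 1) := tsum_eq_zero_add' ENNReal.summable
    rw [hasum] at h2
    refine (ENNReal.add_le_add_iff_left (hat 0)).1 ?_
    rw [← h2]
    have h3 : Real.negMulLog (a 0).toReal ≤ 1 - (a 0).toReal := by
      have := mul_log_le (A := (a 0).toReal) ENNReal.toReal_nonneg one_pos
      rw [Real.negMulLog]
      simp at this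
      linarith
    have h4 : (a 0).toReal ≤ 1 := by simpa using ENNReal.toReal_mono ENNReal.one_ne_top (ha1 0)
    calc a 0 + ℓ 0 ≤ ENNReal.ofReal (a 0).toReal + ENNReal.ofReal (1 - (a 0).toReal) := by
          rw [ENNReal.ofReal_toReal (hat 0)]
          exact add_le_add_right (ENNReal.ofReal_le_ofReal h3) _
      _ = 1 := by
          rw [← ENNReal.ofReal_add ENNReal.toReal_nonneg (by linarith)]; simp
  have hℓsum : ∑' k, ℓ k ≤ ε := by
    rw [tsum_eq_zero_add' ENNReal.summable]
    calc _ ≤ ∑' k, a (k + 1) + ∑' k, ℓ (k + 1) := by gcongr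
      _ = ∑' k, (a (k + 1) + ℓ (k + 1)) := ENNReal.tsum_add.symm
      _ ≤ ∑' k, (η k : ℝ≥0∞) := ENNReal.tsum_le_tsum fun k => hK k _ (hDge k)
      _ ≤ ε := hηε.le
  have hsum : ∑' k, T k + 1 ≤ ∫⁻ x, entropyFun (g x) ∂γ + ε + 1 := by
    calc ∑' k, T k + 1 = ∑' k, (T k + γ (D k)) := by
          rw [ENNReal.tsum_add, hcover, measure_univ]
      _ ≤ ∑' k, (∫⁻ x in D k, entropyFun (g x) ∂γ + a k + ℓ k) := ENNReal.tsum_le_tsum hT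
      _ = ∫⁻ x, entropyFun (g x) ∂γ + 1 + ∑' k, ℓ k := by
          rw [ENNReal.tsum_add, ENNReal.tsum_add, hasum]
          congr 2
          have := hcover (γ.withDensity fun x => entropyFun (g x))
          rw [withDensity_apply _ .univ, Measure.restrict_univ] at this
          rw [← this]
          exact tsum_congr fun k => (withDensity_apply _ (hD k)).symm
      _ ≤ _ := by
          rw [add_right_comm]
          gcongr
  refine (transportCost_le_tsum_cond hj).trans ?_
  have hTk : ∀ k, P₁ (j ⁻¹' {k}) * transportCost c γ (cond P₁ (j ⁻¹' {k})) = T k := fun k => by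
    simp only [T]
    rw [← ha]
  simp_rw [hTk]
  exact (ENNReal.add_le_add_iff_right ENNReal.one_ne_top).1 hsum

end EntropySplitting

/-! ### Transport-entropy inequalities for the Poisson law -/

section PoissonTransport

open scoped NNReal

variable {Z : Type*} [MeasurableSpace Z] [TopologicalSpace Z] [SecondCountableTopology Z]
  [BorelSpace Z] [StandardBorelSpace Z] [Nonempty Z] {ν : Measure Z} [SigmaFinite ν]
  {S : Set (Measure Z)} {Pν : Measure S}

lemma map_withDensity_comp {X Y : Type*} [MeasurableSpace X] [MeasurableSpace Y] {P : Measure X}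
    {Φ : X → Y} (hΦ : Measurable Φ) {g : Y → ℝ≥0∞} (hg : Measurable g) :
    (P.withDensity (g ∘ Φ)).map Φ = (P.map Φ).withDensity g := by
  ext A hA
  rw [Measure.map_apply hΦ hA, withDensity_apply _ (hΦ hA), withDensity_apply _ hA,
    setLIntegral_map hA hg hΦ]
  rfl

lemma map_fst_cellLaw (r : ℝ≥0) (π : Measure Z) [IsProbabilityMeasure π] :
    (cellLaw r π).map Prod.fst = poissonMeasure r := by
  change (cellLaw r π).fst = _
  rw [cellLaw, Measure.fst_prod]

/-- Cells with arbitrarily small means represent the Poisson law on `S`, and the sequential coupling of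
their laws bounds the transport cost. -/
theorem exists_cells_transportCost_le (hS : IsConfigurationSpace ν S) (hP : IsPoissonLaw ν Pν)
    {g₁ g₂ : S → ℝ≥0∞} (hg₁ : Measurable g₁) (hg₂ : Measurable g₂)
    (h₁ : ∫⁻ ξ, g₁ ξ ∂Pν = 1) (h₂ : ∫⁻ ξ, g₂ ξ ∂Pν = 1) {ε : ℝ≥0∞} (hε : ε ≠ 0) :
    ∃ (s : ℕ → ℝ≥0) (μ : ℕ → Measure (ℕ × (ℕ → Z))) (_ : ∀ i, IsProbabilityMeasure (μ i))
      (Φ : (ℕ → ℕ × (ℕ → Z)) → S) (p : Kernel (ℕ → ℕ × (ℕ → Z)) (ℕ → ℕ × (ℕ → Z)))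
      (_ : IsMarkovKernel p),
      (∀ i, s i ≤ 1) ∧ ∑' i, (s i : ℝ≥0∞) ^ 3 ≤ ε ∧
      (∀ i, (μ i).map Prod.fst = poissonMeasure (s i ^ 2)) ∧
      Measurable Φ ∧ (Measure.infinitePi μ).map Φ = Pν ∧
      ((Measure.infinitePi μ).withDensity (g₁ ∘ Φ) ⊗ₘ p).snd =
        (Measure.infinitePi μ).withDensity (g₂ ∘ Φ) ∧
      ∀ α, IsConvexCost α →
        transportCost (martonCost α) (Pν.withDensity g₂) (Pν.withDensity g₁) ≤
          ∑' i, ∫⁻ x, ∫⁻ y, ∫⁻ z, nextDensity μ (g₁ ∘ Φ) i x z * ((z.1 : ℝ≥0∞) *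
            α (1 - nextDensity μ (g₂ ∘ Φ) i y z / nextDensity μ (g₁ ∘ Φ) i x z).toReal) ∂μ i ∂p x
            ∂(Measure.infinitePi μ).withDensity (g₁ ∘ Φ) := by
  obtain ⟨s, π, hπ, hs1, hs3, hν⟩ := exists_eq_sum_sq_smul ν hε
  obtain ⟨Φ, hΦ, hΦs, hΦP⟩ := hS.exists_map_isPoissonLaw (fun i => s i ^ 2) π hν
  have hmap := hΦP.unique hP
  set μ : ℕ → Measure (ℕ × (ℕ → Z)) := fun i => cellLaw (s i ^ 2) (π i) with hμ
  set P := Measure.infinitePi μ with hPdef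
  have hf₁ : Measurable (g₁ ∘ Φ) := hg₁.comp hΦ
  have hf₂ : Measurable (g₂ ∘ Φ) := hg₂.comp hΦ
  have hi : ∀ g : S → ℝ≥0∞, Measurable g → ∫⁻ ω, (g ∘ Φ) ω ∂P = ∫⁻ ξ, g ξ ∂Pν := by
    intro g hg
    rw [← hmap, lintegral_map hg hΦ]
    rfl
  have hi₁ : ∫⁻ ω, (g₁ ∘ Φ) ω ∂P = 1 := (hi g₁ hg₁).trans h₁
  have hi₂ : ∫⁻ ω, (g₂ ∘ Φ) ω ∂P = 1 := (hi g₂ hg₂).trans h₂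
  obtain ⟨p, hp, hsnd, hcost⟩ := exists_sequentialCoupling_cost μ hf₁ hf₂ hi₁ hi₂
  refine ⟨s, μ, inferInstance, Φ, p, hp, hs1, hs3, fun i => map_fst_cellLaw _ _, hΦ, hmap, hsnd,
    fun α hα => ?_⟩
  have hp₁ : IsProbabilityMeasure (P.withDensity (g₁ ∘ Φ)) :=
    ⟨by rw [withDensity_apply _ .univ]; simpa using hi₁⟩
  have hp₂ : IsProbabilityMeasure (P.withDensity (g₂ ∘ Φ)) :=
    ⟨by rw [withDensity_apply _ .univ]; simpa using hi₂⟩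
  have h := transportCost_martonCost_le hS.isLocallyFiniteMeasure hΦ
    ((withDensity_absolutelyContinuous P (g₁ ∘ Φ)).ae_le hΦs)
    ((withDensity_absolutelyContinuous P (g₂ ∘ Φ)).ae_le hΦs) p hsnd hα
  rw [map_withDensity_comp hΦ hg₁, map_withDensity_comp hΦ hg₂, hmap] at h
  refine h.trans (ENNReal.tsum_le_tsum fun i => ?_)
  exact hcost α hα (fun z => (z.1 : ℝ≥0∞))
    ((measurable_of_countable fun n : ℕ => (n : ℝ≥0∞)).comp measurable_fst) i

lemma lintegral_entropyFun_comp {X Y : Type*} [MeasurableSpace X] [MeasurableSpace Y] {P : Measure X}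
    {Φ : X → Y} (hΦ : Measurable Φ) {g : Y → ℝ≥0∞} (hg : Measurable g) :
    ∫⁻ x, entropyFun ((g ∘ Φ) x) ∂P = ∫⁻ y, entropyFun (g y) ∂P.map Φ :=
  (lintegral_map (measurable_entropyFun.comp hg) hΦ).symm

/-- The transport-entropy inequality for a bounded convex cost, in terms of densities. -/
theorem transportCost_withDensity_le (hS : IsConfigurationSpace ν S) (hP : IsPoissonLaw ν Pν)
    {α : ℝ → ℝ≥0∞} {c₁ c₂ : ℝ≥0∞} (hα : IsConvexCost α) (hb : CostEntropyBound α c₁ c₂)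
    (hα1 : α 1 ≠ ∞) (hc₁ : c₁ ≠ 0)
    {g₁ g₂ : S → ℝ≥0∞} (hg₁ : Measurable g₁) (hg₂ : Measurable g₂)
    (h₁ : ∫⁻ ξ, g₁ ξ ∂Pν = 1) (h₂ : ∫⁻ ξ, g₂ ξ ∂Pν = 1) :
    transportCost (martonCost α) (Pν.withDensity g₂) (Pν.withDensity g₁) ≤
      c₁ * ∫⁻ ξ, entropyFun (g₁ ξ) ∂Pν + c₂ * ∫⁻ ξ, entropyFun (g₂ ξ) ∂Pν := by
  set H₁ := ∫⁻ ξ, entropyFun (g₁ ξ) ∂Pν with hH₁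
  by_cases hH : H₁ = ∞
  · rw [hH, ENNReal.mul_top hc₁]
    simp
  -- the contribution of the cells with several points vanishes as the scale `m` tends to infinity
  have key : ∀ m : ℝ, 0 < m →
      transportCost (martonCost α) (Pν.withDensity g₂) (Pν.withDensity g₁) ≤
        c₁ * H₁ + c₂ * ∫⁻ ξ, entropyFun (g₂ ξ) ∂Pν + α 1 * ENNReal.ofReal (1 / m) * (H₁ + 1) := by
    intro m hm
    set C := ENNReal.ofReal (Real.exp (Real.exp m)) with hC
    obtain ⟨s, μ, hμ, Φ, p, hp, hs1, hs3, hpoi, hΦ, hmap, hsnd, hT⟩ :=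
      exists_cells_transportCost_le hS hP hg₁ hg₂ h₁ h₂ (ε := C⁻¹)
        (ENNReal.inv_ne_zero.2 ENNReal.ofReal_ne_top)
    have hi : ∀ g : S → ℝ≥0∞, Measurable g →
        ∫⁻ ω, (g ∘ Φ) ω ∂Measure.infinitePi μ = ∫⁻ ξ, g ξ ∂Pν := by
      intro g hg
      rw [← hmap, lintegral_map hg hΦ]
      rfl
    have h := tsum_lintegral_count_cost_le_of_le μ hα hb le_rfl measurable_fst hpoi hs1
      (hg₁.comp hΦ) (hg₂.comp hΦ) ((hi g₁ hg₁).trans h₁) ((hi g₂ hg₂).trans h₂) hsnd hm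
    rw [lintegral_entropyFun_comp hΦ hg₁, lintegral_entropyFun_comp hΦ hg₂, hmap] at h
    refine ((hT α hα).trans h).trans ?_
    gcongr
    calc C * ∑' i, (s i : ℝ≥0∞) ^ 3 ≤ C * C⁻¹ := by gcongr
      _ ≤ 1 := ENNReal.mul_inv_le_one _
  refine ENNReal.le_of_forall_pos_le_add fun δ hδ _ => ?_
  set K := α 1 * (H₁ + 1) with hK
  have hKt : K ≠ ∞ := ENNReal.mul_ne_top hα1 (ENNReal.add_ne_top.2 ⟨hH, ENNReal.one_ne_top⟩)
  have hδ0 : (0 : ℝ) < δ := by exact_mod_cast hδ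
  have hm : 0 < K.toReal / δ + 1 := by positivity
  refine (key _ hm).trans (add_le_add_right ?_ _)
  rw [mul_right_comm, ← hK, ← ENNReal.ofReal_toReal hKt, ← ENNReal.ofReal_mul ENNReal.toReal_nonneg,
    ← ENNReal.ofReal_coe_nnreal]
  refine ENNReal.ofReal_le_ofReal ?_
  rw [mul_one_div, ENNReal.toReal_ofReal ENNReal.toReal_nonneg, div_le_iff₀ hm, mul_add,
    mul_div_cancel₀ _ hδ0.ne']
  linarith

/-- The transport-entropy inequality for the cost `demboFunction 1`, from the Poisson law. -/
theorem transportCost_demboFunction_one_le (hS : IsConfigurationSpace ν S) (hP : IsPoissonLaw ν Pν)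
    {g : S → ℝ≥0} (hg : Measurable g) (h1 : ∫⁻ ξ, g ξ ∂Pν = 1) :
    transportCost (martonCost (demboFunction 1)) Pν (Pν.withDensity fun ξ => g ξ) ≤
      ∫⁻ ξ, entropyFun (g ξ) ∂Pν := by
  have := hP.1
  refine transportCost_le_of_bounded (fun f hf hf1 ⟨M, hMt, hM⟩ => ?_) hg h1
  set K := M * (24 + 2 * ENNReal.ofReal (Real.exp (Real.exp 1))) with hK
  have hKt : K ≠ ∞ := ENNReal.mul_ne_top hMt (by finiteness)
  refine ENNReal.le_of_forall_pos_le_add fun δ hδ _ => ?_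
  obtain ⟨s, μ, hμ, Φ, p, hp, hs1, hs3, hpoi, hΦ, hmap, hsnd, hT⟩ :=
    exists_cells_transportCost_le hS hP hf (g₂ := fun _ => 1) measurable_const hf1 (by simp)
      (ε := δ / K) (ENNReal.div_ne_zero.2 ⟨(ENNReal.coe_pos.2 hδ).ne', hKt⟩)
  have hi : ∫⁻ ω, (f ∘ Φ) ω ∂Measure.infinitePi μ = 1 := by
    rw [← hf1, ← hmap, lintegral_map hf hΦ]
    rfl
  have h := tsum_lintegral_count_cost_demboFunction_one_le μ measurable_fst hpoi hs1
    (hf.comp hΦ) hi (fun x => hM (Φ x)) hsnd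
  rw [lintegral_entropyFun_comp hΦ hf, hmap] at h
  have hT1 := (hT _ (isConvexCost_demboFunction ⟨zero_le_one, le_rfl⟩)).trans h
  have hone : Pν.withDensity (fun _ => 1) = Pν := by
    simp
  rw [hone] at hT1
  refine hT1.trans (add_le_add_right ?_ _)
  calc K * ∑' i, (s i : ℝ≥0∞) ^ 3 ≤ K * (δ / K) := by gcongr
    _ ≤ δ := ENNReal.mul_div_le

lemma klDiv_eq_lintegral_entropyFun {E : Type*} [MeasurableSpace E] {P γ : Measure E}
    [IsFiniteMeasure P] [IsFiniteMeasure γ] (h : P ≪ γ) :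
    InformationTheory.klDiv P γ = ∫⁻ x, entropyFun (P.rnDeriv γ x) ∂γ :=
  InformationTheory.klDiv_eq_lintegral_klFun_of_ac h

lemma lintegral_rnDeriv_eq_one {E : Type*} [MeasurableSpace E] {P γ : Measure E}
    [IsProbabilityMeasure P] [IsFiniteMeasure γ] (h : P ≪ γ) : ∫⁻ x, P.rnDeriv γ x ∂γ = 1 := by
  rw [Measure.lintegral_rnDeriv h, measure_univ]

/-- The transport-entropy inequality for a bounded convex cost. -/
theorem transportEntropyInequality_of_ne_top (hS : IsConfigurationSpace ν S) (hP : IsPoissonLaw ν Pν)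
    {α : ℝ → ℝ≥0∞} {c₁ c₂ : ℝ≥0∞} (hα : IsConvexCost α) (hb : CostEntropyBound α c₁ c₂)
    (hα1 : α 1 ≠ ∞) (hc₁ : c₁ ≠ 0) (hc₂ : c₂ ≠ 0) :
    TransportEntropyInequality (martonCost α) c₁ c₂ Pν := by
  intro P₁ P₂ hP₁ hP₂
  have := hP.1
  by_cases hac₁ : P₁ ≪ Pν
  · by_cases hac₂ : P₂ ≪ Pν
    · rw [klDiv_eq_lintegral_entropyFun hac₁, klDiv_eq_lintegral_entropyFun hac₂]
      have h := transportCost_withDensity_le hS hP hα hb hα1 hc₁ (Measure.measurable_rnDeriv P₁ Pν)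
        (Measure.measurable_rnDeriv P₂ Pν) (lintegral_rnDeriv_eq_one hac₁)
        (lintegral_rnDeriv_eq_one hac₂)
      rwa [Measure.withDensity_rnDeriv_eq _ _ hac₁, Measure.withDensity_rnDeriv_eq _ _ hac₂] at h
    · rw [InformationTheory.klDiv_of_not_ac hac₂, ENNReal.mul_top hc₂]
      simp
  · rw [InformationTheory.klDiv_of_not_ac hac₁, ENNReal.mul_top hc₁]
    simp

/-- The transport-entropy inequality for the cost `demboFunction 1`. The second constant is infinite, so that
only `P₂ = Pν` matters. -/
theorem transportEntropyInequality_demboFunction_one (hS : IsConfigurationSpace ν S)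
    (hP : IsPoissonLaw ν Pν) :
    TransportEntropyInequality (martonCost (demboFunction 1)) 1 ∞ Pν := by
  intro P₁ P₂ hP₁ hP₂
  have := hP.1
  by_cases hkl : InformationTheory.klDiv P₂ Pν = 0
  · rw [hkl, mul_zero, add_zero, one_mul, InformationTheory.klDiv_eq_zero_iff.1 hkl]
    by_cases hac : P₁ ≪ Pν
    · rw [klDiv_eq_lintegral_entropyFun hac]
      let g : S → ℝ≥0 := fun ξ => (P₁.rnDeriv Pν ξ).toNNReal
      have hg : Measurable g := (Measure.measurable_rnDeriv P₁ Pν).ennreal_toNNReal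
      have hgr : (fun ξ => (g ξ : ℝ≥0∞)) =ᵐ[Pν] P₁.rnDeriv Pν := by
        filter_upwards [Measure.rnDeriv_lt_top P₁ Pν] with ξ hξ
        exact ENNReal.coe_toNNReal hξ.ne
      have h := transportCost_demboFunction_one_le hS hP hg
        ((lintegral_congr_ae hgr).trans (lintegral_rnDeriv_eq_one hac))
      rw [withDensity_congr_ae hgr, Measure.withDensity_rnDeriv_eq _ _ hac] at h
      refine h.trans (le_of_eq (lintegral_congr_ae ?_))
      filter_upwards [hgr] with ξ hξ
      rw [hξ]
    · rw [InformationTheory.klDiv_of_not_ac hac]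
      exact le_top
  · rw [ENNReal.top_mul hkl]
    simp

theorem transportEntropyInequality_demboFunction (hS : IsConfigurationSpace ν S)
    (hP : IsPoissonLaw ν Pν) {t : ℝ} (ht : t ∈ Set.Icc (0 : ℝ) 1) :
    TransportEntropyInequality (martonCost (demboFunction t))
      (ENNReal.ofReal t)⁻¹ (ENNReal.ofReal (1 - t))⁻¹ Pν := by
  rcases ht.2.eq_or_lt with rfl | ht1
  · simpa using transportEntropyInequality_demboFunction_one hS hP
  · refine transportEntropyInequality_of_ne_top hS hP (isConvexCost_demboFunction ht)
      (costEntropyBound_demboFunction ht) ?_ (ENNReal.inv_ne_zero.2 ENNReal.ofReal_ne_top)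
      (ENNReal.inv_ne_zero.2 ENNReal.ofReal_ne_top)
    unfold demboFunction
    split_ifs with h h'
    all_goals first | exact ENNReal.ofReal_ne_top | exact absurd ‹t = 1› ht1.ne

theorem transportEntropyInequality_sq (hS : IsConfigurationSpace ν S) (hP : IsPoissonLaw ν Pν) :
    TransportEntropyInequality (martonCost fun u => ENNReal.ofReal (u ^ 2)) 4 4 Pν :=
  transportEntropyInequality_of_ne_top hS hP isConvexCost_sq costEntropyBound_sq
    ENNReal.ofReal_ne_top (by norm_num) (by norm_num)

theorem existsUnique_isPoissonLaw (hS : IsConfigurationSpace ν S) :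
    ∃! Pν : Measure S, IsPoissonLaw ν Pν := by
  obtain ⟨s, π, hπ, -, -, hν⟩ := exists_eq_sum_sq_smul ν one_ne_zero
  obtain ⟨Φ, -, -, hΦP⟩ := hS.exists_map_isPoissonLaw (fun i => s i ^ 2) π hν
  exact ⟨_, hΦP, fun P hP => hP.unique hΦP⟩

end PoissonTransport

/-! ### The empty space -/

section EmptySpace

variable {Z : Type*} [MeasurableSpace Z] [IsEmpty Z] {ν : Measure Z} {S : Set (Measure Z)}

lemma poissonMeasure_zero : poissonMeasure 0 = Measure.dirac 0 := by
  refine Measure.ext_of_singleton fun n => ?_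
  rw [poissonMeasure_singleton, Measure.dirac_apply' _ (measurableSet_singleton n)]
  rcases n with _ | n <;> simp

lemma iIndepFun_const {Ω ι : Type*} {β : ι → Type*} [MeasurableSpace Ω]
    [∀ i, MeasurableSpace (β i)] (P : Measure Ω) [IsProbabilityMeasure P] (b : ∀ i, β i) :
    iIndepFun (fun i (_ : Ω) => b i) P := by
  rw [iIndepFun_iff_measure_inter_preimage_eq_mul]
  intro T B hB
  by_cases h : ∀ i ∈ T, b i ∈ B i
  · have h1 : ∀ i ∈ T, (fun _ : Ω => b i) ⁻¹' B i = Set.univ := fun i hi =>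
      Set.preimage_const_of_mem (h i hi)
    rw [Finset.prod_congr rfl fun i hi => by rw [h1 i hi, measure_univ],
      Set.iInter₂_congr h1]
    simp
  · push Not at h
    obtain ⟨i, hi, hb⟩ := h
    have h1 : (fun _ : Ω => b i) ⁻¹' B i = ∅ := Set.preimage_const_of_notMem hb
    rw [Finset.prod_eq_zero hi (by rw [h1, measure_empty])]
    exact measure_mono_null (Set.biInter_subset_of_mem hi) (by rw [h1, measure_empty])

/-- On the empty space the only measure is `0`. -/
lemma isPoissonLaw_dirac_of_isEmpty (h0 : (0 : Measure Z) ∈ S) :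
    IsPoissonLaw ν (Measure.dirac (⟨0, h0⟩ : S)) := by
  refine ⟨inferInstance, fun l A hA hd hf => ?_⟩
  have hA0 : ∀ i, A i = ∅ := fun i => Set.eq_empty_of_isEmpty _
  simp only [hA0, measure_empty]
  refine ⟨iIndepFun_const _ _, fun i => ?_⟩
  rw [ENNReal.toNNReal_zero, poissonMeasure_zero, Measure.map_dirac' measurable_const,
    Measure.map_dirac' .of_discrete, Nat.cast_zero]

lemma existsUnique_isPoissonLaw_of_isEmpty (h0 : (0 : Measure Z) ∈ S) :
    ∃! Pν : Measure S, IsPoissonLaw ν Pν := by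
  have hν : ν = 0 := Measure.eq_zero_of_isEmpty ν
  have : SigmaFinite ν := by rw [hν]; infer_instance
  exact ⟨_, isPoissonLaw_dirac_of_isEmpty h0,
    fun P hP => hP.unique (isPoissonLaw_dirac_of_isEmpty h0)⟩

lemma transportEntropyInequality_martonCost_of_isEmpty (α : ℝ → ℝ≥0∞) (c₁ c₂ : ℝ≥0∞)
    (P : Measure S) : TransportEntropyInequality (martonCost α) c₁ c₂ P := by
  intro P₁ P₂ hP₁ hP₂
  refine (transportCost_le (Kernel.const _ P₂) (by simp)).trans ?_
  simp [martonCost, Measure.eq_zero_of_isEmpty]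

end EmptySpace

end

theorem theorem3p7 {Z : Type*} [MetricSpace Z] [CompleteSpace Z]
    [TopologicalSpace.SeparableSpace Z] [MeasurableSpace Z] [BorelSpace Z]
    (ν : Measure Z) [SigmaFinite ν] [IsLocallyFiniteMeasure ν]
    (S : Set (Measure Z))
    (hS : (S = configurations Z ∧ ∀ (x : Z) (r : ℝ), ν (Metric.closedBall x r) < ∞) ∨
      S = locallyFiniteConfigurations Z ∨
      (S = finiteMeasures Z ∧ IsFiniteMeasure ν)) :
    (∃! Pν : Measure S, IsPoissonLaw ν Pν) ∧
    ∀ Pν : Measure S, IsPoissonLaw ν Pν →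
      (∀ t ∈ Set.Icc (0 : ℝ) 1,
        TransportEntropyInequality (martonCost (demboFunction t))
          (ENNReal.ofReal t)⁻¹ (ENNReal.ofReal (1 - t))⁻¹ Pν) ∧
      TransportEntropyInequality (martonCost fun u => ENNReal.ofReal (u ^ 2)) 4 4 Pν := by
  rcases isEmpty_or_nonempty Z with hZ | hZ
  · have h0 : (0 : Measure Z) ∈ S := by
      rcases hS with ⟨rfl, -⟩ | rfl | ⟨rfl, -⟩
      · exact fun x => hZ.elim x
      · exact fun x => hZ.elim x
      · exact (inferInstance : IsFiniteMeasure (0 : Measure Z))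
    exact ⟨existsUnique_isPoissonLaw_of_isEmpty h0, fun Pν _ =>
      ⟨fun t _ => transportEntropyInequality_martonCost_of_isEmpty _ _ _ Pν,
        transportEntropyInequality_martonCost_of_isEmpty _ _ _ Pν⟩⟩
  · have : SecondCountableTopology Z := UniformSpace.secondCountable_of_separable Z
    have hS' : IsConfigurationSpace ν S := by
      rcases hS with ⟨rfl, hν⟩ | rfl | ⟨rfl, hν⟩
      · exact isConfigurationSpace_configurations hν
      · exact isConfigurationSpace_locallyFiniteConfigurations
      · exact isConfigurationSpace_finiteMeasures
    exact ⟨existsUnique_isPoissonLaw hS', fun Pν hP =>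
      ⟨fun t ht => transportEntropyInequality_demboFunction hS' hP ht,
        transportEntropyInequality_sq hS' hP⟩⟩
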